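/- Let $D_2=\{\zeta=(\zeta_1,\zeta_2)\in\mathbb C^2:\operatorname{Im}\zeta_2-|\zeta_1|^2>0\}$ and $\mathbb R_+=(0,\infty)$, both $D_2$ and $\mathbb R\times\mathbb R_+$ carrying Lebesgue measure. For $n\ge 1$ let $\mathcal A^2_{(n,1)}(D_2)$ be the space of all $f\in L^2(D_2)\cap C^\infty(D_2)$ with $$\Big(\frac{\partial}{\partial\bar\zeta_1}-2i\zeta_1\frac{\partial}{\partial\bar\zeta_2}\Big)^{n}f=0,\qquad \frac{\partial f}{\partial\bar\zeta_2}=0 ,$$ which is a closed subspace of $L^2(D_2)$; let $B_{(n,1)}$ be the orthogonal projection of $L^2(D_2)$ onto it. Let $\mathcal D=\mathbb C\times(\mathbb R\times\mathbb R_+)$, with points $(x_1+iy_1,\,x_2+iy_2)$, $y_2>0$. Let $U=V_2V_1U_1U_0:L^2(D_2)\to L^2(\mathcal D)$, where $(U_0f)(w_1,w_2)=f(w_1,w_2+i|w_1|^2)$; $U_1=F\otimes I\otimes F\otimes I$ is the Fourier transform $(Fg)(t)=\frac1{\sqrt{2\pi}}\int_{\mathbb R}g(x)e^{-itx}\,dx$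 in the real parts of $w_1$ and $w_2$; $(V_1f)(\xi_1,t_2+is_2)=(2|t_2|)^{-1/2}f\big(\xi_1,t_2+i\tfrac{s_2}{2|t_2|}\big)$; and $(V_2g)(x_1+iy_1,z_2)=g\big(\sqrt{|x_2|}(x_1+y_1)+\tfrac{i}{2\sqrt{|x_2|}}(-x_1+y_1),\,z_2\big)$ with $x_2=\operatorname{Re}z_2$. Let $$h_m(y)=\frac{(-1)^m}{(2^m\sqrt\pi\,m!)^{1/2}}\,e^{y^2/2}\frac{d^m}{dy^m}e^{-y^2},\qquad \ell_0(y)=e^{-y/2},\qquad H=(h_0,\dots,h_{n-1})^T,$$ let $R_{0(n,1)}:(L^2(\mathbb R\times\mathbb R_+))^n\to L^2(\mathcal D)$ be given by $(R_{0(n,1)}g)(x_1,y_1,x_2,y_2)=\chi_{\mathbb R_+}(x_2)\,\ell_0(y_2)\,H(y_1)^Tg(x_1,x_2)$, and put $R_{(n,1)}=R_{0(n,1)}^*U$. Let $c:\mathbb R\times\mathbb R_+\to\mathbb C$ be such that $\tilde c(\zeta)=c(\operatorname{Im}\zeta_1,\operatorname{Im}\zeta_2-|\zeta_1|^2)$ belongs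 to $L^\infty(D_2)$ (a bounded nilpotent symbol), and let $T_cf=B_{(n,1)}(\tilde cf)$ be the Toeplitz operator on $\mathcal A^2_{(n,1)}(D_2)$. Then $R_{(n,1)}$ maps $\mathcal A^2_{(n,1)}(D_2)$ unitarily onto $(L^2(\mathbb R\times\mathbb R_+))^n$, the inverse of this unitary operator is $R_{(n,1)}^*$, and $T_c$ is unitarily equivalent to a multiplication operator: $$R_{(n,1)}T_cR_{(n,1)}^*=\gamma^cI ,$$ where the matrix-valued function $\gamma^c:\mathbb R\times\mathbb R_+\to M_n(\mathbb C)$ is given by the absolutely convergent integral $$\gamma^c(x_1,x_2)=\int_{\mathbb R}\int_{\mathbb R_+}c\Big(\frac{-x_1+y_1}{2\sqrt{x_2}},\frac{y_2}{2x_2}\Big)\,\ell_0(y_2)^2\,H(y_1)H(y_1)^T\,dy_2\,dy_1 .$$ -/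

import Mathlib

open MeasureTheory
open scoped ENNReal Real
set_option linter.unusedSectionVars false
noncomputable section
namespace SiegelToeplitz

section Curry
variable {X Y : Type*} [MeasurableSpace X] [MeasurableSpace Y]

lemma measurable_of_edist_const {E : Type*} [PseudoEMetricSpace E]
    [SecondCountableTopology E] [MeasurableSpace E] [BorelSpace E] {φ : Y → E}
    (h : ∀ g : E, Measurable fun y => edist (φ y) g) : Measurable φ := by
  have hb : TopologicalSpace.IsTopologicalBasis
      {s : Set E | ∃ (g : E) (r : ℝ≥0∞), s = Metric.eball g r} := by
    refine TopologicalSpace.isTopologicalBasis_of_isOpen_of_nhds ?_ ?_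
    · rintro _ ⟨g, r, rfl⟩; exact Metric.isOpen_eball
    · intro a u ha hu
      obtain ⟨r, hr, hru⟩ := EMetric.isOpen_iff.1 hu a ha
      exact ⟨_, ⟨a, r, rfl⟩, Metric.mem_eball_self hr, hru⟩
  rw [BorelSpace.measurable_eq (α := E), hb.borel_eq_generateFrom]
  refine measurable_generateFrom ?_
  rintro _ ⟨g, r, rfl⟩
  exact measurableSet_lt (h g) measurable_const

/-- The slice `f(·, y)` as an element of `L²(μ)` (zero if it is not square integrable). -/
def sliceLp (μ : Measure X) (f : X × Y → ℂ) (y : Y) : Lp ℂ 2 μ :=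
  open Classical in
  if h : MemLp (fun x => f (x, y)) 2 μ then h.toLp _ else 0

variable {μ : Measure X} {ν : Measure Y}

lemma sliceLp_coeFn {f : X × Y → ℂ} {y : Y} (h : MemLp (fun x => f (x, y)) 2 μ) :
    sliceLp μ f y =ᵐ[μ] fun x => f (x, y) := by
  rw [sliceLp, dif_pos h]; exact h.coeFn_toLp

lemma eLpNorm_two_sq {Z E : Type*} [MeasurableSpace Z] [NormedAddCommGroup E] (ρ : Measure Z)
    (f : Z → E) : (eLpNorm f 2 ρ) ^ 2 = ∫⁻ z, ‖f z‖ₑ ^ 2 ∂ρ := by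
  have := eLpNorm_nnreal_pow_eq_lintegral (f := f) (μ := ρ) (p := 2) (by norm_num)
  simpa using this

lemma eLpNorm_two_eq_of_sq {Z Z' E E' : Type*} [MeasurableSpace Z] [MeasurableSpace Z']
    [NormedAddCommGroup E] [NormedAddCommGroup E'] {ρ : Measure Z} {ρ' : Measure Z'}
    {f : Z → E} {g : Z' → E'} (h : ∫⁻ z, ‖f z‖ₑ ^ 2 ∂ρ = ∫⁻ z, ‖g z‖ₑ ^ 2 ∂ρ') :
    eLpNorm f 2 ρ = eLpNorm g 2 ρ' := by
  rw [← eLpNorm_two_sq, ← eLpNorm_two_sq] at h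
  exact (ENNReal.pow_right_strictMono two_ne_zero).injective h

lemma measurable_eLpNorm_slice [SFinite μ] {f : X × Y → ℂ} (hf : Measurable f) :
    Measurable fun y => eLpNorm (fun x => f (x, y)) 2 μ := by
  simp_rw [eLpNorm_eq_lintegral_rpow_enorm_toReal (two_ne_zero) (ENNReal.ofNat_ne_top)]
  refine Measurable.pow_const ?_ _
  exact Measurable.lintegral_prod_left' (f := fun p : X × Y => ‖f p‖ₑ ^ (2 : ℝ≥0∞).toReal)
    (hf.enorm.pow_const _)

lemma stronglyMeasurable_sliceLp [MeasurableSpace.CountablyGenerated X] [SFinite μ]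
    {f : X × Y → ℂ} (hf : Measurable f) : StronglyMeasurable (sliceLp μ f) := by
  have : Fact ((2 : ℝ≥0∞) ≠ ∞) := ⟨ENNReal.ofNat_ne_top⟩
  let _ : MeasurableSpace (Lp ℂ 2 μ) := borel _
  have : BorelSpace (Lp ℂ 2 μ) := ⟨rfl⟩
  refine Measurable.stronglyMeasurable (measurable_of_edist_const fun g => ?_)
  have hS : MeasurableSet {y | MemLp (fun x => f (x, y)) 2 μ} := by
    have : {y | MemLp (fun x => f (x, y)) 2 μ} = {y | eLpNorm (fun x => f (x, y)) 2 μ < ∞} := by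
      ext y
      exact ⟨fun h => h.2, fun h => ⟨(hf.comp (by fun_prop)).aestronglyMeasurable, h⟩⟩
    rw [this]
    exact measurableSet_lt (measurable_eLpNorm_slice hf) measurable_const
  have hg : Measurable fun p : X × Y => f p - g p.1 :=
    hf.sub ((Lp.stronglyMeasurable g).measurable.comp measurable_fst)
  have h1 : Measurable fun y => eLpNorm (fun x => f (x, y) - g x) 2 μ :=
    measurable_eLpNorm_slice (f := fun p => f p - g p.1) hg
  classical
  set S := {y | MemLp (fun x => f (x, y)) 2 μ} with hSdef
  have h2 : (fun y => edist (sliceLp μ f y) g) =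
      S.piecewise (fun y => eLpNorm (fun x => f (x, y) - g x) 2 μ) (fun _ => edist 0 g) := by
    ext y
    by_cases h : y ∈ S
    · rw [Set.piecewise_eq_of_mem S _ _ h, Lp.edist_def]
      refine eLpNorm_congr_ae ?_
      filter_upwards [sliceLp_coeFn (μ := μ) (f := f) (y := y) h] with x hx
      rw [Pi.sub_apply, hx]
    · rw [Set.piecewise_eq_of_notMem S _ _ h, sliceLp, dif_neg (by exact h)]
  rw [h2]
  exact Measurable.piecewise hS h1 measurable_const

lemma ae_memLp_slice [SFinite μ] [SFinite ν] {f : X × Y → ℂ} (hf : Measurable f)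
    (h : MemLp f 2 (μ.prod ν)) : ∀ᵐ y ∂ν, MemLp (fun x => f (x, y)) 2 μ := by
  have h2 : ∫⁻ z, ‖f z‖ₑ ^ 2 ∂(μ.prod ν) < ∞ := by
    rw [← eLpNorm_two_sq]; exact ENNReal.pow_lt_top h.2
  have hm : Measurable fun z => ‖f z‖ₑ ^ 2 := hf.enorm.pow_const _
  rw [lintegral_prod_symm _ hm.aemeasurable] at h2
  filter_upwards [ae_lt_top (hm.lintegral_prod_left') h2.ne] with y hy
  refine ⟨(hf.comp (by fun_prop)).aestronglyMeasurable, ?_⟩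
  rw [← eLpNorm_two_sq] at hy
  exact (ENNReal.pow_lt_top_iff.1 hy).resolve_right two_ne_zero

lemma eLpNorm_sliceLp [SFinite μ] [SFinite ν] {f : X × Y → ℂ} (hf : Measurable f)
    (h : MemLp f 2 (μ.prod ν)) : eLpNorm (sliceLp μ f) 2 ν = eLpNorm f 2 (μ.prod ν) := by
  refine eLpNorm_two_eq_of_sq ?_
  have hm : Measurable fun z => ‖f z‖ₑ ^ 2 := hf.enorm.pow_const _
  rw [lintegral_prod_symm _ hm.aemeasurable]
  refine lintegral_congr_ae ?_
  filter_upwards [ae_memLp_slice hf h] with y hy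
  rw [← eLpNorm_two_sq, Lp.enorm_def, eLpNorm_congr_ae (sliceLp_coeFn hy)]

variable [MeasurableSpace.CountablyGenerated X] [SFinite μ] [SFinite ν]

lemma memLp_sliceLp (F : Lp ℂ 2 (μ.prod ν)) : MemLp (sliceLp μ (F : X × Y → ℂ)) 2 ν := by
  have hF := (Lp.stronglyMeasurable F).measurable
  refine ⟨(stronglyMeasurable_sliceLp hF).aestronglyMeasurable, ?_⟩
  rw [eLpNorm_sliceLp hF (Lp.memLp F)]
  exact (Lp.memLp F).2

lemma ae_slice_of_ae {p : X × Y → Prop} (h : ∀ᵐ z ∂μ.prod ν, p z) :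
    ∀ᵐ y ∂ν, ∀ᵐ x ∂μ, p (x, y) :=
  Measure.ae_ae_of_ae_prod (p := fun z : Y × X => p z.swap)
    (Measure.measurePreserving_swap.quasiMeasurePreserving.ae h)

lemma ae_sliceLp_coeFn (F : Lp ℂ 2 (μ.prod ν)) :
    ∀ᵐ y ∂ν, sliceLp μ (F : X × Y → ℂ) y =ᵐ[μ] fun x => F (x, y) := by
  filter_upwards [ae_memLp_slice (Lp.stronglyMeasurable F).measurable (Lp.memLp F)] with y hy
  exact sliceLp_coeFn hy

variable (μ ν) in
/-- The isometry `L²(X × Y) → L²(Y; L²(X))`, `F ↦ (y ↦ F(·, y))`. -/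
def curryIsometry : Lp ℂ 2 (μ.prod ν) →ₗᵢ[ℂ] Lp (Lp ℂ 2 μ) 2 ν where
  toFun F := (memLp_sliceLp F).toLp _
  map_add' F G := by
    rw [← MemLp.toLp_add]
    refine MemLp.toLp_congr _ _ ?_
    filter_upwards [ae_sliceLp_coeFn F, ae_sliceLp_coeFn G, ae_sliceLp_coeFn (F + G),
      ae_slice_of_ae (Lp.coeFn_add F G)] with y h1 h2 h3 h4
    refine Lp.ext ?_
    refine (h3.trans ?_).trans (Lp.coeFn_add _ _).symm
    filter_upwards [h1, h2, h4] with x a b c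
    rw [c, Pi.add_apply, Pi.add_apply, a, b]
  map_smul' r F := by
    rw [RingHom.id_apply, ← MemLp.toLp_const_smul]
    refine MemLp.toLp_congr _ _ ?_
    filter_upwards [ae_sliceLp_coeFn F, ae_sliceLp_coeFn (r • F),
      ae_slice_of_ae (Lp.coeFn_smul r F)] with y h1 h3 h4
    refine Lp.ext ?_
    refine (h3.trans ?_).trans (Lp.coeFn_smul _ _).symm
    filter_upwards [h1, h4] with x a c
    rw [c, Pi.smul_apply, Pi.smul_apply, a]
  norm_map' F := by
    change ‖(memLp_sliceLp F).toLp _‖ = ‖F‖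
    rw [Lp.norm_toLp, Lp.norm_def,
      eLpNorm_sliceLp (Lp.stronglyMeasurable F).measurable (Lp.memLp F)]

lemma curryIsometry_coeFn (F : Lp ℂ 2 (μ.prod ν)) :
    ∀ᵐ y ∂ν, (curryIsometry μ ν F y : X → ℂ) =ᵐ[μ] fun x => F (x, y) := by
  filter_upwards [(memLp_sliceLp F).coeFn_toLp, ae_sliceLp_coeFn F] with y h1 h2
  change ((memLp_sliceLp F).toLp _ : Y → Lp ℂ 2 μ) y =ᵐ[μ] _
  rw [h1]; exact h2

lemma curryIsometry_surjective : Function.Surjective (curryIsometry μ ν) := by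
  classical
  intro G
  have hcl : IsClosed (Set.range (curryIsometry μ ν)) :=
    (curryIsometry μ ν).isometry.isClosedEmbedding.isClosed_range
  refine Lp.induction (p := 2) (μ := ν) ENNReal.ofNat_ne_top
    (motive := fun G => G ∈ Set.range (curryIsometry μ ν)) ?_ ?_ hcl G
  · intro v s hs hsν
    have hv := (Lp.stronglyMeasurable v).measurable
    let f : X × Y → ℂ := fun z => s.indicator (fun _ => v z.1) z.2
    have hf : Measurable f := by
      have : f = (Set.univ ×ˢ s).indicator fun z => v z.1 := by
        ext z; simp [f, Set.indicator, Set.mem_prod]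
      rw [this]
      exact (hv.comp measurable_fst).indicator (MeasurableSet.univ.prod hs)
    have hsl : ∀ y, (fun x => f (x, y)) = if y ∈ s then (v : X → ℂ) else 0 := by
      intro y; ext x; by_cases h : y ∈ s <;> simp [f, h]
    have hm : MemLp f 2 (μ.prod ν) := by
      refine ⟨hf.aestronglyMeasurable, ?_⟩
      have h2 : ∫⁻ z, ‖f z‖ₑ ^ 2 ∂(μ.prod ν) < ∞ := by
        rw [lintegral_prod_symm _ (hf.enorm.pow_const _).aemeasurable]
        have : ∀ y, ∫⁻ x, ‖f (x, y)‖ₑ ^ 2 ∂μ = s.indicator (fun _ => ‖v‖ₑ ^ 2) y := by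
          intro y
          rw [← eLpNorm_two_sq, hsl]
          by_cases h : y ∈ s <;> simp [h, Lp.enorm_def]
        simp_rw [this]
        rw [lintegral_indicator_const hs]
        exact ENNReal.mul_lt_top (ENNReal.pow_lt_top enorm_lt_top) hsν
      rw [← eLpNorm_two_sq] at h2
      exact (ENNReal.pow_lt_top_iff.1 h2).resolve_right two_ne_zero
    refine ⟨hm.toLp f, ?_⟩
    refine Lp.ext ?_
    rw [Lp.simpleFunc.coe_indicatorConst]
    filter_upwards [curryIsometry_coeFn (hm.toLp f), ae_slice_of_ae hm.coeFn_toLp,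
      indicatorConstLp_coeFn (p := 2) (hs := hs) (hμs := hsν.ne) (c := v)] with y h1 h2 h3
    rw [h3]
    refine Lp.ext (h1.trans (Filter.EventuallyEq.trans h2 ?_))
    rw [hsl]
    by_cases h : y ∈ s
    · simp [h]
    · simpa [h] using (Lp.coeFn_zero ℂ 2 μ).symm
  · rintro f g hf hg - ⟨F, hF⟩ ⟨G, hG⟩
    exact ⟨F + G, by rw [map_add, hF, hG]⟩

variable (μ ν) in
/-- The unitary `L²(X × Y) ≃ L²(Y; L²(X))`, `F ↦ (y ↦ F(·, y))`. -/
def curryEquiv : Lp ℂ 2 (μ.prod ν) ≃ₗᵢ[ℂ] Lp (Lp ℂ 2 μ) 2 ν :=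
  LinearIsometryEquiv.ofSurjective (curryIsometry μ ν) curryIsometry_surjective

/-- The operator `A ⊗ I` on `L²(X × Y)`, acting by `A` on every slice `F(·, y)`. -/
def tensorId (A : Lp ℂ 2 μ →L[ℂ] Lp ℂ 2 μ) : Lp ℂ 2 (μ.prod ν) →L[ℂ] Lp ℂ 2 (μ.prod ν) :=
  (curryEquiv μ ν).symm.toContinuousLinearEquiv.toContinuousLinearMap ∘L
    (A.compLpL 2 ν) ∘L (curryEquiv μ ν).toContinuousLinearEquiv.toContinuousLinearMap

end Curry

section WeightedComp
variable {X Y : Type*} [MeasurableSpace X] [MeasurableSpace Y] {μ : Measure X} {ν : Measure Y}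
  {ω : X → ℂ} {φ : X → Y}

lemma ae_comp_of_ae (hω : Measurable ω) (hφ : Measurable φ)
    (h : (μ.withDensity fun x => ‖ω x‖ₑ ^ 2).map φ = ν) {p : Y → Prop} (hp : ∀ᵐ y ∂ν, p y) :
    ∀ᵐ x ∂μ, ω x ≠ 0 → p (φ x) := by
  rw [← h] at hp
  have h2 := (ae_withDensity_iff (hω.enorm.pow_const 2)).1 (ae_of_ae_map hφ.aemeasurable hp)
  filter_upwards [h2] with x hx h0
  exact hx (by simpa using h0)

lemma eLpNorm_weightedComp (hω : Measurable ω) (hφ : Measurable φ)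
    (h : (μ.withDensity fun x => ‖ω x‖ₑ ^ 2).map φ = ν) (f : Lp ℂ 2 ν) :
    eLpNorm (fun x => ω x * f (φ x)) 2 μ = eLpNorm f 2 ν := by
  refine eLpNorm_two_eq_of_sq ?_
  have hf : Measurable fun y => ‖f y‖ₑ ^ 2 :=
    (Lp.stronglyMeasurable f).measurable.enorm.pow_const 2
  have key : ∀ F : Y → ℝ≥0∞, Measurable F → ∫⁻ y, F y ∂ν = ∫⁻ x, ‖ω x‖ₑ ^ 2 * F (φ x) ∂μ := by
    intro F hF
    rw [← h, lintegral_map hF hφ]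
    exact lintegral_withDensity_eq_lintegral_mul _ (hω.enorm.pow_const 2) (hF.comp hφ)
  rw [key _ hf]
  simp only [enorm_mul, mul_pow]

lemma memLp_weightedComp (hω : Measurable ω) (hφ : Measurable φ)
    (h : (μ.withDensity fun x => ‖ω x‖ₑ ^ 2).map φ = ν) (f : Lp ℂ 2 ν) :
    MemLp (fun x => ω x * f (φ x)) 2 μ := by
  refine ⟨(hω.mul ((Lp.stronglyMeasurable f).measurable.comp hφ)).aestronglyMeasurable, ?_⟩
  rw [eLpNorm_weightedComp hω hφ h]
  exact (Lp.memLp f).2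

/-- The weighted composition operator `f ↦ ω · (f ∘ φ)` as an isometry `L²(ν) → L²(μ)`; the
hypothesis says that `∫ |ω|² (F ∘ φ) dμ = ∫ F dν`. -/
def weightedComp (ω : X → ℂ) (φ : X → Y) (hω : Measurable ω) (hφ : Measurable φ)
    (h : (μ.withDensity fun x => ‖ω x‖ₑ ^ 2).map φ = ν) : Lp ℂ 2 ν →ₗᵢ[ℂ] Lp ℂ 2 μ where
  toFun f := (memLp_weightedComp hω hφ h f).toLp _
  map_add' f g := by
    rw [← MemLp.toLp_add]
    refine MemLp.toLp_congr _ _ ?_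
    filter_upwards [ae_comp_of_ae hω hφ h (Lp.coeFn_add f g)] with x hx
    by_cases h0 : ω x = 0
    · simp [h0]
    · rw [Pi.add_apply, hx h0, Pi.add_apply, mul_add]
  map_smul' r f := by
    rw [RingHom.id_apply, ← MemLp.toLp_const_smul]
    refine MemLp.toLp_congr _ _ ?_
    filter_upwards [ae_comp_of_ae hω hφ h (Lp.coeFn_smul r f)] with x hx
    by_cases h0 : ω x = 0
    · simp [h0]
    · rw [Pi.smul_apply, hx h0, Pi.smul_apply, smul_eq_mul, smul_eq_mul, mul_left_comm]
  norm_map' f := by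
    change ‖(memLp_weightedComp hω hφ h f).toLp _‖ = ‖f‖
    rw [Lp.norm_toLp, Lp.norm_def, eLpNorm_weightedComp hω hφ h]

end WeightedComp

section ExtendTensor
variable {X Y : Type*} [MeasurableSpace X] [MeasurableSpace Y] {μ : Measure X} {ν : Measure Y}
  [SFinite μ] [SFinite ν] {A : Set X} {φ : Y → ℂ}

lemma ae_indicator_of_ae (hA : MeasurableSet A) {p : X → Prop}
    (hp : ∀ᵐ x ∂μ.restrict A, p x) : ∀ᵐ z ∂μ.prod ν, z.1 ∈ A → p z.1 :=
  Measure.quasiMeasurePreserving_fst.ae ((ae_restrict_iff' hA).1 hp)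

lemma eLpNorm_extendTensor (hA : MeasurableSet A) (hφ : MemLp φ 2 ν) (g : Lp ℂ 2 (μ.restrict A)) :
    eLpNorm (fun z : X × Y => A.indicator g z.1 * φ z.2) 2 (μ.prod ν) =
      eLpNorm φ 2 ν * eLpNorm g 2 (μ.restrict A) := by
  have hg := (Lp.stronglyMeasurable g).measurable
  refine (ENNReal.pow_right_strictMono two_ne_zero).injective ?_
  simp only [mul_pow, eLpNorm_two_sq, enorm_mul]
  rw [lintegral_prod_mul (f := fun x => ‖A.indicator g x‖ₑ ^ 2) (g := fun y => ‖φ y‖ₑ ^ 2)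
    ((hg.indicator hA).enorm.pow_const 2).aemeasurable (hφ.1.enorm.pow_const 2), mul_comm]
  congr 1
  rw [← lintegral_indicator hA]
  refine lintegral_congr fun x => ?_
  by_cases h : x ∈ A <;> simp [h]

lemma memLp_extendTensor (hA : MeasurableSet A) (hφ : MemLp φ 2 ν) (g : Lp ℂ 2 (μ.restrict A)) :
    MemLp (fun z : X × Y => A.indicator g z.1 * φ z.2) 2 (μ.prod ν) := by
  have hg := (Lp.stronglyMeasurable g).measurable
  refine ⟨((hg.indicator hA).comp measurable_fst).aestronglyMeasurable.mul hφ.1.comp_snd, ?_⟩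
  rw [eLpNorm_extendTensor hA hφ]
  exact ENNReal.mul_lt_top hφ.2 (Lp.memLp g).2

variable (μ) in
/-- The operator `L²(A) → L²(X × Y)`, `g ↦ ((x, y) ↦ χ_A(x) g(x) φ(y))`. -/
def extendTensor (hA : MeasurableSet A) (hφ : MemLp φ 2 ν) :
    Lp ℂ 2 (μ.restrict A) →L[ℂ] Lp ℂ 2 (μ.prod ν) :=
  LinearMap.mkContinuous
    { toFun := fun g => (memLp_extendTensor hA hφ g).toLp _
      map_add' := fun f g => by
        rw [← MemLp.toLp_add]
        refine MemLp.toLp_congr _ _ ?_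
        filter_upwards [ae_indicator_of_ae hA (Lp.coeFn_add f g)] with z hz
        by_cases h : z.1 ∈ A
        · simp only [Pi.add_apply, Set.indicator_of_mem h, hz h, add_mul]
        · simp [h]
      map_smul' := fun r f => by
        rw [RingHom.id_apply, ← MemLp.toLp_const_smul]
        refine MemLp.toLp_congr _ _ ?_
        filter_upwards [ae_indicator_of_ae hA (Lp.coeFn_smul r f)] with z hz
        by_cases h : z.1 ∈ A
        · simp only [Pi.smul_apply, Set.indicator_of_mem h, hz h, smul_eq_mul, mul_assoc]
        · simp [h] }
    (eLpNorm φ 2 ν).toReal fun g => by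
      change ‖(memLp_extendTensor hA hφ g).toLp _‖ ≤ _
      rw [Lp.norm_toLp, Lp.norm_def, eLpNorm_extendTensor hA hφ, ENNReal.toReal_mul]

end ExtendTensor

/-- The Siegel domain `D₂ ⊂ ℂ²`. -/
def siegelDomain : Set (ℂ × ℂ) := {ζ | 0 < ζ.2.im - ‖ζ.1‖ ^ 2}

/-- The half-plane `ℝ × ℝ₊`. -/
def halfPlane : Set (ℝ × ℝ) := {x | 0 < x.2}

lemma measurableSet_siegelDomain : MeasurableSet siegelDomain :=
  measurableSet_lt measurable_const (by fun_prop)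

lemma measurableSet_halfPlane : MeasurableSet halfPlane :=
  measurableSet_lt measurable_const measurable_snd

/-- Lebesgue measure on `D₂`. -/
abbrev siegelMeasure : Measure (ℂ × ℂ) := volume.restrict siegelDomain

/-- Lebesgue measure on `ℝ × ℝ₊`. -/
abbrev halfPlaneMeasure : Measure (ℝ × ℝ) := volume.restrict halfPlane

/-- Lebesgue measure on the flat domain `𝒟 = ℂ × Π`.  A point `(x₁ + i y₁, x₂ + i y₂)` of `𝒟` is
written `((x₁, x₂), (y₁, y₂))`, with `(x₁, x₂) ∈ ℝ²` and `(y₁, y₂) ∈ ℝ × ℝ₊`. -/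
abbrev flatMeasure : Measure ((ℝ × ℝ) × (ℝ × ℝ)) := (volume : Measure (ℝ × ℝ)).prod halfPlaneMeasure

lemma flatMeasure_eq : flatMeasure = volume.restrict {p : (ℝ × ℝ) × (ℝ × ℝ) | 0 < p.2.2} := by
  have : {p : (ℝ × ℝ) × (ℝ × ℝ) | 0 < p.2.2} = Set.univ ×ˢ halfPlane := by
    ext p; simp [halfPlane]
  rw [this, Measure.volume_eq_prod, ← Measure.prod_restrict, Measure.restrict_univ]

/-- Exchange of the two middle coordinates. -/
lemma measurePreserving_middle : MeasurePreserving
    (fun p : (ℝ × ℝ) × (ℝ × ℝ) => ((p.1.1, p.2.1), (p.1.2, p.2.2))) := by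
  have hm : Measurable (fun p : (ℝ × ℝ) × (ℝ × ℝ) => ((p.1.1, p.2.1), (p.1.2, p.2.2))) := by
    fun_prop
  refine ⟨hm, ?_⟩
  simp only [Measure.volume_eq_prod]
  symm
  refine (Measure.prod_eq_generateFrom generateFrom_prod generateFrom_prod isPiSystem_prod
    isPiSystem_prod ((volume : Measure ℝ).toFiniteSpanningSetsIn.prod
      (volume : Measure ℝ).toFiniteSpanningSetsIn)
    ((volume : Measure ℝ).toFiniteSpanningSetsIn.prod
      (volume : Measure ℝ).toFiniteSpanningSetsIn) ?_)
  rintro _ ⟨a, ha, b, hb, rfl⟩ _ ⟨c, hc, d, hd, rfl⟩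
  simp only [Set.mem_ofPred_eq] at ha hb hc hd
  rw [Measure.map_apply hm ((ha.prod hb).prod (hc.prod hd))]
  have : (fun p : (ℝ × ℝ) × (ℝ × ℝ) => ((p.1.1, p.2.1), (p.1.2, p.2.2))) ⁻¹'
      ((a ×ˢ b) ×ˢ (c ×ˢ d)) = (a ×ˢ c) ×ˢ (b ×ˢ d) := by
    ext p; simp only [Set.mem_preimage, Set.mem_prod]; tauto
  rw [this]
  simp only [Measure.prod_prod]
  ring

/-- `κ(w₁, w₂) = (w₁, w₂ + i|w₁|²)`, where `w = (u₁ + i v₁, u₂ + i v₂)`. -/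
def kappa (p : (ℝ × ℝ) × (ℝ × ℝ)) : ℂ × ℂ :=
  let w₁ : ℂ := ⟨p.1.1, p.2.1⟩
  let w₂ : ℂ := ⟨p.1.2, p.2.2⟩
  (w₁, w₂ + Complex.I * (‖w₁‖ : ℂ) ^ 2)

lemma measurePreserving_kappa : MeasurePreserving kappa flatMeasure siegelMeasure := by
  have h1 : MeasurePreserving (fun p : (ℝ × ℝ) × (ℝ × ℝ) =>
      (Complex.measurableEquivRealProd.symm (p.1.1, p.2.1),
        Complex.measurableEquivRealProd.symm (p.1.2, p.2.2))) :=
    ((Complex.volume_preserving_equiv_real_prod.symm).prod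
      (Complex.volume_preserving_equiv_real_prod.symm)).comp measurePreserving_middle
  have h2 : MeasurePreserving (fun w : ℂ × ℂ => (w.1, w.2 + Complex.I * (‖w.1‖ : ℂ) ^ 2)) := by
    refine MeasurePreserving.skew_product (g := fun a b => b + Complex.I * (‖a‖ : ℂ) ^ 2)
      (MeasurePreserving.id _) (by fun_prop) ?_
    exact Filter.Eventually.of_forall fun a => (measurePreserving_add_right volume _).map_eq
  have h3 : MeasurePreserving kappa volume volume := h2.comp h1
  have h4 := h3.restrict_preimage measurableSet_siegelDomain
  have h5 : kappa ⁻¹' siegelDomain = {p | 0 < p.2.2} := by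
    ext p
    simp [kappa, siegelDomain, ← Complex.ofReal_pow]
  rwa [h5, ← flatMeasure_eq] at h4

/-- The unitary `U₀ f = f ∘ κ`. -/
def opU₀ : Lp ℂ 2 siegelMeasure →L[ℂ] Lp ℂ 2 flatMeasure :=
  (Lp.compMeasurePreservingₗᵢ ℂ kappa measurePreserving_kappa).toContinuousLinearMap

/-- `ψ₁(t₁ + i s₁, t₂ + i s₂) = (t₁ + i s₁, t₂ + i s₂ / (2|t₂|))`. -/
def psi₁ (p : (ℝ × ℝ) × (ℝ × ℝ)) : (ℝ × ℝ) × (ℝ × ℝ) :=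
  ((p.1.1, p.1.2), (p.2.1, p.2.2 / (2 * |p.1.2|)))

/-- `ψ₂(x₁ + i y₁, x₂ + i y₂) = (√|x₂| (x₁ + y₁) + i (-x₁ + y₁) / (2√|x₂|), x₂ + i y₂)`. -/
def psi₂ (p : (ℝ × ℝ) × (ℝ × ℝ)) : (ℝ × ℝ) × (ℝ × ℝ) :=
  ((√|p.1.2| * (p.1.1 + p.2.1), p.1.2), (1 / (2 * √|p.1.2|) * (-p.1.1 + p.2.1), p.2.2))

/-- The weight `(2|t₂|)^{-1/2}` of `V₁`. -/
def weight₁ (p : (ℝ × ℝ) × (ℝ × ℝ)) : ℂ := ((1 / √(2 * |p.1.2|) : ℝ) : ℂ)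

lemma ae_snd_ne_zero : ∀ᵐ x : ℝ × ℝ, x.2 ≠ 0 := by
  rw [Measure.volume_eq_prod]
  exact Measure.quasiMeasurePreserving_snd.ae (p := fun x : ℝ => x ≠ 0) (Measure.ae_ne volume 0)

lemma map_scale (a : ℝ) (ha : 0 < a) :
    (ENNReal.ofReal a⁻¹) • Measure.map (fun s : ℝ => s / a) (volume.restrict (Set.Ioi 0)) =
      volume.restrict (Set.Ioi 0) := by
  have h := Real.smul_map_volume_mul_right (a := a⁻¹) (by positivity)
  have h2 : (fun s : ℝ => s / a) ⁻¹' (Set.Ioi 0) = Set.Ioi 0 := by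
    ext s; simp [ha]
  rw [← h2, ← Measure.restrict_map (by fun_prop) measurableSet_Ioi, ← Measure.restrict_smul]
  rw [abs_of_pos (by positivity)] at h
  simp only [div_eq_mul_inv]
  conv_lhs => rw [h]
  simp [← div_eq_mul_inv, h2]

lemma measurable_psi₁ : Measurable psi₁ := by
  unfold psi₁; fun_prop

lemma measurable_weight₁ : Measurable weight₁ := by
  unfold weight₁; fun_prop

lemma halfPlaneMeasure_eq :
    halfPlaneMeasure = (volume : Measure ℝ).prod (volume.restrict (Set.Ioi 0)) := by
  have : halfPlane = Set.univ ×ˢ Set.Ioi 0 := by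
    ext p; simp [halfPlane]
  rw [halfPlaneMeasure, this, Measure.volume_eq_prod, ← Measure.prod_restrict,
    Measure.restrict_univ]

lemma map_psi₁ : (flatMeasure.withDensity fun p => ‖weight₁ p‖ₑ ^ 2).map psi₁ = flatMeasure := by
  refine Measure.ext_of_lintegral _ fun F hF => ?_
  have hG : Measurable fun p => ‖weight₁ p‖ₑ ^ 2 * F (psi₁ p) :=
    (measurable_weight₁.enorm.pow_const 2).mul (hF.comp measurable_psi₁)
  have h1 : ∫⁻ p, F p ∂(flatMeasure.withDensity fun p => ‖weight₁ p‖ₑ ^ 2).map psi₁ =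
      ∫⁻ p, ‖weight₁ p‖ₑ ^ 2 * F (psi₁ p) ∂flatMeasure := by
    rw [lintegral_map hF measurable_psi₁]
    exact lintegral_withDensity_eq_lintegral_mul _ (measurable_weight₁.enorm.pow_const 2)
      (hF.comp measurable_psi₁)
  rw [h1, flatMeasure, lintegral_prod _ hG.aemeasurable, lintegral_prod _ hF.aemeasurable]
  refine lintegral_congr_ae ?_
  filter_upwards [ae_snd_ne_zero] with t ht
  have ha : 0 < 2 * |t.2| := by positivity
  have hG' : Measurable fun y : ℝ × ℝ => ‖weight₁ (t, y)‖ₑ ^ 2 * F (psi₁ (t, y)) :=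
    hG.comp measurable_prodMk_left
  have hF' : Measurable fun y : ℝ × ℝ => F (t, y) := hF.comp measurable_prodMk_left
  rw [halfPlaneMeasure_eq, lintegral_prod _ hG'.aemeasurable, lintegral_prod _ hF'.aemeasurable]
  refine lintegral_congr fun s₁ => ?_
  have hw : ∀ s₂, ‖weight₁ (t, (s₁, s₂))‖ₑ ^ 2 = ENNReal.ofReal (2 * |t.2|)⁻¹ := by
    intro s₂
    rw [weight₁, ← ofReal_norm, Complex.norm_real, Real.norm_eq_abs,
      ← ENNReal.ofReal_pow (abs_nonneg _), sq_abs, div_pow, Real.sq_sqrt ha.le, one_pow, one_div]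
  simp only [hw]
  have hF'' : Measurable fun s₂ : ℝ => F (t, (s₁, s₂)) := hF'.comp measurable_prodMk_left
  conv_rhs => rw [← map_scale _ ha, lintegral_smul_measure,
    lintegral_map hF'' (by fun_prop), smul_eq_mul]
  exact lintegral_const_mul _
    (hF''.comp (by fun_prop : Measurable fun s : ℝ => s / (2 * |t.2|)))

/-- The unitary `(V₁ f)(ξ) = (2|t₂|)^{-1/2} f(ψ₁(ξ))`. -/
def opV₁ : Lp ℂ 2 flatMeasure →L[ℂ] Lp ℂ 2 flatMeasure :=
  (weightedComp weight₁ psi₁ measurable_weight₁ measurable_psi₁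
    map_psi₁).toContinuousLinearMap

lemma map_shear (r : ℝ) (hr : 0 < r) :
    Measure.map (fun q : ℝ × ℝ => (r * (q.1 + q.2), 1 / (2 * r) * (-q.1 + q.2))) volume =
      volume := by
  let M : Matrix (Fin 2) (Fin 2) ℝ := !![r, r; -(1 / (2 * r)), 1 / (2 * r)]
  let b : Module.Basis (Fin 2) ℝ (ℝ × ℝ) := Module.Basis.finTwoProd ℝ
  have hdet : LinearMap.det (Matrix.toLin b b M) = 1 := by
    rw [LinearMap.det_toLin, Matrix.det_fin_two_of]
    field_simp
    norm_num
  have hfun : (fun q : ℝ × ℝ => (r * (q.1 + q.2), 1 / (2 * r) * (-q.1 + q.2))) =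
      Matrix.toLin b b M := by
    ext q <;> rw [Matrix.toLin_finTwoProd_apply] <;> ring
  rw [hfun, Measure.map_linearMap_addHaar_eq_smul_addHaar volume (by rw [hdet]; norm_num), hdet]
  simp

lemma measurePreserving_psi₂ : MeasurePreserving psi₂ flatMeasure flatMeasure := by
  let g : ℝ × ℝ → ℝ × ℝ → ℝ × ℝ := fun a q =>
    (√|a.1| * (q.1 + q.2), 1 / (2 * √|a.1|) * (-q.1 + q.2))
  have hg : ∀ᵐ a : ℝ × ℝ, Measure.map (g a) volume = volume := by
    have h0 : ∀ᵐ a : ℝ × ℝ, a.1 ≠ 0 := by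
      rw [Measure.volume_eq_prod]
      exact Measure.quasiMeasurePreserving_fst.ae (p := fun x : ℝ => x ≠ 0)
        (Measure.ae_ne volume 0)
    filter_upwards [h0] with a ha
    exact map_shear _ (by positivity)
  have h1 : MeasurePreserving (fun p : (ℝ × ℝ) × (ℝ × ℝ) => (p.1, g p.1 p.2)) :=
    MeasurePreserving.skew_product (MeasurePreserving.id _) (by unfold g; fun_prop) hg
  have hs : MeasurePreserving (Prod.swap : (ℝ × ℝ) × (ℝ × ℝ) → (ℝ × ℝ) × (ℝ × ℝ)) :=
    Measure.measurePreserving_swap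
  have h2 : MeasurePreserving psi₂ volume volume :=
    measurePreserving_middle.comp (hs.comp (h1.comp (hs.comp measurePreserving_middle)))
  have hm : MeasurableSet {p : (ℝ × ℝ) × (ℝ × ℝ) | 0 < p.2.2} :=
    measurableSet_lt measurable_const (by fun_prop)
  have h3 := h2.restrict_preimage hm
  rw [flatMeasure_eq]
  exact h3

/-- The unitary `V₂ g = g ∘ ψ₂`. -/
def opV₂ : Lp ℂ 2 flatMeasure →L[ℂ] Lp ℂ 2 flatMeasure :=
  (Lp.compMeasurePreservingₗᵢ ℂ psi₂ measurePreserving_psi₂).toContinuousLinearMap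

/-- `t ↦ (t₁ + i t₂) / (2π)`. -/
def dilate (t : ℝ × ℝ) : ℂ := ⟨t.1 / (2 * π), t.2 / (2 * π)⟩

lemma measurable_dilate : Measurable dilate :=
  Complex.measurableEquivRealProd.symm.measurable.comp
    (g := Complex.measurableEquivRealProd.symm) (f := fun t : ℝ × ℝ => (t.1 / (2 * π), t.2 / (2 * π)))
    (by fun_prop)

lemma map_dilate : (volume.withDensity fun _ : ℝ × ℝ => ‖((2 * π : ℝ) : ℂ)⁻¹‖ₑ ^ 2).map dilate =
    (volume : Measure ℂ) := by
  have h1 : dilate = (fun z : ℂ => (2 * π)⁻¹ • z) ∘ Complex.measurableEquivRealProd.symm := by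
    ext t
    apply Complex.ext <;> simp [dilate, div_eq_inv_mul]
  have h3 : Measurable (fun z : ℂ => (2 * π)⁻¹ • z) := by fun_prop
  rw [withDensity_const, Measure.map_smul, h1,
    ← Measure.map_map h3 Complex.measurableEquivRealProd.symm.measurable,
    Complex.volume_preserving_equiv_real_prod.symm.map_eq,
    Measure.map_addHaar_smul volume (by positivity), smul_smul, Complex.finrank_real_complex]
  have : ‖((2 * π : ℝ) : ℂ)⁻¹‖ₑ ^ 2 * ENNReal.ofReal |(((2 * π)⁻¹ ^ 2)⁻¹ : ℝ)| = 1 := by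
    rw [← Complex.ofReal_inv, ← ofReal_norm, Complex.norm_real, Real.norm_eq_abs,
      abs_of_pos (by positivity), abs_of_pos (by positivity), ← ENNReal.ofReal_pow (by positivity),
      ← ENNReal.ofReal_mul (by positivity), mul_inv_cancel₀ (by positivity), ENNReal.ofReal_one]
  rw [this, one_smul]

/-- The two-dimensional Fourier transform `F ⊗ F` on `L²(ℝ²)`,
`(2π)⁻¹ ∫∫ g(x₁, x₂) e^{-i(t₁x₁ + t₂x₂)} dx₁ dx₂`.  It is the Fourier–Plancherel transform
`∫ G(z) e^{-2πi ⟪z, ζ⟫} dz` of `L²(ℂ)`, `ℂ = ℝ²`, evaluated at `ζ = t / (2π)` and divided by `2π`. -/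
def fourier₂ : Lp ℂ 2 (volume : Measure (ℝ × ℝ)) →L[ℂ] Lp ℂ 2 (volume : Measure (ℝ × ℝ)) :=
  (weightedComp (fun _ => ((2 * π : ℝ) : ℂ)⁻¹) dilate measurable_const measurable_dilate
      map_dilate).toContinuousLinearMap ∘L
    (Lp.fourierTransformₗᵢ ℂ ℂ).toContinuousLinearEquiv.toContinuousLinearMap ∘L
    (Lp.compMeasurePreservingₗᵢ ℂ Complex.measurableEquivRealProd
      Complex.volume_preserving_equiv_real_prod).toContinuousLinearMap

/-- The unitary `U₁ = F ⊗ I ⊗ F ⊗ I`: Fourier transform in `(u₁, u₂)`, identity in `(v₁, v₂)`. -/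
def opU₁ : Lp ℂ 2 flatMeasure →L[ℂ] Lp ℂ 2 flatMeasure := tensorId fourier₂

/-- The unitary `U = V₂ V₁ U₁ U₀` from `L²(D₂)` onto `L²(𝒟)`. -/
def opU : Lp ℂ 2 siegelMeasure →L[ℂ] Lp ℂ 2 flatMeasure := opV₂ ∘L opV₁ ∘L opU₁ ∘L opU₀

/-- The Hermite polynomial `H_m(y) = (-1)^m e^{y²} (d/dy)^m e^{-y²}`. -/
def hermitePoly (m : ℕ) (y : ℝ) : ℝ :=
  (-1) ^ m * Real.exp (y ^ 2) * iteratedDeriv m (fun t : ℝ => Real.exp (-t ^ 2)) y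

/-- The Hermite function `h_m(y) = (2^m √π m!)^{-1/2} H_m(y) e^{-y²/2}`. -/
def hermiteFun (m : ℕ) (y : ℝ) : ℝ :=
  1 / √(2 ^ m * √π * (m.factorial : ℝ)) * hermitePoly m y * Real.exp (-y ^ 2 / 2)

/-- The Laguerre function `ℓ₀(y) = e^{-y/2}`. -/
def laguerreFun₀ (y : ℝ) : ℝ := Real.exp (-y / 2)

lemma exists_iteratedDeriv_gaussian (m : ℕ) : ∃ p : Polynomial ℝ,
    iteratedDeriv m (fun t : ℝ => Real.exp (-t ^ 2)) = fun y => p.eval y * Real.exp (-y ^ 2) := by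
  induction m with
  | zero => exact ⟨1, by simp⟩
  | succ m ih =>
    obtain ⟨p, hp⟩ := ih
    refine ⟨Polynomial.derivative p - 2 * Polynomial.X * p, ?_⟩
    rw [iteratedDeriv_succ, hp]
    ext y
    have h1 : HasDerivAt (fun t : ℝ => Real.exp (-t ^ 2)) (Real.exp (-y ^ 2) * (-(2 * y))) y := by
      have := ((hasDerivAt_pow 2 y).neg).exp
      simpa using this
    have h2 : HasDerivAt (fun y => p.eval y * Real.exp (-y ^ 2)) _ y := (p.hasDerivAt y).mul h1
    rw [h2.deriv]
    simp only [Polynomial.eval_sub, Polynomial.eval_mul, Polynomial.eval_X, Polynomial.eval_ofNat]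
    ring

lemma exists_hermiteFun_eq (m : ℕ) :
    ∃ p : Polynomial ℝ, hermiteFun m = fun y => p.eval y * Real.exp (-y ^ 2 / 2) := by
  obtain ⟨p, hp⟩ := exists_iteratedDeriv_gaussian m
  refine ⟨Polynomial.C (1 / √(2 ^ m * √π * (m.factorial : ℝ)) * (-1) ^ m) * p, ?_⟩
  ext y
  have : Real.exp (y ^ 2) * Real.exp (-y ^ 2) = 1 := by rw [← Real.exp_add]; simp
  simp only [hermiteFun, hermitePoly, hp, Polynomial.eval_mul, Polynomial.eval_C]
  linear_combination (1 / √(2 ^ m * √π * (m.factorial : ℝ)) * (-1) ^ m * p.eval y *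
    Real.exp (-y ^ 2 / 2)) * this

lemma continuous_hermiteFun (m : ℕ) : Continuous (hermiteFun m) := by
  obtain ⟨p, hp⟩ := exists_hermiteFun_eq m
  rw [hp]
  fun_prop

lemma integrable_polynomial_mul_gaussian (p : Polynomial ℝ) :
    Integrable fun y : ℝ => p.eval y * Real.exp (-1 * y ^ 2) := by
  induction p using Polynomial.induction_on' with
  | add p q hp hq =>
    simp only [Polynomial.eval_add, add_mul]
    exact hp.add hq
  | monomial n a =>
    have := (integrable_rpow_mul_exp_neg_mul_sq (b := 1) one_pos (s := n)
      (by have : (0 : ℝ) ≤ n := n.cast_nonneg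
          linarith)).const_mul a
    simpa only [Polynomial.eval_monomial, Real.rpow_natCast, mul_assoc] using this

lemma integrable_hermiteFun_sq (m : ℕ) : Integrable fun y => hermiteFun m y ^ 2 := by
  obtain ⟨p, hp⟩ := exists_hermiteFun_eq m
  refine (integrable_polynomial_mul_gaussian (p ^ 2)).congr (Filter.Eventually.of_forall fun y => ?_)
  simp only [hp, mul_pow, Polynomial.eval_pow, ← Real.exp_nat_mul]
  congr 2
  push_cast
  ring

lemma integrableOn_laguerreFun₀_sq :
    Integrable (fun y => laguerreFun₀ y ^ 2) (volume.restrict (Set.Ioi 0)) := by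
  refine (integrableOn_exp_neg_Ioi 0).congr (Filter.Eventually.of_forall fun y => ?_)
  simp only [laguerreFun₀, ← Real.exp_nat_mul]
  congr 1
  push_cast
  ring

/-- The function `h_m(y₁) ℓ₀(y₂)`. -/
def basisFun (m : ℕ) (y : ℝ × ℝ) : ℂ := (hermiteFun m y.1 : ℂ) * (laguerreFun₀ y.2 : ℂ)

lemma memLp_basisFun (m : ℕ) : MemLp (basisFun m) 2 halfPlaneMeasure := by
  have hc : Continuous (basisFun m) := by
    have := continuous_hermiteFun m
    unfold basisFun laguerreFun₀
    fun_prop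
  rw [memLp_two_iff_integrable_sq_norm hc.aestronglyMeasurable, halfPlaneMeasure_eq]
  refine ((integrable_hermiteFun_sq m).mul_prod integrableOn_laguerreFun₀_sq).congr
    (Filter.Eventually.of_forall fun y => ?_)
  simp [basisFun, mul_pow]

/-- The Hilbert space `(L²(ℝ × ℝ₊))ⁿ`. -/
abbrev L2n (n : ℕ) : Type := PiLp 2 fun _ : Fin n => Lp ℂ 2 halfPlaneMeasure

/-- `(R_{0(n,1)} g)(x₁, y₁, x₂, y₂) = χ_{ℝ₊}(x₂) ℓ₀(y₂) H(y₁)ᵀ g(x₁, x₂)`, with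
`H = (h₀, …, h_{n-1})ᵀ`. -/
def opR₀ (n : ℕ) : L2n n →L[ℂ] Lp ℂ 2 flatMeasure :=
  ∑ k : Fin n, extendTensor volume measurableSet_halfPlane (memLp_basisFun k) ∘L
    PiLp.proj 2 (fun _ : Fin n => Lp ℂ 2 halfPlaneMeasure) k

/-- The Bargmann-type transform `R_{(n,1)} = R_{0(n,1)}^* U`. -/
def opR (n : ℕ) : Lp ℂ 2 siegelMeasure →L[ℂ] L2n n :=
  ContinuousLinearMap.adjoint (opR₀ n) ∘L opU

/-- `∂/∂ζ̄₁ = (∂/∂u₁ + i ∂/∂v₁) / 2` on functions of `(ζ₁, ζ₂) ∈ ℂ²`. -/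
def dbar₁ (f : ℂ × ℂ → ℂ) (ζ : ℂ × ℂ) : ℂ :=
  (fderiv ℝ f ζ (1, 0) + Complex.I * fderiv ℝ f ζ (Complex.I, 0)) / 2

/-- `∂/∂ζ̄₂ = (∂/∂u₂ + i ∂/∂v₂) / 2` on functions of `(ζ₁, ζ₂) ∈ ℂ²`. -/
def dbar₂ (f : ℂ × ℂ → ℂ) (ζ : ℂ × ℂ) : ℂ :=
  (fderiv ℝ f ζ (0, 1) + Complex.I * fderiv ℝ f ζ (0, Complex.I)) / 2

/-- `∂/∂ζ̄₁ - 2 i ζ₁ ∂/∂ζ̄₂`. -/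
def tangentialDbar (f : ℂ × ℂ → ℂ) (ζ : ℂ × ℂ) : ℂ :=
  dbar₁ f ζ - 2 * Complex.I * ζ.1 * dbar₂ f ζ

/-- `(j, k)`-analytic functions on `D₂`. -/
structure IsPolyAnalytic (j k : ℕ) (f : ℂ × ℂ → ℂ) : Prop where
  smooth : ContDiffOn ℝ (⊤ : ℕ∞) f siegelDomain
  tangential : ∀ ζ ∈ siegelDomain, (tangentialDbar^[j]) f ζ = 0
  transversal : ∀ ζ ∈ siegelDomain, (dbar₂^[k]) f ζ = 0

lemma isOpen_siegelDomain : IsOpen siegelDomain :=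
  isOpen_lt continuous_const (by fun_prop)

/-- An operator that preserves smoothness on `D₂` and acts locally and linearly; used only to show
that the `(j, k)`-analytic functions form a vector space. -/
structure IsLocalLinear (D : (ℂ × ℂ → ℂ) → ℂ × ℂ → ℂ) : Prop where
  smooth : ∀ f, ContDiffOn ℝ (⊤ : ℕ∞) f siegelDomain → ContDiffOn ℝ (⊤ : ℕ∞) (D f) siegelDomain
  congr : ∀ f g, Set.EqOn f g siegelDomain → Set.EqOn (D f) (D g) siegelDomain
  comb : ∀ (f g : ℂ × ℂ → ℂ) (r : ℂ), ContDiffOn ℝ (⊤ : ℕ∞) f siegelDomain →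
    ContDiffOn ℝ (⊤ : ℕ∞) g siegelDomain →
    Set.EqOn (D (fun z => r * f z + g z)) (fun z => r * D f z + D g z) siegelDomain

lemma IsLocalLinear.iterate_comb {D : (ℂ × ℂ → ℂ) → ℂ × ℂ → ℂ} (hD : IsLocalLinear D) (m : ℕ) :
    ∀ (f g : ℂ × ℂ → ℂ) (r : ℂ), ContDiffOn ℝ (⊤ : ℕ∞) f siegelDomain →
      ContDiffOn ℝ (⊤ : ℕ∞) g siegelDomain →
      Set.EqOn (D^[m] (fun z => r * f z + g z)) (fun z => r * D^[m] f z + D^[m] g z)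
        siegelDomain := by
  have hit : ∀ m f g, Set.EqOn f g siegelDomain → Set.EqOn (D^[m] f) (D^[m] g) siegelDomain := by
    intro m
    induction m with
    | zero => exact fun f g h => h
    | succ m ih => exact fun f g h => ih _ _ (hD.congr _ _ h)
  induction m with
  | zero => exact fun f g r _ _ _ _ => rfl
  | succ m ih =>
    intro f g r hf hg
    exact (hit m _ _ (hD.comb f g r hf hg)).trans (ih _ _ r (hD.smooth f hf) (hD.smooth g hg))

lemma fderiv_comb {f g : ℂ × ℂ → ℂ} (r : ℂ) (hf : ContDiffOn ℝ (⊤ : ℕ∞) f siegelDomain)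
    (hg : ContDiffOn ℝ (⊤ : ℕ∞) g siegelDomain) {ζ : ℂ × ℂ} (hζ : ζ ∈ siegelDomain) (v : ℂ × ℂ) :
    fderiv ℝ (fun z => r * f z + g z) ζ v = r * fderiv ℝ f ζ v + fderiv ℝ g ζ v := by
  have hn := isOpen_siegelDomain.mem_nhds hζ
  have h1 : DifferentiableAt ℝ f ζ := (hf.contDiffAt hn).differentiableAt (by simp)
  have h2 : DifferentiableAt ℝ g ζ := (hg.contDiffAt hn).differentiableAt (by simp)
  rw [fderiv_fun_add (h1.const_mul r) h2, fderiv_const_mul h1]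
  simp

lemma contDiffOn_fderiv_apply {f : ℂ × ℂ → ℂ} (hf : ContDiffOn ℝ (⊤ : ℕ∞) f siegelDomain) (v : ℂ × ℂ) :
    ContDiffOn ℝ (⊤ : ℕ∞) (fun ζ => fderiv ℝ f ζ v) siegelDomain :=
  (hf.fderiv_of_isOpen isOpen_siegelDomain (by simp)).clm_apply contDiffOn_const

lemma fderiv_congr_on {f g : ℂ × ℂ → ℂ} (h : Set.EqOn f g siegelDomain) {ζ : ℂ × ℂ}
    (hζ : ζ ∈ siegelDomain) : fderiv ℝ f ζ = fderiv ℝ g ζ :=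
  (h.eventuallyEq_of_mem (isOpen_siegelDomain.mem_nhds hζ)).fderiv_eq

lemma isLocalLinear_dbar₁ : IsLocalLinear dbar₁ where
  smooth f hf := ((contDiffOn_fderiv_apply hf _).add
    (contDiffOn_const.mul (contDiffOn_fderiv_apply hf _))).div_const 2
  congr f g h ζ hζ := by simp only [dbar₁, fderiv_congr_on h hζ]
  comb f g r hf hg ζ hζ := by
    simp only [dbar₁, fderiv_comb r hf hg hζ]; ring

lemma isLocalLinear_dbar₂ : IsLocalLinear dbar₂ where
  smooth f hf := ((contDiffOn_fderiv_apply hf _).add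
    (contDiffOn_const.mul (contDiffOn_fderiv_apply hf _))).div_const 2
  congr f g h ζ hζ := by simp only [dbar₂, fderiv_congr_on h hζ]
  comb f g r hf hg ζ hζ := by
    simp only [dbar₂, fderiv_comb r hf hg hζ]; ring

lemma isLocalLinear_tangentialDbar : IsLocalLinear tangentialDbar where
  smooth f hf := (isLocalLinear_dbar₁.smooth f hf).sub
    ((contDiffOn_const.mul contDiff_fst.contDiffOn).mul (isLocalLinear_dbar₂.smooth f hf))
  congr f g h ζ hζ := by
    simp only [tangentialDbar, isLocalLinear_dbar₁.congr f g h hζ,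
      isLocalLinear_dbar₂.congr f g h hζ]
  comb f g r hf hg ζ hζ := by
    simp only [tangentialDbar, isLocalLinear_dbar₁.comb f g r hf hg hζ,
      isLocalLinear_dbar₂.comb f g r hf hg hζ]; ring

lemma IsPolyAnalytic.comb {j k : ℕ} {f g : ℂ × ℂ → ℂ} (r : ℂ) (hf : IsPolyAnalytic j k f)
    (hg : IsPolyAnalytic j k g) : IsPolyAnalytic j k fun z => r * f z + g z where
  smooth := (contDiffOn_const.mul hf.smooth).add hg.smooth
  tangential ζ hζ := by
    rw [isLocalLinear_tangentialDbar.iterate_comb j f g r hf.smooth hg.smooth hζ]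
    simp [hf.tangential ζ hζ, hg.tangential ζ hζ]
  transversal ζ hζ := by
    rw [isLocalLinear_dbar₂.iterate_comb k f g r hf.smooth hg.smooth hζ]
    simp [hf.transversal ζ hζ, hg.transversal ζ hζ]

lemma iterate_apply_zero {D : (ℂ × ℂ → ℂ) → ℂ × ℂ → ℂ} (hD : D 0 = 0) (m : ℕ) :
    D^[m] 0 = 0 := by
  induction m with
  | zero => rfl
  | succ m ih => rw [Function.iterate_succ_apply, hD, ih]

lemma dbar₂_zero : dbar₂ 0 = 0 := by
  ext ζ; simp [dbar₂]

lemma tangentialDbar_zero : tangentialDbar 0 = 0 := by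
  ext ζ; simp [tangentialDbar, dbar₁, dbar₂]

lemma isPolyAnalytic_zero (j k : ℕ) : IsPolyAnalytic j k 0 where
  smooth := contDiffOn_const
  tangential ζ _ := by rw [iterate_apply_zero tangentialDbar_zero]; rfl
  transversal ζ _ := by rw [iterate_apply_zero dbar₂_zero]; rfl

/-- The poly-Bergman-type space `A²_{(j,k)}(D₂)`: the square integrable `(j, k)`-analytic
functions, as a subspace of `L²(D₂)`. -/
def polyBergman (j k : ℕ) : Submodule ℂ (Lp ℂ 2 siegelMeasure) where
  carrier := {F | ∃ f, IsPolyAnalytic j k f ∧ F =ᵐ[siegelMeasure] f}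
  zero_mem' := ⟨0, isPolyAnalytic_zero j k, Lp.coeFn_zero _ _ _⟩
  add_mem' := by
    rintro F G ⟨f, hf, hF⟩ ⟨g, hg, hG⟩
    refine ⟨_, hf.comb 1 hg, ?_⟩
    filter_upwards [Lp.coeFn_add F G, hF, hG] with z h1 h2 h3
    rw [h1, Pi.add_apply, h2, h3, one_mul]
  smul_mem' := by
    rintro r F ⟨f, hf, hF⟩
    refine ⟨_, hf.comb r (isPolyAnalytic_zero j k), ?_⟩
    filter_upwards [Lp.coeFn_smul r F, hF] with z h1 h2
    rw [h1, Pi.smul_apply, h2, smul_eq_mul, Pi.zero_apply, add_zero]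

/-- The function `c̃(ζ₁, ζ₂) = c(Im ζ₁, Im ζ₂ - |ζ₁|²)`. -/
def nilpotentSymbol (c : ℝ × ℝ → ℂ) (ζ : ℂ × ℂ) : ℂ := c (ζ.1.im, ζ.2.im - ‖ζ.1‖ ^ 2)

/-- The multiplication operator `M_a` on `L²(D₂)`, for `a ∈ L^∞(D₂)`. -/
def mulOp (a : Lp ℂ ∞ siegelMeasure) : Lp ℂ 2 siegelMeasure →L[ℂ] Lp ℂ 2 siegelMeasure :=
  (ContinuousLinearMap.mul ℂ ℂ).holderL siegelMeasure ∞ 2 2 a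

/-- The Toeplitz operator `f ↦ B(a f)` on a subspace `K` of `L²(D₂)`, where `B` is the orthogonal
projection of `L²(D₂)` onto `K`. -/
def toeplitz (K : Submodule ℂ (Lp ℂ 2 siegelMeasure)) [K.HasOrthogonalProjection]
    (a : Lp ℂ ∞ siegelMeasure) : K →L[ℂ] K :=
  K.orthogonalProjectionOnto ∘L mulOp a ∘L K.subtypeL

/-- The integrand of the spectral function:
`c((-x₁ + y₁)/(2√x₂), y₂/(2x₂)) ℓ₀(y₂)² H(y₁) H(y₁)ᵀ`. -/
def gammaIntegrand (n : ℕ) (c : ℝ × ℝ → ℂ) (x y : ℝ × ℝ) : Matrix (Fin n) (Fin n) ℂ :=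
  Matrix.of fun j k => c ((-x.1 + y.1) / (2 * √x.2), y.2 / (2 * x.2)) *
    (laguerreFun₀ y.2 : ℂ) ^ 2 * ((hermiteFun j y.1 : ℂ) * (hermiteFun k y.1 : ℂ))

/-- The matrix-valued spectral function
`γ^c(x₁, x₂) = ∫_ℝ ∫_{ℝ₊} c((-x₁ + y₁)/(2√x₂), y₂/(2x₂)) ℓ₀(y₂)² H(y₁) H(y₁)ᵀ dy₂ dy₁`. -/
def gammaFun (n : ℕ) (c : ℝ × ℝ → ℂ) (x : ℝ × ℝ) : Matrix (Fin n) (Fin n) ℂ :=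
  Matrix.of fun j k => ∫ y₁ : ℝ, ∫ y₂ in Set.Ioi (0 : ℝ), gammaIntegrand n c x (y₁, y₂) j k

end SiegelToeplitz

end

open SiegelToeplitz

/-!
The operators `U` and `R₀ = R_{0(n,1)}` are isometries: `U` because each of `U₀`, `U₁`, `V₁`, `V₂`
is, and `R₀` because the functions `h_k(y₁) ℓ₀(y₂)` are orthonormal (`norm_opU`, `norm_opR₀`).
Everything follows from the identity `U(A²_{(n,1)}(D₂)) = range R₀` (`mem_polyBergman_iff`). It makes
`A²_{(n,1)}(D₂)` closed, it makes `R = R₀^* U` unitary on that space with inverse `R^* = U^* R₀`, and,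
since `U` turns multiplication by the symbol into multiplication by
`c((-x₁ + y₁) / (2√x₂), y₂ / (2x₂))` (`opU_mul`), it turns the Toeplitz operator into the compression
of that multiplication to the fibres spanned by the `h_k ℓ₀`, which is the matrix `γ^c(x₁, x₂)`
(`opR_mul_coeFn`).

*The range of `R₀` is contained in the image* (`exists_polyBergman_opU_eq`). Given `g`, undoing `V₁`,
`V₂` and the Fourier transform leads to the explicit function
`f(ζ) = ∑_{l < n} (Im ζ₁)^l ∫ m_l(x, t) exp(i t ζ₂ + 2i √t x ζ₁ + t ζ₁² - x²/2) dx dt`,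
where the `m_l` come from the Taylor expansion of the Hermite polynomials. The integrals converge
locally uniformly on `D₂`, so their values are holomorphic and `f` is `(n, 1)`-analytic.

*The image is contained in the range of `R₀`* (`exists_opR₀_eq_opU`). An `(n, 1)`-analytic `f` is
`∑_{l < n} (Im ζ₁)^l a_l` with holomorphic `a_l` (`IsPolyAnalytic.exists_hasImExpansion`).
Suppose first that the `a_l` decay fast enough for all integrals below to converge. Then
`∫ a_l(w, z) e^{-itz} dz` over a horizontal line does not depend on the line; it vanishes for `t < 0`
and is an entire function of `w` for `t > 0`. In the Fourier integral over `Re ζ₁`, completing the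
square in the exponent and shifting the contour `Im w = v₁` to the real axis leaves the factor
`e^{-y₁²/2} e^{-y₂/2}` times a function of `x` alone. As `(Im ζ₁)^l` is a polynomial of degree `l` in
`y₁`, the result is a combination of the `h_k ℓ₀` on each fibre (`exists_opR₀_eq_opU_of_decay`).
A general square integrable `f` is the `L²`-limit of `ζ ↦ f(ζ₁, ζ₂ + iε)` as `ε → 0`. By a mean value
inequality for polyanalytic functions, the coefficients of these translates grow at most
polynomially (`exists_coeff_growth`), so after multiplication by `(i / (δζ₂ + i))^M`, which tends to
`1` as `δ → 0`, the first case applies; the range of `R₀` is closed.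
-/

namespace SiegelToeplitz

/-! ### Pointwise formulas for the operators `U` and `R₀` -/

section OperatorFormulas
variable {X Y : Type*} [MeasurableSpace X] [MeasurableSpace Y] {μ : Measure X} {ν : Measure Y}

lemma weightedComp_coeFn {ω : X → ℂ} {φ : X → Y} (hω : Measurable ω) (hφ : Measurable φ)
    (h : (μ.withDensity fun x => ‖ω x‖ₑ ^ 2).map φ = ν) (f : Lp ℂ 2 ν) :
    weightedComp ω φ hω hφ h f =ᵐ[μ] fun x => ω x * f (φ x) :=
  (memLp_weightedComp hω hφ h f).coeFn_toLp

lemma curryEquiv_coeFn [SFinite μ] [SFinite ν] [MeasurableSpace.CountablyGenerated X]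
    (F : Lp ℂ 2 (μ.prod ν)) :
    ∀ᵐ y ∂ν, (curryEquiv μ ν F y : X → ℂ) =ᵐ[μ] fun x => F (x, y) :=
  curryIsometry_coeFn F

lemma tensorId_slice [SFinite μ] [SFinite ν] [MeasurableSpace.CountablyGenerated X]
    (A : Lp ℂ 2 μ →L[ℂ] Lp ℂ 2 μ) (F : Lp ℂ 2 (μ.prod ν)) :
    ∀ᵐ y ∂ν, curryEquiv μ ν (tensorId A F) y = A (curryEquiv μ ν F y) := by
  have : curryEquiv μ ν (tensorId A F) = A.compLpL 2 ν (curryEquiv μ ν F) := by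
    simp [tensorId]
  rw [this]
  exact A.coeFn_compLpL _

lemma tensorId_eq_of_slice [SFinite μ] [SFinite ν] [MeasurableSpace.CountablyGenerated X]
    (A : Lp ℂ 2 μ →L[ℂ] Lp ℂ 2 μ) (F G : Lp ℂ 2 (μ.prod ν))
    (h : ∀ᵐ y ∂ν, A (curryEquiv μ ν F y) = curryEquiv μ ν G y) : tensorId A F = G := by
  refine (curryEquiv μ ν).injective (Lp.ext ?_)
  filter_upwards [tensorId_slice A F, h] with y h1 h2
  rw [h1, h2]

lemma norm_tensorId [SFinite μ] [SFinite ν] [MeasurableSpace.CountablyGenerated X]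
    (A : Lp ℂ 2 μ →L[ℂ] Lp ℂ 2 μ) (hA : ∀ f, ‖A f‖ = ‖f‖) (F : Lp ℂ 2 (μ.prod ν)) :
    ‖tensorId A F‖ = ‖F‖ := by
  rw [← (curryEquiv μ ν).norm_map, ← (curryEquiv μ ν).norm_map F, Lp.norm_def, Lp.norm_def]
  congr 1
  refine eLpNorm_congr_norm_ae ?_
  filter_upwards [tensorId_slice A F] with y hy
  rw [hy, hA]

lemma extendTensor_coeFn [SFinite μ] [SFinite ν] {A : Set X} {φ : Y → ℂ} (hA : MeasurableSet A)
    (hφ : MemLp φ 2 ν) (g : Lp ℂ 2 (μ.restrict A)) :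
    extendTensor μ hA hφ g =ᵐ[μ.prod ν] fun z => A.indicator g z.1 * φ z.2 :=
  (memLp_extendTensor hA hφ g).coeFn_toLp

end OperatorFormulas

lemma opU₀_coeFn (f : Lp ℂ 2 siegelMeasure) : opU₀ f =ᵐ[flatMeasure] f ∘ kappa :=
  Lp.coeFn_compMeasurePreserving f measurePreserving_kappa

lemma opV₁_coeFn (f : Lp ℂ 2 flatMeasure) :
    opV₁ f =ᵐ[flatMeasure] fun p => weight₁ p * f (psi₁ p) :=
  weightedComp_coeFn measurable_weight₁ measurable_psi₁ map_psi₁ f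

lemma opV₂_coeFn (f : Lp ℂ 2 flatMeasure) : opV₂ f =ᵐ[flatMeasure] f ∘ psi₂ :=
  Lp.coeFn_compMeasurePreserving f measurePreserving_psi₂

lemma ae_comp_psi₁ {P : (ℝ × ℝ) × (ℝ × ℝ) → Prop} (h : ∀ᵐ p ∂flatMeasure, P p) :
    ∀ᵐ p ∂flatMeasure, P (psi₁ p) := by
  have h2 := ae_comp_of_ae measurable_weight₁ measurable_psi₁ map_psi₁ h
  have h3 : ∀ᵐ p ∂flatMeasure, p.1.2 ≠ 0 :=
    Measure.quasiMeasurePreserving_fst.ae ae_snd_ne_zero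
  filter_upwards [h2, h3] with p hp h0
  refine hp ?_
  have : 0 < √(2 * |p.1.2|) := by positivity
  simp only [weight₁, ne_eq, Complex.ofReal_eq_zero]
  positivity

lemma ae_comp_psi₂ {P : (ℝ × ℝ) × (ℝ × ℝ) → Prop} (h : ∀ᵐ p ∂flatMeasure, P p) :
    ∀ᵐ p ∂flatMeasure, P (psi₂ p) :=
  measurePreserving_psi₂.quasiMeasurePreserving.ae h

/-- The operator `V₂ V₁` as a single weighted substitution. -/
lemma opV₂_opV₁_coeFn (f : Lp ℂ 2 flatMeasure) :
    opV₂ (opV₁ f) =ᵐ[flatMeasure] fun p => weight₁ (psi₂ p) * f (psi₁ (psi₂ p)) := by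
  filter_upwards [opV₂_coeFn (opV₁ f), ae_comp_psi₂ (opV₁_coeFn f)] with p h1 h2
  rw [h1, Function.comp_apply, h2]

lemma norm_fourier₂ (f : Lp ℂ 2 (volume : Measure (ℝ × ℝ))) : ‖fourier₂ f‖ = ‖f‖ := by
  simp only [fourier₂, ContinuousLinearMap.comp_apply, LinearIsometry.coe_toContinuousLinearMap,
    LinearIsometry.norm_map]
  erw [LinearIsometryEquiv.norm_map]
  exact LinearIsometry.norm_map _ f

lemma norm_opU (f : Lp ℂ 2 siegelMeasure) : ‖opU f‖ = ‖f‖ := by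
  simp only [opU, ContinuousLinearMap.comp_apply]
  rw [opV₂, LinearIsometry.coe_toContinuousLinearMap, LinearIsometry.norm_map, opV₁,
    LinearIsometry.coe_toContinuousLinearMap, LinearIsometry.norm_map, opU₁,
    norm_tensorId _ norm_fourier₂, opU₀, LinearIsometry.coe_toContinuousLinearMap,
    LinearIsometry.norm_map]

/-- Multiplication by a bounded function of the imaginary parts commutes with an operator acting
on the real parts. -/
lemma tensorId_mul {X Y : Type*} [MeasurableSpace X] [MeasurableSpace Y] {μ : Measure X}
    {ν : Measure Y} [SFinite μ] [SFinite ν] [MeasurableSpace.CountablyGenerated X]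
    (A : Lp ℂ 2 μ →L[ℂ] Lp ℂ 2 μ) (F G : Lp ℂ 2 (μ.prod ν)) (c : Y → ℂ)
    (h : G =ᵐ[μ.prod ν] fun z => c z.2 * F z) :
    ∀ᵐ y ∂ν, curryEquiv μ ν (tensorId A G) y = c y • curryEquiv μ ν (tensorId A F) y := by
  filter_upwards [tensorId_slice A F, tensorId_slice A G, ae_slice_of_ae h, curryEquiv_coeFn F,
    curryEquiv_coeFn G] with y h1 h2 h3 h4 h5
  rw [h1, h2, ← map_smul]
  congr 1
  refine Lp.ext ((h5.trans h3).trans ?_)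
  filter_upwards [h4, Lp.coeFn_smul (c y) (curryEquiv μ ν F y)] with x h6 h7
  rw [h7, Pi.smul_apply, h6, smul_eq_mul]

/-- In the flat coordinates, multiplication by a nilpotent symbol becomes multiplication by
`c((-x₁ + y₁) / (2√|x₂|), y₂ / (2|x₂|))`. -/
lemma opU_mul {c : ℝ × ℝ → ℂ} {C : ℝ} (hcm : AEStronglyMeasurable c halfPlaneMeasure)
    (hcb : ∀ᵐ y ∂halfPlaneMeasure, ‖c y‖ ≤ C) (f h : Lp ℂ 2 siegelMeasure)
    (hf : h =ᵐ[siegelMeasure] fun ζ => nilpotentSymbol c ζ * f ζ) :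
    opU h =ᵐ[flatMeasure] fun p => c ((psi₁ (psi₂ p)).2) * opU f p := by
  have h0 : opU₀ h =ᵐ[flatMeasure] fun p => c p.2 * opU₀ f p := by
    filter_upwards [opU₀_coeFn f, opU₀_coeFn h,
      measurePreserving_kappa.quasiMeasurePreserving.ae hf] with p h1 h2 h3
    rw [h1, h2, Function.comp_apply, h3, Function.comp_apply]
    simp [nilpotentSymbol, kappa, ← Complex.ofReal_pow]
  have h1 : ∀ᵐ y ∂halfPlaneMeasure, curryEquiv _ _ (opU₁ (opU₀ h)) y =
      c y • curryEquiv _ _ (opU₁ (opU₀ f)) y := tensorId_mul fourier₂ _ _ c h0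
  have hM : MemLp (fun p : (ℝ × ℝ) × (ℝ × ℝ) => c p.2 * opU₁ (opU₀ f) p) 2 flatMeasure := by
    have hb : MemLp (fun p : (ℝ × ℝ) × (ℝ × ℝ) => c p.2) ∞ flatMeasure :=
      memLp_top_of_bound hcm.comp_snd C (Measure.quasiMeasurePreserving_snd.ae hcb)
    exact (Lp.memLp (opU₁ (opU₀ f))).mul hb
  have h2 : opU₁ (opU₀ h) = hM.toLp _ := by
    refine (curryEquiv _ _).injective (Lp.ext ?_)
    filter_upwards [h1, curryEquiv_coeFn (hM.toLp _), ae_slice_of_ae hM.coeFn_toLp,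
      curryEquiv_coeFn (opU₁ (opU₀ f))] with y h1 h3 h4 h5
    rw [h1]
    refine Lp.ext (Filter.EventuallyEq.trans ?_ (h3.trans h4).symm)
    filter_upwards [h5, Lp.coeFn_smul (c y) (curryEquiv _ _ (opU₁ (opU₀ f)) y)] with x h6 h7
    rw [h7, Pi.smul_apply, smul_eq_mul, h6]
  simp only [opU, ContinuousLinearMap.comp_apply]
  filter_upwards [opV₂_opV₁_coeFn (opU₁ (opU₀ f)), opV₂_opV₁_coeFn (opU₁ (opU₀ h)),
    ae_comp_psi₂ (ae_comp_psi₁ (hM.coeFn_toLp))] with p h3 h4 h5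
  rw [h3, h4, h2, h5]
  ring

lemma opR₀_coeFn (n : ℕ) (g : L2n n) : opR₀ n g =ᵐ[flatMeasure]
    fun p => ∑ k : Fin n, halfPlane.indicator (g k) p.1 * basisFun k p.2 := by
  have h1 : opR₀ n g = ∑ k : Fin n, extendTensor volume measurableSet_halfPlane
      (memLp_basisFun k) (g k) := by
    simp [opR₀]
  rw [h1]
  have h2 : ∀ᵐ p ∂flatMeasure, ∀ k : Fin n, extendTensor volume measurableSet_halfPlane
      (memLp_basisFun k) (g k) p = halfPlane.indicator (g k) p.1 * basisFun k p.2 :=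
    ae_all_iff.2 fun k => extendTensor_coeFn measurableSet_halfPlane (memLp_basisFun k) (g k)
  filter_upwards [h2, Lp.coeFn_finsetSum Finset.univ fun k : Fin n => extendTensor volume
    measurableSet_halfPlane (memLp_basisFun k) (g k)] with p h3 h4
  rw [h4, Finset.sum_apply]
  exact Finset.sum_congr rfl fun k _ => h3 k

/-! ### Hermite functions and the isometry `R₀` -/

section Hermite
open Polynomial

/-- The Hermite polynomials `H_m` as elements of `ℝ[X]`. -/
noncomputable def hermitePolynomial : ℕ → ℝ[X]
  | 0 => 1
  | m + 1 => 2 * X * hermitePolynomial m - derivative (hermitePolynomial m)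

lemma hasDerivAt_polynomial_mul_gaussian (p : ℝ[X]) (y : ℝ) :
    HasDerivAt (fun y => p.eval y * Real.exp (-y ^ 2))
      ((derivative p - 2 * X * p).eval y * Real.exp (-y ^ 2)) y := by
  have h1 : HasDerivAt (fun t : ℝ => Real.exp (-t ^ 2)) (Real.exp (-y ^ 2) * (-(2 * y))) y := by
    have := ((hasDerivAt_pow 2 y).neg).exp
    simpa using this
  refine ((p.hasDerivAt y).mul h1).congr_deriv ?_
  simp only [eval_sub, eval_mul, eval_X, eval_ofNat]
  ring

lemma iteratedDeriv_gaussian (m : ℕ) : iteratedDeriv m (fun t : ℝ => Real.exp (-t ^ 2)) =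
    fun y => (-1) ^ m * (hermitePolynomial m).eval y * Real.exp (-y ^ 2) := by
  induction m with
  | zero => simp [hermitePolynomial]
  | succ m ih =>
    rw [iteratedDeriv_succ, ih]
    ext y
    have h2 := (hasDerivAt_polynomial_mul_gaussian (hermitePolynomial m) y).const_mul ((-1) ^ m)
    simp only [← mul_assoc] at h2
    rw [h2.deriv]
    simp only [hermitePolynomial, eval_sub, eval_mul, eval_X, eval_ofNat]
    ring

lemma hermitePoly_eq (m : ℕ) (y : ℝ) : hermitePoly m y = (hermitePolynomial m).eval y := by
  rw [hermitePoly, iteratedDeriv_gaussian]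
  have h1 : Real.exp (y ^ 2) * Real.exp (-y ^ 2) = 1 := by rw [← Real.exp_add]; simp
  have h2 : ((-1 : ℝ) ^ m) * (-1) ^ m = 1 := by rw [← mul_pow]; simp
  linear_combination ((-1) ^ m * (-1) ^ m * (hermitePolynomial m).eval y) * h1 +
    (hermitePolynomial m).eval y * h2

/-- The normalizing factor of the `m`-th Hermite function. -/
noncomputable def hermiteNorm (m : ℕ) : ℝ := 1 / √(2 ^ m * √π * (m.factorial : ℝ))

lemma hermiteNorm_pos (m : ℕ) : 0 < hermiteNorm m := by
  unfold hermiteNorm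
  positivity

lemma hermiteFun_eq (m : ℕ) (y : ℝ) :
    hermiteFun m y = hermiteNorm m * (hermitePolynomial m).eval y * Real.exp (-y ^ 2 / 2) := by
  rw [hermiteFun, hermitePoly_eq, hermiteNorm]

lemma natDegree_hermitePolynomial_le (m : ℕ) : (hermitePolynomial m).natDegree ≤ m := by
  induction m with
  | zero => simp [hermitePolynomial]
  | succ m ih =>
    rw [hermitePolynomial]
    refine (natDegree_sub_le _ _).trans (max_le ?_ ?_)
    · rw [mul_assoc, show (2 : ℝ[X]) = C 2 from rfl]
      refine (natDegree_C_mul_le _ _).trans (natDegree_mul_le.trans ?_)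
      have := natDegree_X_le (R := ℝ)
      omega
    · exact (natDegree_derivative_le _).trans (by omega)

lemma coeff_hermitePolynomial_self (m : ℕ) : (hermitePolynomial m).coeff m = 2 ^ m := by
  induction m with
  | zero => simp [hermitePolynomial]
  | succ m ih =>
    have h1 : (derivative (hermitePolynomial m)).coeff (m + 1) = 0 := by
      refine coeff_eq_zero_of_natDegree_lt ?_
      have := natDegree_derivative_le (hermitePolynomial m)
      have := natDegree_hermitePolynomial_le m
      omega
    rw [hermitePolynomial, coeff_sub, h1, mul_assoc, show (2 : ℝ[X]) = C 2 from rfl, coeff_C_mul,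
      coeff_X_mul, ih]
    ring

lemma integrable_polynomial_mul_gaussian' (p : ℝ[X]) :
    Integrable fun y : ℝ => p.eval y * Real.exp (-y ^ 2) := by
  simpa using integrable_polynomial_mul_gaussian p

lemma integral_derivative_mul_gaussian (p : ℝ[X]) :
    ∫ y : ℝ, (derivative p - 2 * X * p).eval y * Real.exp (-y ^ 2) = 0 :=
  integral_eq_zero_of_hasDerivAt_of_integrable (hasDerivAt_polynomial_mul_gaussian p)
    (integrable_polynomial_mul_gaussian' _) (integrable_polynomial_mul_gaussian' _)

/-- Rodrigues' formula integrated by parts `m` times. -/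
lemma integral_mul_hermitePolynomial (m : ℕ) : ∀ p : ℝ[X],
    ∫ y : ℝ, (p * hermitePolynomial m).eval y * Real.exp (-y ^ 2) =
      ∫ y : ℝ, (derivative^[m] p).eval y * Real.exp (-y ^ 2) := by
  induction m with
  | zero => intro p; simp [hermitePolynomial]
  | succ m ih =>
    intro p
    rw [Function.iterate_succ_apply, ← ih (derivative p)]
    have h := integral_derivative_mul_gaussian (p * hermitePolynomial m)
    rw [← sub_eq_zero, ← integral_sub (integrable_polynomial_mul_gaussian' _)
      (integrable_polynomial_mul_gaussian' _), ← neg_eq_zero, ← integral_neg, ← h]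
    congr 1
    ext y
    simp only [hermitePolynomial, derivative_mul, eval_sub, eval_add, eval_mul, eval_X, eval_ofNat]
    ring

lemma integral_hermiteFun_mul (j k : ℕ) :
    ∫ y : ℝ, hermiteFun j y * hermiteFun k y = if j = k then 1 else 0 := by
  have key : ∀ j k : ℕ, ∫ y : ℝ, hermiteFun j y * hermiteFun k y = hermiteNorm j * hermiteNorm k *
      ∫ y : ℝ, (derivative^[k] (hermitePolynomial j)).eval y * Real.exp (-y ^ 2) := by
    intro j k
    rw [← integral_mul_hermitePolynomial, ← integral_const_mul]
    congr 1
    ext y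
    rw [hermiteFun_eq, hermiteFun_eq, eval_mul]
    have : Real.exp (-y ^ 2 / 2) * Real.exp (-y ^ 2 / 2) = Real.exp (-y ^ 2) := by
      rw [← Real.exp_add]; congr 1; ring
    rw [← this]
    ring
  have hlt : ∀ j k : ℕ, j < k → ∫ y : ℝ, hermiteFun j y * hermiteFun k y = 0 := by
    intro j k h
    rw [key, iterate_derivative_eq_zero ((natDegree_hermitePolynomial_le j).trans_lt h)]
    simp
  rcases lt_trichotomy j k with h | h | h
  · rw [hlt j k h, if_neg h.ne]
  · subst h
    have h1 : derivative^[j] (hermitePolynomial j) = C ((2 : ℝ) ^ j * j.factorial) := by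
      ext i
      rw [coeff_iterate_derivative, coeff_C]
      split_ifs with hi
      · subst hi
        rw [zero_add, coeff_hermitePolynomial_self, Nat.descFactorial_self, nsmul_eq_mul]
        ring
      · rw [coeff_eq_zero_of_natDegree_lt
          ((natDegree_hermitePolynomial_le j).trans_lt (by omega)), nsmul_zero]
    have h2 : ∫ y : ℝ, Real.exp (-y ^ 2) = √π := by
      simpa using integral_gaussian 1
    rw [key, h1]
    simp only [eval_C, if_true]
    rw [integral_const_mul, h2, hermiteNorm, div_mul_div_comm, Real.mul_self_sqrt (by positivity)]
    have : (0 : ℝ) < √π := by positivity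
    field_simp
  · rw [if_neg h.ne', ← hlt k j h]
    congr 1
    ext y
    ring

/-- The functions `y ↦ p(y) e^{-y²/2}` with `deg p < n` are combinations of `h₀, …, h_{n-1}`. -/
lemma exists_sum_hermiteFun (n : ℕ) : ∀ p : ℂ[X], p.degree < n → ∃ a : Fin n → ℂ, ∀ y : ℝ,
    p.eval (y : ℂ) * (Real.exp (-y ^ 2 / 2) : ℂ) = ∑ k : Fin n, a k * (hermiteFun k y : ℂ) := by
  induction n with
  | zero =>
    intro p hp
    rw [Nat.cast_zero, Nat.WithBot.lt_zero_iff, degree_eq_bot] at hp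
    exact ⟨0, fun y => by simp [hp]⟩
  | succ n ih =>
    intro p hp
    let q : ℂ[X] := (hermitePolynomial n).map Complex.ofRealHom
    let b : ℂ := p.coeff n / 2 ^ n
    have hd : (p - C b * q).degree < n := by
      rw [degree_lt_iff_coeff_zero]
      intro m hm
      rw [coeff_sub, coeff_C_mul, coeff_map]
      rcases hm.eq_or_lt with rfl | h
      · rw [coeff_hermitePolynomial_self]
        simp [b]
      · rw [coeff_eq_zero_of_degree_lt (hp.trans_le (by exact_mod_cast h)),
          coeff_eq_zero_of_natDegree_lt ((natDegree_hermitePolynomial_le n).trans_lt h)]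
        simp
    obtain ⟨a, ha⟩ := ih _ hd
    have hnz : (hermiteNorm n : ℂ) ≠ 0 := by exact_mod_cast (hermiteNorm_pos n).ne'
    refine ⟨Fin.snoc a (b / hermiteNorm n), fun y => ?_⟩
    rw [Fin.sum_univ_castSucc]
    simp only [Fin.snoc_castSucc, Fin.snoc_last, Fin.val_castSucc, Fin.val_last]
    rw [← ha y, hermiteFun_eq]
    have hq : q.eval (y : ℂ) = ((hermitePolynomial n).eval y : ℝ) :=
      eval_map_apply (f := Complex.ofRealHom) (p := hermitePolynomial n) y
    rw [eval_sub, eval_mul, eval_C, hq]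
    push_cast
    field_simp
    ring

end Hermite

lemma integral_laguerreFun₀_sq :
    ∫ y in Set.Ioi (0 : ℝ), laguerreFun₀ y * laguerreFun₀ y = 1 := by
  rw [← integral_exp_neg_Ioi_zero]
  congr 1
  ext y
  rw [laguerreFun₀, ← Real.exp_add]
  congr 1
  ring

lemma integral_basisFun_mul (j k : ℕ) :
    ∫ y, basisFun j y * basisFun k y ∂halfPlaneMeasure = if j = k then 1 else 0 := by
  have h1 : ∀ y : ℝ × ℝ, basisFun j y * basisFun k y =
      ((hermiteFun j y.1 * hermiteFun k y.1 : ℝ) : ℂ) *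
        ((laguerreFun₀ y.2 * laguerreFun₀ y.2 : ℝ) : ℂ) := by
    intro y
    simp only [basisFun]
    push_cast
    ring
  simp_rw [h1]
  rw [halfPlaneMeasure_eq, integral_prod_mul (fun y : ℝ => ((hermiteFun j y * hermiteFun k y : ℝ) : ℂ))
    (fun y : ℝ => ((laguerreFun₀ y * laguerreFun₀ y : ℝ) : ℂ))]
  rw [integral_complex_ofReal, integral_complex_ofReal, integral_hermiteFun_mul,
    integral_laguerreFun₀_sq]
  split_ifs <;> simp

lemma conj_basisFun (j : ℕ) (y : ℝ × ℝ) : (starRingEnd ℂ) (basisFun j y) = basisFun j y := by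
  simp [basisFun]

lemma inner_L2n_single (n : ℕ) (j : Fin n) (v : Lp ℂ 2 halfPlaneMeasure) (G : L2n n) :
    inner ℂ (WithLp.toLp 2 (Pi.single j v) : L2n n) G = inner ℂ v (G j) := by
  rw [PiLp.inner_apply, Finset.sum_eq_single j]
  · simp
  · intro k _ hk
    simp [hk]
  · simp

open scoped ComplexConjugate in
/-- The adjoint of `R₀` integrates against the functions `h_j ℓ₀` in each fibre. -/
lemma adjoint_opR₀_coeFn (n : ℕ) (Θ : Lp ℂ 2 flatMeasure) (j : Fin n) :
    (ContinuousLinearMap.adjoint (opR₀ n) Θ j : ℝ × ℝ → ℂ) =ᵐ[halfPlaneMeasure]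
      fun x => ∫ y, Θ (x, y) * basisFun j y ∂halfPlaneMeasure := by
  have key : ∀ s, MeasurableSet s → halfPlaneMeasure s < ∞ →
      IntegrableOn (fun x => ∫ y, Θ (x, y) * basisFun j y ∂halfPlaneMeasure) s halfPlaneMeasure ∧
      ∫ x in s, ∫ y, Θ (x, y) * basisFun j y ∂halfPlaneMeasure ∂halfPlaneMeasure =
        ∫ x in s, ContinuousLinearMap.adjoint (opR₀ n) Θ j x ∂halfPlaneMeasure := by
    intro s hs hμs
    let v := indicatorConstLp 2 hs hμs.ne (1 : ℂ)
    let e := extendTensor volume measurableSet_halfPlane (memLp_basisFun j) v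
    have he : e =ᵐ[flatMeasure] fun p => (halfPlane ∩ s).indicator 1 p.1 * basisFun j p.2 := by
      filter_upwards [extendTensor_coeFn (μ := volume) measurableSet_halfPlane (memLp_basisFun j) v,
        ae_indicator_of_ae (ν := halfPlaneMeasure) measurableSet_halfPlane
          (indicatorConstLp_coeFn (p := 2) (hs := hs) (hμs := hμs.ne) (c := (1 : ℂ)))] with p h1 h2
      rw [h1]
      by_cases h : p.1 ∈ halfPlane
      · rw [Set.indicator_of_mem h, h2 h]
        by_cases h' : p.1 ∈ s <;> simp [h, h']
      · simp [h]
    have h1 : inner ℂ e Θ = ∫ p, (halfPlane ∩ s).indicator 1 p.1 * (Θ p * basisFun j p.2)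
        ∂flatMeasure := by
      rw [L2.inner_def]
      refine integral_congr_ae ?_
      filter_upwards [he] with p hp
      rw [hp, RCLike.inner_apply, map_mul, conj_basisFun]
      by_cases h' : p.1 ∈ halfPlane ∩ s <;> simp [h']
    have hint : Integrable (fun p => (halfPlane ∩ s).indicator 1 p.1 * (Θ p * basisFun j p.2))
        flatMeasure := by
      refine (L2.integrable_inner (𝕜 := ℂ) e Θ).congr ?_
      filter_upwards [he] with p hp
      rw [hp, RCLike.inner_apply, map_mul, conj_basisFun]
      by_cases h' : p.1 ∈ halfPlane ∩ s <;> simp [h']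
    have h2 : inner ℂ e Θ = ∫ x in s, ContinuousLinearMap.adjoint (opR₀ n) Θ j x
        ∂halfPlaneMeasure := by
      rw [← L2.inner_indicatorConstLp_one (𝕜 := ℂ) hs hμs.ne, ← inner_L2n_single,
        ContinuousLinearMap.adjoint_inner_right]
      congr 1
      simp only [opR₀, sum_apply, ContinuousLinearMap.comp_apply,
        PiLp.proj_apply]
      rw [Finset.sum_eq_single j]
      · simp [e, v]
      · intro k _ hk
        simp [hk]
      · simp
    have h3 : ∀ x : ℝ × ℝ, ∫ y, (halfPlane ∩ s).indicator 1 x * (Θ (x, y) * basisFun j y)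
        ∂halfPlaneMeasure = (halfPlane ∩ s).indicator
          (fun x => ∫ y, Θ (x, y) * basisFun j y ∂halfPlaneMeasure) x := by
      intro x
      by_cases h : x ∈ halfPlane ∩ s <;> simp [h]
    have hrr : halfPlaneMeasure.restrict s = volume.restrict (halfPlane ∩ s) := by
      rw [Measure.restrict_restrict hs, Set.inter_comm]
    have hms := measurableSet_halfPlane.inter hs
    constructor
    · have h4 := hint.integral_prod_left
      simp only [h3] at h4
      rw [IntegrableOn, hrr]
      exact (integrable_indicator_iff hms).1 h4
    · rw [← h2, h1, integral_prod _ hint]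
      simp only [h3]
      rw [integral_indicator hms, hrr]
  symm
  refine ae_eq_of_forall_setIntegral_eq_of_sigmaFinite (fun s hs h => (key s hs h).1) ?_
    (fun s hs h => (key s hs h).2)
  intro s _ h
  exact integrableOn_Lp_of_measure_ne_top _ (by norm_num) h.ne

lemma adjoint_opR₀_opR₀ (n : ℕ) (g : L2n n) :
    ContinuousLinearMap.adjoint (opR₀ n) (opR₀ n g) = g := by
  refine PiLp.ext fun j => Lp.ext ?_
  have h1 : ∀ᵐ x ∂halfPlaneMeasure, ∀ᵐ y ∂halfPlaneMeasure, opR₀ n g (x, y) =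
      ∑ k : Fin n, halfPlane.indicator (g k) x * basisFun k y :=
    ae_restrict_of_ae (Measure.ae_ae_of_ae_prod (opR₀_coeFn n g))
  filter_upwards [adjoint_opR₀_coeFn n (opR₀ n g) j, h1,
    ae_restrict_mem measurableSet_halfPlane] with x h2 h3 hx
  rw [h2]
  have h4 : ∫ y, opR₀ n g (x, y) * basisFun j y ∂halfPlaneMeasure =
      ∫ y, ∑ k : Fin n, g k x * (basisFun k y * basisFun j y) ∂halfPlaneMeasure := by
    refine integral_congr_ae ?_
    filter_upwards [h3] with y hy
    rw [hy, Finset.sum_mul]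
    simp [hx, mul_assoc]
  rw [h4, integral_finsetSum]
  · simp_rw [integral_const_mul, integral_basisFun_mul]
    simp [Fin.val_inj]
  · intro k _
    exact ((memLp_basisFun k).integrable_mul (memLp_basisFun j)).const_mul _

lemma norm_opR₀ (n : ℕ) (g : L2n n) : ‖opR₀ n g‖ = ‖g‖ := by
  have h : inner ℂ (opR₀ n g) (opR₀ n g) = inner ℂ g g := by
    rw [← ContinuousLinearMap.adjoint_inner_right, adjoint_opR₀_opR₀]
  rw [inner_self_eq_norm_sq_to_K, inner_self_eq_norm_sq_to_K] at h
  have h' : ‖opR₀ n g‖ ^ 2 = ‖g‖ ^ 2 := by exact_mod_cast h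
  exact (pow_left_inj₀ (norm_nonneg _) (norm_nonneg _) two_ne_zero).1 h'

/-- A function in `L²` of the flat domain whose fibres over `x₂ > 0` are combinations of the
`h_k ℓ₀` and whose fibres over `x₂ < 0` vanish lies in the range of `R₀`. No measurability of the
coefficients is needed: the fibrewise integrals provide them. -/
lemma exists_opR₀_eq (n : ℕ) (Θ : Lp ℂ 2 flatMeasure)
    (h : ∀ᵐ x : ℝ × ℝ, ∃ a : Fin n → ℂ, ∀ᵐ y ∂halfPlaneMeasure,
      Θ (x, y) = halfPlane.indicator (fun _ => ∑ k : Fin n, a k * basisFun k y) x) :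
    ∃ g : L2n n, Θ = opR₀ n g := by
  refine ⟨ContinuousLinearMap.adjoint (opR₀ n) Θ, Lp.ext ?_⟩
  set g := ContinuousLinearMap.adjoint (opR₀ n) Θ
  have hm : MeasurableSet {p : (ℝ × ℝ) × (ℝ × ℝ) | Θ p = opR₀ n g p} :=
    measurableSet_eq_fun (Lp.stronglyMeasurable Θ).measurable
      (Lp.stronglyMeasurable (opR₀ n g)).measurable
  refine (Measure.ae_prod_iff_ae_ae hm).2 ?_
  have h2 : ∀ᵐ x : ℝ × ℝ, ∀ j : Fin n, x ∈ halfPlane → g j x =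
      ∫ y, Θ (x, y) * basisFun j y ∂halfPlaneMeasure :=
    ae_all_iff.2 fun j =>
      (ae_restrict_iff' measurableSet_halfPlane).1 (adjoint_opR₀_coeFn n Θ j)
  filter_upwards [h, h2, Measure.ae_ae_of_ae_prod (opR₀_coeFn n g)] with x ⟨a, ha⟩ hg hx
  by_cases hxH : x ∈ halfPlane
  · simp only [Set.indicator_of_mem hxH] at ha hx
    have hga : ∀ j : Fin n, g j x = a j := by
      intro j
      rw [hg j hxH]
      have h4 : ∫ y, Θ (x, y) * basisFun j y ∂halfPlaneMeasure =
          ∫ y, ∑ k : Fin n, a k * (basisFun k y * basisFun j y) ∂halfPlaneMeasure := by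
        refine integral_congr_ae ?_
        filter_upwards [ha] with y hy
        rw [hy, Finset.sum_mul]
        simp [mul_assoc]
      rw [h4, integral_finsetSum]
      · simp_rw [integral_const_mul, integral_basisFun_mul]
        simp [Fin.val_inj]
      · intro k _
        exact ((memLp_basisFun k).integrable_mul (memLp_basisFun j)).const_mul _
    filter_upwards [ha, hx] with y h5 h6
    rw [h5, h6]
    simp [hga]
  · filter_upwards [ha, hx] with y h5 h6
    rw [h5, h6]
    simp [hxH]

/-! ### The Fourier–Plancherel transform on `L¹ ∩ L²` -/

section FourierL1L2
open SchwartzMap FourierTransform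
open scoped ContDiff

variable {E : Type*} [NormedAddCommGroup E] [MeasurableSpace E] [BorelSpace E]
  [InnerProductSpace ℝ E] [FiniteDimensional ℝ E]

lemma integral_schwartz_fourier_Lp (F : Lp ℂ 2 (volume : Measure E)) (ψ : 𝓢(E, ℂ)) :
    ∫ x, (𝓕 ψ) x • F x = ∫ x, ψ x • (𝓕 F : Lp ℂ 2 (volume : Measure E)) x := by
  have h := Lp.fourier_toTemperedDistribution_eq F
  rw [← Lp.toTemperedDistribution_apply, ← Lp.toTemperedDistribution_apply, ← h]
  rfl

lemma integral_schwartz_fourierInv_Lp (F : Lp ℂ 2 (volume : Measure E)) (ψ : 𝓢(E, ℂ)) :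
    ∫ x, (𝓕⁻ ψ) x • F x = ∫ x, ψ x • (𝓕⁻ F : Lp ℂ 2 (volume : Measure E)) x := by
  have h := Lp.fourierInv_toTemperedDistribution_eq F
  rw [← Lp.toTemperedDistribution_apply, ← Lp.toTemperedDistribution_apply, ← h]
  rfl

/-- On `L¹ ∩ L²` the Fourier–Plancherel transform is given by the Fourier integral. -/
lemma fourier_toLp_coeFn {f : E → ℂ} (h1 : Integrable f) (h2 : MemLp f 2) :
    (𝓕 (h2.toLp f) : Lp ℂ 2 (volume : Measure E)) =ᵐ[volume] 𝓕 f := by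
  have hL : Continuous fun p : E × E => (innerₗ E) p.1 p.2 := continuous_inner
  refine ae_eq_of_integral_contDiff_smul_eq
    ((Lp.memLp _).locallyIntegrable (by norm_num))
    ((VectorFourier.fourierIntegral_continuous Real.continuous_fourierChar hL h1).locallyIntegrable)
    fun g hg hgs => ?_
  have hs' : HasCompactSupport fun x => (g x : ℂ) :=
    hgs.comp_left (g := fun a : ℝ => (a : ℂ)) Complex.ofReal_zero
  have hd' : ContDiff ℝ ∞ fun x => (g x : ℂ) := Complex.ofRealCLM.contDiff.comp hg
  obtain ⟨ψ, hψ⟩ : ∃ ψ : 𝓢(E, ℂ), ∀ x, ψ x = (g x : ℂ) := ⟨hs'.toSchwartzMap hd', fun x => rfl⟩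
  have h3 := integral_schwartz_fourier_Lp (h2.toLp f) ψ
  simp only [hψ] at h3
  have h4 : ∫ x, (𝓕 ψ) x • (h2.toLp f) x = ∫ x, (𝓕 ψ) x • f x := by
    refine integral_congr_ae ?_
    filter_upwards [h2.coeFn_toLp] with x hx
    rw [hx]
  have h5 := VectorFourier.integral_fourierIntegral_smul_eq_flip (L := innerₗ E)
    (μ := volume) (ν := volume) Real.continuous_fourierChar hL ψ.integrable h1
  rw [h4] at h3
  have hcoe : ∀ (a : ℝ) (z : ℂ), a • z = (a : ℂ) • z := fun a z => by simp
  simp only [hcoe]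
  rw [← h3, SchwartzMap.fourier_coe]
  refine h5.trans ?_
  rw [flip_innerₗ]
  simp only [hψ]
  rfl

/-- On `L¹ ∩ L²` the inverse Fourier–Plancherel transform is given by the Fourier integral. -/
lemma fourierInv_toLp_coeFn {f : E → ℂ} (h1 : Integrable f) (h2 : MemLp f 2) :
    (𝓕⁻ (h2.toLp f) : Lp ℂ 2 (volume : Measure E)) =ᵐ[volume] 𝓕⁻ f := by
  have hL : Continuous fun p : E × E => (-innerₗ E) p.1 p.2 := continuous_inner.neg
  refine ae_eq_of_integral_contDiff_smul_eq
    ((Lp.memLp _).locallyIntegrable (by norm_num))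
    ((VectorFourier.fourierIntegral_continuous Real.continuous_fourierChar hL h1).locallyIntegrable)
    fun g hg hgs => ?_
  have hs' : HasCompactSupport fun x => (g x : ℂ) :=
    hgs.comp_left (g := fun a : ℝ => (a : ℂ)) Complex.ofReal_zero
  have hd' : ContDiff ℝ ∞ fun x => (g x : ℂ) := Complex.ofRealCLM.contDiff.comp hg
  obtain ⟨ψ, hψ⟩ : ∃ ψ : 𝓢(E, ℂ), ∀ x, ψ x = (g x : ℂ) := ⟨hs'.toSchwartzMap hd', fun x => rfl⟩
  have h3 := integral_schwartz_fourierInv_Lp (h2.toLp f) ψ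
  simp only [hψ] at h3
  have h4 : ∫ x, (𝓕⁻ ψ) x • (h2.toLp f) x = ∫ x, (𝓕⁻ ψ) x • f x := by
    refine integral_congr_ae ?_
    filter_upwards [h2.coeFn_toLp] with x hx
    rw [hx]
  have h5 := VectorFourier.integral_fourierIntegral_smul_eq_flip (L := -innerₗ E)
    (μ := volume) (ν := volume) Real.continuous_fourierChar hL ψ.integrable h1
  rw [h4] at h3
  have hcoe : ∀ (a : ℝ) (z : ℂ), a • z = (a : ℂ) • z := fun a z => by simp
  simp only [hcoe]
  rw [← h3, SchwartzMap.fourierInv_coe]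
  refine h5.trans ?_
  have : (-innerₗ E).flip = -innerₗ E := by
    ext x y
    simp [real_inner_comm]
  rw [this]
  simp only [hψ]
  rfl

end FourierL1L2

lemma inner_dilate (t : ℝ × ℝ) (z : ℂ) :
    2 * π * inner ℝ z (dilate t) = t.1 * z.re + t.2 * z.im := by
  rw [Complex.inner]
  simp only [dilate, Complex.mul_re, Complex.conj_re, Complex.conj_im]
  field_simp
  ring

open FourierTransform in
/-- The transform `F ⊗ F` of a function in `L¹ ∩ L²`. -/
lemma fourier₂_toLp_coeFn {f : ℝ × ℝ → ℂ} (h1 : Integrable f) (h2 : MemLp f 2) :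
    fourier₂ (h2.toLp f) =ᵐ[volume] fun t =>
      (2 * π : ℂ)⁻¹ * ∫ x : ℝ × ℝ, f x * Complex.exp (-Complex.I * (t.1 * x.1 + t.2 * x.2)) := by
  have hp := Complex.volume_preserving_equiv_real_prod
  let F : ℂ → ℂ := f ∘ Complex.measurableEquivRealProd
  have hF1 : Integrable F := (hp.integrable_comp_emb (MeasurableEquiv.measurableEmbedding _)).2 h1
  have hF2 : MemLp F 2 := h2.comp_measurePreserving hp
  have e1 : Lp.compMeasurePreservingₗᵢ ℂ Complex.measurableEquivRealProd hp (h2.toLp f) =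
      hF2.toLp F := rfl
  have e2 : fourier₂ (h2.toLp f) = weightedComp (fun _ => ((2 * π : ℝ) : ℂ)⁻¹) dilate
      measurable_const measurable_dilate map_dilate (𝓕 (hF2.toLp F)) := by
    rw [← e1]; rfl
  rw [e2]
  have h3 := ae_comp_of_ae measurable_const measurable_dilate map_dilate
    (fourier_toLp_coeFn hF1 hF2)
  filter_upwards [weightedComp_coeFn measurable_const measurable_dilate map_dilate
    (𝓕 (hF2.toLp F)), h3] with t h4 h5
  have hne : ((2 * π : ℝ) : ℂ)⁻¹ ≠ 0 := by
    rw [ne_eq, inv_eq_zero, Complex.ofReal_eq_zero]; positivity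
  rw [h4, h5 hne, Real.fourier_eq']
  congr 1
  · push_cast; rfl
  · rw [← hp.integral_comp (MeasurableEquiv.measurableEmbedding _)]
    congr 1
    ext z
    rw [smul_eq_mul, mul_comm]
    congr 1
    congr 1
    rw [show (-2 * π * inner ℝ z (dilate t) : ℝ) = -(t.1 * z.re + t.2 * z.im) by
      rw [← inner_dilate]; ring]
    simp [Complex.measurableEquivRealProd_apply]
    ring

open FourierTransform in
/-- Fourier inversion for `F ⊗ F`: the inverse Fourier integral of `G ∈ L¹ ∩ L²` is square
integrable, and its transform is `G`. -/
lemma fourier₂_inv {G f : ℝ × ℝ → ℂ} (h1 : Integrable G) (h2 : MemLp G 2)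
    (hf : ∀ x : ℝ × ℝ, f x = (2 * π : ℂ)⁻¹ *
      ∫ t : ℝ × ℝ, G t * Complex.exp (Complex.I * (t.1 * x.1 + t.2 * x.2))) :
    ∃ h : MemLp f 2, fourier₂ (h.toLp f) = h2.toLp G := by
  have hp := Complex.volume_preserving_equiv_real_prod
  let D : ℂ → ℝ × ℝ := fun z => (2 * π * z.re, 2 * π * z.im)
  let G' : ℂ → ℂ := fun z => (2 * π : ℂ) * G (D z)
  have hpi : (0 : ℝ) < 2 * π := by positivity
  have hGm := h2.1
  have hD : ∀ z, D z = Complex.measurableEquivRealProd ((2 * π : ℝ) • z) := by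
    intro z; simp [D, Complex.measurableEquivRealProd_apply]
  have hDi : ∀ F : ℝ × ℝ → ℂ, Integrable F → Integrable (fun z => F (D z)) := by
    intro F hF
    simp_rw [hD]
    exact ((hp.integrable_comp_emb (MeasurableEquiv.measurableEmbedding _)).2 hF).comp_smul hpi.ne'
  have hDint : ∀ F : ℝ × ℝ → ℂ, ∫ z, F (D z) = ((2 * π) ^ 2 : ℝ)⁻¹ • ∫ t, F t := by
    intro F
    simp_rw [hD]
    rw [Measure.integral_comp_smul volume (fun z => F (Complex.measurableEquivRealProd z)),
      hp.integral_comp (MeasurableEquiv.measurableEmbedding _) F, Complex.finrank_real_complex,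
      abs_of_pos (by positivity)]
  have hG'1 : Integrable G' := (hDi G h1).const_mul _
  have hG'2 : MemLp G' 2 := by
    refine (memLp_two_iff_integrable_sq_norm hG'1.1).2 ?_
    have h3 := hDi (fun t => ((‖G t‖ ^ 2 : ℝ) : ℂ))
      ((memLp_two_iff_integrable_sq_norm hGm).1 h2).ofReal
    refine (h3.norm.const_mul ((2 * π) ^ 2)).congr (Filter.Eventually.of_forall fun z => ?_)
    simp only [G', norm_mul, mul_pow, Complex.norm_real, Real.norm_eq_abs]
    simp [abs_of_pos Real.pi_pos]
  let Φ : Lp ℂ 2 (volume : Measure ℂ) := 𝓕⁻ (hG'2.toLp G')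
  have hΦ : Φ =ᵐ[volume] f ∘ Complex.measurableEquivRealProd := by
    filter_upwards [fourierInv_toLp_coeFn hG'1 hG'2] with z hz
    rw [hz, Real.fourierInv_eq', Function.comp_apply, hf]
    let K : ℝ × ℝ → ℂ := fun t => (2 * π : ℂ) *
      (G t * Complex.exp (Complex.I * (t.1 * z.re + t.2 * z.im)))
    have : ∀ w : ℂ, Complex.exp (((2 * π * inner ℝ w z : ℝ) : ℂ) * Complex.I) • G' w =
        K (D w) := by
      intro w
      simp only [K, G', D, smul_eq_mul]
      rw [Complex.inner]
      simp only [Complex.mul_re, Complex.conj_re, Complex.conj_im]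
      push_cast
      rw [show (2 * π * (z.re * w.re - z.im * -w.im) : ℂ) * Complex.I =
        Complex.I * (2 * π * w.re * z.re + 2 * π * w.im * z.im) by ring]
      ring
    simp_rw [this]
    rw [hDint, integral_const_mul, Complex.real_smul]
    simp only [Complex.measurableEquivRealProd_apply]
    generalize (∫ t : ℝ × ℝ, G t * Complex.exp (Complex.I * (t.1 * z.re + t.2 * z.im))) = J
    push_cast
    have : (π : ℂ) ≠ 0 := by exact_mod_cast Real.pi_ne_zero
    field_simp
  have hfm : f ∘ Complex.measurableEquivRealProd ∘ Complex.measurableEquivRealProd.symm = f := by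
    ext x; simp
  have hf2 : MemLp f 2 := by
    have := (((memLp_congr_ae hΦ).1 (Lp.memLp Φ)).comp_measurePreserving hp.symm)
    rwa [Function.comp_assoc, hfm] at this
  refine ⟨hf2, ?_⟩
  have hF2 : MemLp (f ∘ Complex.measurableEquivRealProd) 2 := hf2.comp_measurePreserving hp
  have e0 : hF2.toLp _ = Φ := Lp.ext (hF2.coeFn_toLp.trans hΦ.symm)
  have e2 : fourier₂ (hf2.toLp f) = weightedComp (fun _ => ((2 * π : ℝ) : ℂ)⁻¹) dilate
      measurable_const measurable_dilate map_dilate (𝓕 (hF2.toLp _)) := rfl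
  rw [e2, e0]
  simp only [Φ, FourierTransform.fourier_fourierInv_eq]
  refine Lp.ext ?_
  have h3 := ae_comp_of_ae measurable_const measurable_dilate map_dilate hG'2.coeFn_toLp
  filter_upwards [weightedComp_coeFn measurable_const measurable_dilate map_dilate
    (hG'2.toLp G'), h3, h2.coeFn_toLp] with t h4 h5 h6
  have hne : ((2 * π : ℝ) : ℂ)⁻¹ ≠ 0 := by
    rw [ne_eq, inv_eq_zero, Complex.ofReal_eq_zero]; positivity
  rw [h4, h5 hne, h6]
  have hDt : D (dilate t) = t := by
    ext <;> simp only [D, dilate] <;> field_simp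
  simp only [G', hDt]
  push_cast
  have : (π : ℂ) ≠ 0 := by exact_mod_cast Real.pi_ne_zero
  field_simp

/-! ### Fourier integrals over slices -/

lemma measurable_kappa : Measurable kappa := measurePreserving_kappa.measurable

/-- The Fourier integral in the real parts of the function `w ↦ f(w₁, w₂ + i|w₁|²)`, at
`q = ((t₁, t₂), (v₁, v₂))`. -/
noncomputable def fourierSlice (f : ℂ × ℂ → ℂ) (q : (ℝ × ℝ) × (ℝ × ℝ)) : ℂ :=
  (2 * π : ℂ)⁻¹ * ∫ u : ℝ × ℝ, f (kappa (u, q.2)) *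
    Complex.exp (-Complex.I * (q.1.1 * u.1 + q.1.2 * u.2))

lemma measurable_fourierSlice {f : ℂ × ℂ → ℂ} (hf : Measurable f) :
    Measurable (fourierSlice f) := by
  have h : StronglyMeasurable fun z : ((ℝ × ℝ) × (ℝ × ℝ)) × (ℝ × ℝ) => f (kappa (z.2, z.1.2)) *
      Complex.exp (-Complex.I * (z.1.1.1 * z.2.1 + z.1.1.2 * z.2.2)) := by
    refine Measurable.stronglyMeasurable ?_
    refine Measurable.mul (hf.comp (measurable_kappa.comp (by fun_prop))) (by fun_prop)
  exact (h.integral_prod_right (ν := volume)).measurable.const_mul _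

/-- The transform `U F` of a function `f` that is integrable on the slices `Im w = const`. -/
lemma opU_coeFn_of_integrable {f : ℂ × ℂ → ℂ} (hf : Measurable f) (F : Lp ℂ 2 siegelMeasure)
    (hF : F =ᵐ[siegelMeasure] f)
    (hint : ∀ v ∈ halfPlane, Integrable fun u : ℝ × ℝ => f (kappa (u, v))) :
    opU F =ᵐ[flatMeasure] fun p => weight₁ (psi₂ p) * fourierSlice f (psi₁ (psi₂ p)) := by
  have h0 : opU₀ F =ᵐ[flatMeasure] f ∘ kappa :=
    (opU₀_coeFn F).trans (measurePreserving_kappa.quasiMeasurePreserving.ae_eq_comp hF)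
  have hmem : MemLp (f ∘ kappa) 2 flatMeasure := (memLp_congr_ae h0).1 (Lp.memLp _)
  have h1 : ∀ᵐ v ∂halfPlaneMeasure, ∀ᵐ t : ℝ × ℝ, opU₁ (opU₀ F) (t, v) =
      fourierSlice f (t, v) := by
    have hs : ∀ᵐ v ∂halfPlaneMeasure, curryEquiv volume halfPlaneMeasure (opU₁ (opU₀ F)) v =
      fourier₂ (curryEquiv volume halfPlaneMeasure (opU₀ F) v) := tensorId_slice fourier₂ (opU₀ F)
    filter_upwards [hs, curryEquiv_coeFn (opU₀ F), ae_slice_of_ae h0,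
      ae_memLp_slice (hf.comp measurable_kappa) hmem, ae_restrict_mem measurableSet_halfPlane,
      curryEquiv_coeFn (opU₁ (opU₀ F))] with v h2 h3 h4 h5 h6 h7
    have h8 : curryEquiv volume halfPlaneMeasure (opU₀ F) v = h5.toLp _ :=
      Lp.ext ((h3.trans h4).trans h5.coeFn_toLp.symm)
    rw [h2, h8] at h7
    filter_upwards [h7, fourier₂_toLp_coeFn (hint v h6) h5] with t h9 h10
    rw [← h9]
    exact h10
  have hm : MeasurableSet {p | opU₁ (opU₀ F) p = fourierSlice f p} :=
    measurableSet_eq_fun (Lp.stronglyMeasurable _).measurable (measurable_fourierSlice hf)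
  have h2 : opU₁ (opU₀ F) =ᵐ[flatMeasure] fourierSlice f := by
    have h3 : ∀ᵐ z ∂halfPlaneMeasure.prod (volume : Measure (ℝ × ℝ)),
        opU₁ (opU₀ F) z.swap = fourierSlice f z.swap :=
      (Measure.ae_prod_iff_ae_ae (measurable_swap hm)).2 h1
    have h4 := (Measure.measurePreserving_swap (μ := (volume : Measure (ℝ × ℝ)))
      (ν := halfPlaneMeasure)).quasiMeasurePreserving.ae h3
    simp only [Prod.swap_swap] at h4
    exact h4
  filter_upwards [opV₂_opV₁_coeFn (opU₁ (opU₀ F)), ae_comp_psi₂ (ae_comp_psi₁ h2)] with p h3 h4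
  exact h3.trans (by rw [h4])

/-- If `G` is square integrable and integrable on slices, and `f` is given on every slice by its
inverse Fourier integral, then `f ∈ L²(D₂)` and `U₁ U₀ f = G`. -/
lemma opU₁_opU₀_eq {f : ℂ × ℂ → ℂ} {G : (ℝ × ℝ) × (ℝ × ℝ) → ℂ}
    (hf : AEStronglyMeasurable f siegelMeasure) (hG : Measurable G) (hG2 : MemLp G 2 flatMeasure)
    (hint : ∀ v ∈ halfPlane, Integrable fun t : ℝ × ℝ => G (t, v))
    (hfG : ∀ v ∈ halfPlane, ∀ u : ℝ × ℝ, f (kappa (u, v)) = (2 * π : ℂ)⁻¹ *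
      ∫ t : ℝ × ℝ, G (t, v) * Complex.exp (Complex.I * (t.1 * u.1 + t.2 * u.2))) :
    ∃ h : MemLp f 2 siegelMeasure, opU₁ (opU₀ (h.toLp f)) = hG2.toLp G := by
  have key : ∀ᵐ v ∂halfPlaneMeasure, ∃ (h2 : MemLp (fun t => G (t, v)) 2 volume)
      (h : MemLp (fun u => f (kappa (u, v))) 2 volume),
      fourier₂ (h.toLp _) = h2.toLp _ := by
    filter_upwards [ae_memLp_slice hG hG2, ae_restrict_mem measurableSet_halfPlane] with v h1 h2
    exact ⟨h1, fourier₂_inv (hint v h2) h1 (hfG v h2)⟩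
  have hfk : AEStronglyMeasurable (f ∘ kappa) flatMeasure :=
    hf.comp_measurePreserving measurePreserving_kappa
  have hmem : MemLp (f ∘ kappa) 2 flatMeasure := by
    refine ⟨hfk, ?_⟩
    have : eLpNorm (f ∘ kappa) 2 flatMeasure = eLpNorm G 2 flatMeasure := by
      refine eLpNorm_two_eq_of_sq ?_
      rw [lintegral_prod_symm _ (hfk.enorm.pow_const 2),
        lintegral_prod_symm _ (hG.enorm.pow_const 2).aemeasurable]
      refine lintegral_congr_ae ?_
      filter_upwards [key] with v ⟨h2, h, h3⟩
      rw [← eLpNorm_two_sq, ← eLpNorm_two_sq]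
      have h4 := norm_fourier₂ (h.toLp _)
      rw [h3, Lp.norm_toLp, Lp.norm_toLp] at h4
      have h5 := (ENNReal.toReal_eq_toReal_iff' h2.2.ne h.2.ne).1 h4
      simp only [Function.comp_def]
      rw [h5]
    rw [this]
    exact hG2.2
  have hmem' : MemLp f 2 siegelMeasure := by
    rw [← measurePreserving_kappa.map_eq]
    rw [← measurePreserving_kappa.map_eq] at hf
    exact (memLp_map_measure_iff hf measurable_kappa.aemeasurable).2 hmem
  refine ⟨hmem', tensorId_eq_of_slice _ _ _ ?_⟩
  have h0 : opU₀ (hmem'.toLp f) =ᵐ[flatMeasure] f ∘ kappa :=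
    (opU₀_coeFn _).trans
      (measurePreserving_kappa.quasiMeasurePreserving.ae_eq_comp hmem'.coeFn_toLp)
  filter_upwards [key, curryEquiv_coeFn (opU₀ (hmem'.toLp f)), ae_slice_of_ae h0,
    curryEquiv_coeFn (hG2.toLp G), ae_slice_of_ae hG2.coeFn_toLp] with v ⟨h2, h, h3⟩ h4 h5 h6 h7
  have h8 : curryEquiv volume halfPlaneMeasure (opU₀ (hmem'.toLp f)) v = h.toLp _ :=
    Lp.ext ((h4.trans h5).trans h.coeFn_toLp.symm)
  have h9 : curryEquiv volume halfPlaneMeasure (hG2.toLp G) v = h2.toLp _ :=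
    Lp.ext ((h6.trans h7).trans h2.coeFn_toLp.symm)
  rw [h8, h9, h3]

/-! ### Holomorphic integrals of Bargmann type -/

section LaplaceIntegrals
open scoped ContDiff Topology

/-- The kernel `exp(i t ζ₂ + 2i √t x ζ₁ + t ζ₁² - x²/2)`, where `z = (x, t)`. -/
noncomputable def bargmannKernel (ζ : ℂ × ℂ) (z : ℝ × ℝ) : ℂ :=
  Complex.exp (Complex.I * z.2 * ζ.2 + 2 * Complex.I * (√z.2 : ℝ) * z.1 * ζ.1 + z.2 * ζ.1 ^ 2 -
    z.1 ^ 2 / 2)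

lemma norm_bargmannKernel (ζ : ℂ × ℂ) {z : ℝ × ℝ} (hz : z ∈ halfPlane) :
    ‖bargmannKernel ζ z‖ = Real.exp (-z.2 * (ζ.2.im - ‖ζ.1‖ ^ 2) -
      (z.1 + 2 * √z.2 * ζ.1.im) ^ 2 / 2) := by
  rw [bargmannKernel, Complex.norm_exp]
  congr 1
  have h : √z.2 * √z.2 = z.2 := Real.mul_self_sqrt (le_of_lt hz)
  have h1 : ‖ζ.1‖ ^ 2 = ζ.1.re ^ 2 + ζ.1.im ^ 2 := by
    rw [← Complex.normSq_eq_norm_sq, Complex.normSq_apply]; ring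
  simp only [pow_two, Complex.sub_re, Complex.add_re, Complex.mul_re, Complex.mul_im, Complex.I_re,
    Complex.I_im, Complex.ofReal_re, Complex.ofReal_im, Complex.re_ofNat, Complex.im_ofNat,
    Complex.div_ofNat_re] at h1 ⊢
  rw [h1]
  linear_combination (2 * ζ.1.im ^ 2) * h

lemma continuous_bargmannKernel (ζ : ℂ × ℂ) : Continuous (bargmannKernel ζ) := by
  unfold bargmannKernel; fun_prop

/-- Near a point of `D₂` the kernel has uniform Gaussian decay. -/
lemma exists_norm_bargmannKernel_le {ζ₀ : ℂ × ℂ} (h : ζ₀ ∈ siegelDomain) :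
    ∃ c > 0, ∃ s ∈ 𝓝 ζ₀, ∀ ζ ∈ s, ∀ z ∈ halfPlane,
      ‖bargmannKernel ζ z‖ ≤ Real.exp (-c * (z.1 ^ 2 + z.2)) := by
  have h' : 0 < ζ₀.2.im - ‖ζ₀.1‖ ^ 2 := h
  set d := (ζ₀.2.im - ‖ζ₀.1‖ ^ 2) / 2 with hd
  have hd0 : 0 < d := by positivity
  set M := |ζ₀.1.im| + 1 with hM
  have hs1 : ∀ᶠ ζ : ℂ × ℂ in 𝓝 ζ₀, d < ζ.2.im - ‖ζ.1‖ ^ 2 := by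
    have : ContinuousAt (fun ζ : ℂ × ℂ => ζ.2.im - ‖ζ.1‖ ^ 2) ζ₀ := by fun_prop
    exact this.tendsto.eventually_const_lt (by linarith)
  have hs2 : ∀ᶠ ζ : ℂ × ℂ in 𝓝 ζ₀, |ζ.1.im| < M := by
    have : ContinuousAt (fun ζ : ℂ × ℂ => |ζ.1.im|) ζ₀ := by fun_prop
    exact this.tendsto.eventually_lt_const (by linarith)
  have hM8 : 0 < 8 * M ^ 2 + 1 := by positivity
  refine ⟨min (1 / 4) (d / (8 * M ^ 2 + 1)), by positivity, _, hs1.and hs2, ?_⟩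
  rintro ζ ⟨h1, h2⟩ z hz
  rw [norm_bargmannKernel ζ hz]
  refine Real.exp_le_exp.2 ?_
  set c := min (1 / 4) (d / (8 * M ^ 2 + 1))
  have hc : 0 < c := by positivity
  have hc1 : c ≤ 1 / 4 := min_le_left _ _
  have hc2 : c * (8 * M ^ 2 + 1) ≤ d := (le_div_iff₀ hM8).1 (min_le_right _ _)
  have hz0 : 0 < z.2 := hz
  set r := √z.2
  have hr : r ^ 2 = z.2 := Real.sq_sqrt hz0.le
  set v := ζ.1.im
  have hv : v ^ 2 ≤ M ^ 2 := by
    rw [← sq_abs v]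
    exact pow_le_pow_left₀ (abs_nonneg _) h2.le 2
  have e1 : z.1 ^ 2 ≤ 2 * (z.1 + 2 * r * v) ^ 2 + 8 * z.2 * M ^ 2 := by
    have : 8 * z.2 * v ^ 2 ≤ 8 * z.2 * M ^ 2 := by gcongr
    nlinarith [sq_nonneg (z.1 + 4 * r * v)]
  have e2 : c * z.1 ^ 2 ≤ (z.1 + 2 * r * v) ^ 2 / 2 + c * (8 * z.2 * M ^ 2) := by
    calc c * z.1 ^ 2 ≤ c * (2 * (z.1 + 2 * r * v) ^ 2 + 8 * z.2 * M ^ 2) := by gcongr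
      _ = c * (2 * (z.1 + 2 * r * v) ^ 2) + c * (8 * z.2 * M ^ 2) := by ring
      _ ≤ 1 / 4 * (2 * (z.1 + 2 * r * v) ^ 2) + c * (8 * z.2 * M ^ 2) := by gcongr
      _ = _ := by ring
  have e3 : z.2 * (c * (8 * M ^ 2 + 1)) ≤ z.2 * (ζ.2.im - ‖ζ.1‖ ^ 2) := by
    gcongr
    linarith
  nlinarith

/-- Functions on the half-plane that are integrable against every Gaussian
`exp(-c (x² + t))`, `c > 0`. -/
structure IsTame (m : ℝ × ℝ → ℂ) : Prop where
  meas : AEStronglyMeasurable m halfPlaneMeasure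
  integrable : ∀ c : ℝ, 0 < c →
    Integrable (fun z => ‖m z‖ * Real.exp (-c * (z.1 ^ 2 + z.2))) halfPlaneMeasure

lemma IsTame.add {m m' : ℝ × ℝ → ℂ} (h : IsTame m) (h' : IsTame m') :
    IsTame fun z => m z + m' z where
  meas := h.meas.add h'.meas
  integrable c hc := by
    refine ((h.integrable c hc).add (h'.integrable c hc)).mono'
      ((h.meas.add h'.meas).norm.mul (by fun_prop)) (Filter.Eventually.of_forall fun z => ?_)
    rw [Real.norm_of_nonneg (by positivity), Pi.add_apply, ← add_mul]
    gcongr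
    exact norm_add_le _ _

lemma IsTame.zero : IsTame fun _ => 0 where
  meas := aestronglyMeasurable_const
  integrable c hc := by simp

lemma IsTame.sum {ι : Type*} (s : Finset ι) {m : ι → ℝ × ℝ → ℂ} (h : ∀ i ∈ s, IsTame (m i)) :
    IsTame fun z => ∑ i ∈ s, m i z := by
  classical
  induction s using Finset.induction_on with
  | empty => simpa using IsTame.zero
  | insert a s ha ih =>
    simp_rw [Finset.sum_insert ha]
    exact (h a (by simp)).add (ih fun i hi => h i (by simp [hi]))

/-- Factors of at most quadratic growth in `(x, √t)` preserve tameness. -/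
lemma IsTame.mul {m w : ℝ × ℝ → ℂ} (h : IsTame m) (hw : Measurable w) (C : ℝ)
    (hwb : ∀ z ∈ halfPlane, ‖w z‖ ≤ C * (1 + z.1 ^ 2 + z.2)) : IsTame fun z => w z * m z where
  meas := hw.aestronglyMeasurable.mul h.meas
  integrable c hc := by
    refine ((h.integrable (c / 2) (by positivity)).const_mul (|C| * (1 + 2 / c))).mono'
      ((hw.aestronglyMeasurable.mul h.meas).norm.mul (by fun_prop)) ?_
    filter_upwards [ae_restrict_mem measurableSet_halfPlane] with z hz
    have hz0 : 0 < z.2 := hz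
    rw [Real.norm_of_nonneg (by positivity), norm_mul]
    set s := z.1 ^ 2 + z.2 with hs
    have hs0 : 0 ≤ s := by positivity
    have h1 : ‖w z‖ ≤ |C| * (1 + s) := by
      refine (hwb z hz).trans ?_
      rw [show 1 + z.1 ^ 2 + z.2 = 1 + s by rw [hs]; ring]
      gcongr
      exact le_abs_self C
    have h2 : (1 + s) ≤ (1 + 2 / c) * Real.exp (c / 2 * s) := by
      have h3 := Real.add_one_le_exp (c / 2 * s)
      have h4 : 0 ≤ c / 2 * s := by positivity
      have h5 : s = 2 / c * (c / 2 * s) := by field_simp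
      calc 1 + s = 1 + 2 / c * (c / 2 * s) := by rw [← h5]
        _ ≤ Real.exp (c / 2 * s) + 2 / c * Real.exp (c / 2 * s) := by
            gcongr <;> linarith
        _ = _ := by ring
    have h6 : Real.exp (-c * s) = Real.exp (-(c / 2) * s) * Real.exp (-(c / 2) * s) := by
      rw [← Real.exp_add]; congr 1; ring
    have h7 : Real.exp (c / 2 * s) * Real.exp (-(c / 2) * s) = 1 := by
      rw [← Real.exp_add]; simp
    calc ‖w z‖ * ‖m z‖ * Real.exp (-c * s)
        ≤ |C| * ((1 + 2 / c) * Real.exp (c / 2 * s)) * ‖m z‖ * Real.exp (-c * s) := by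
          gcongr
          exact h1.trans (by gcongr)
      _ = |C| * (1 + 2 / c) * (‖m z‖ * Real.exp (-(c / 2) * s)) *
          (Real.exp (c / 2 * s) * Real.exp (-(c / 2) * s)) := by rw [h6]; ring
      _ = _ := by rw [h7, mul_one]

lemma IsTame.const_mul {m : ℝ × ℝ → ℂ} (h : IsTame m) (a : ℂ) : IsTame fun z => a * m z :=
  h.mul measurable_const ‖a‖ fun z hz => by
    have hz0 : 0 < z.2 := hz
    have : 0 ≤ ‖a‖ * (z.1 ^ 2 + z.2) := by positivity
    linarith

lemma IsTame.snd_mul {m : ℝ × ℝ → ℂ} (h : IsTame m) : IsTame fun z => (z.2 : ℂ) * m z :=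
  h.mul (by fun_prop) 1 fun z hz => by
    have hz0 : 0 < z.2 := hz
    rw [Complex.norm_real, Real.norm_of_nonneg hz0.le]
    nlinarith [sq_nonneg z.1]

lemma IsTame.fst_mul {m : ℝ × ℝ → ℂ} (h : IsTame m) : IsTame fun z => (z.1 : ℂ) * m z :=
  h.mul (by fun_prop) 1 fun z hz => by
    have hz0 : 0 < z.2 := hz
    rw [Complex.norm_real, Real.norm_eq_abs]
    nlinarith [sq_nonneg (|z.1| - 1), sq_abs z.1]

lemma IsTame.sqrt_mul {m : ℝ × ℝ → ℂ} (h : IsTame m) : IsTame fun z => ((√z.2 : ℝ) : ℂ) * m z :=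
  h.mul (by fun_prop) 1 fun z hz => by
    have hz0 : 0 < z.2 := hz
    rw [Complex.norm_real, Real.norm_of_nonneg (Real.sqrt_nonneg _)]
    nlinarith [sq_nonneg (√z.2 - 1), Real.sq_sqrt hz0.le, sq_nonneg z.1]

lemma IsTame.polynomial_mul {m : ℝ × ℝ → ℂ} (h : IsTame m) (p : Polynomial ℝ) :
    IsTame fun z => ((p.eval z.1 : ℝ) : ℂ) * m z := by
  induction p using Polynomial.induction_on' with
  | add p q hp hq =>
    simp only [Polynomial.eval_add, Complex.ofReal_add, add_mul]
    exact hp.add hq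
  | monomial k a =>
    induction k with
    | zero => simpa using h.const_mul a
    | succ k ih =>
      have e : (fun z : ℝ × ℝ => (((Polynomial.monomial (k + 1) a).eval z.1 : ℝ) : ℂ) * m z) =
          fun z => (z.1 : ℂ) * (((Polynomial.monomial k a).eval z.1 : ℝ) * m z) := by
        ext z
        simp only [Polynomial.eval_monomial]
        push_cast
        ring
      rw [e]
      exact ih.fst_mul

lemma isTame_Lp (g : Lp ℂ 2 halfPlaneMeasure) : IsTame g where
  meas := (Lp.memLp g).1
  integrable c hc := by
    have h1 : MemLp (fun z : ℝ × ℝ => Real.exp (-c * (z.1 ^ 2 + z.2))) 2 halfPlaneMeasure := by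
      rw [memLp_two_iff_integrable_sq (by fun_prop), halfPlaneMeasure_eq]
      have h2 : Integrable fun x : ℝ => Real.exp (-(2 * c) * x ^ 2) :=
        integrable_exp_neg_mul_sq (by positivity)
      have h3 : Integrable (fun t : ℝ => Real.exp (-(2 * c) * t)) (volume.restrict (Set.Ioi 0)) :=
        exp_neg_integrableOn_Ioi 0 (by positivity)
      refine (h2.mul_prod h3).congr (Filter.Eventually.of_forall fun z => ?_)
      simp only
      rw [← Real.exp_add, ← Real.exp_nat_mul]
      congr 1
      push_cast
      ring
    exact (Lp.memLp g).norm.integrable_mul h1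

/-- The integral `∫ m(x, t) exp(i t ζ₂ + 2i √t x ζ₁ + t ζ₁² - x²/2) dx dt` over the half-plane. -/
noncomputable def bargmannIntegral (m : ℝ × ℝ → ℂ) (ζ : ℂ × ℂ) : ℂ :=
  ∫ z, m z * bargmannKernel ζ z ∂halfPlaneMeasure

lemma IsTame.integrable_mul_kernel {m : ℝ × ℝ → ℂ} (h : IsTame m) {ζ : ℂ × ℂ}
    (hζ : ζ ∈ siegelDomain) : Integrable (fun z => m z * bargmannKernel ζ z) halfPlaneMeasure := by
  obtain ⟨c, hc, s, hs, hb⟩ := exists_norm_bargmannKernel_le hζ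
  refine (h.integrable c hc).mono'
    (h.meas.mul (continuous_bargmannKernel ζ).aestronglyMeasurable) ?_
  filter_upwards [ae_restrict_mem measurableSet_halfPlane] with z hz
  rw [norm_mul]
  gcongr
  exact hb ζ (mem_of_mem_nhds hs) z hz

lemma hasFDerivAt_bargmannKernel (ζ : ℂ × ℂ) (z : ℝ × ℝ) :
    HasFDerivAt (fun ζ => bargmannKernel ζ z) (bargmannKernel ζ z •
      ((2 * Complex.I * (√z.2 : ℝ) * z.1 + 2 * z.2 * ζ.1) • ContinuousLinearMap.fst ℂ ℂ ℂ +
        (Complex.I * z.2) • ContinuousLinearMap.snd ℂ ℂ ℂ)) ζ := by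
  have h1 : HasFDerivAt (fun ζ : ℂ × ℂ => ζ.1) (ContinuousLinearMap.fst ℂ ℂ ℂ) ζ := hasFDerivAt_fst
  have h2 : HasFDerivAt (fun ζ : ℂ × ℂ => ζ.2) (ContinuousLinearMap.snd ℂ ℂ ℂ) ζ := hasFDerivAt_snd
  refine ((((h2.const_mul (Complex.I * z.2)).add
    (h1.const_mul (2 * Complex.I * (√z.2 : ℝ) * z.1))).add
    ((h1.pow 2).const_mul (z.2 : ℂ))).sub_const ((z.1 : ℂ) ^ 2 / 2)).cexp.congr_fderiv ?_
  unfold bargmannKernel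
  congr 1
  ext
  · simp
    ring
  · simp

/-- Derivatives of these integrals are integrals of the same kind. -/
lemma IsTame.hasFDerivAt {m : ℝ × ℝ → ℂ} (h : IsTame m) {ζ : ℂ × ℂ} (hζ : ζ ∈ siegelDomain) :
    HasFDerivAt (bargmannIntegral m)
      ((bargmannIntegral (fun z => 2 * Complex.I * ((√z.2 : ℝ) * (z.1 * m z))) ζ +
        2 * ζ.1 * bargmannIntegral (fun z => z.2 * m z) ζ) • ContinuousLinearMap.fst ℂ ℂ ℂ +
        bargmannIntegral (fun z => Complex.I * (z.2 * m z)) ζ • ContinuousLinearMap.snd ℂ ℂ ℂ)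
      ζ := by
  obtain ⟨c, hc, s, hs, hb⟩ := exists_norm_bargmannKernel_le hζ
  have hm1 : IsTame fun z : ℝ × ℝ => 2 * Complex.I * ((√z.2 : ℝ) * (z.1 * m z)) :=
    h.fst_mul.sqrt_mul.const_mul _
  have hm2 := h.snd_mul
  have hm3 : IsTame fun z : ℝ × ℝ => Complex.I * (z.2 * m z) := hm2.const_mul _
  let F' : ℂ × ℂ → ℝ × ℝ → (ℂ × ℂ →L[ℂ] ℂ) := fun ζ z => m z • (bargmannKernel ζ z •
    ((2 * Complex.I * (√z.2 : ℝ) * z.1 + 2 * z.2 * ζ.1) • ContinuousLinearMap.fst ℂ ℂ ℂ +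
      (Complex.I * z.2) • ContinuousLinearMap.snd ℂ ℂ ℂ))
  have hF' : ∀ ζ z, F' ζ z = (2 * Complex.I * ((√z.2 : ℝ) * (z.1 * m z)) * bargmannKernel ζ z) •
      ContinuousLinearMap.fst ℂ ℂ ℂ + (2 * ζ.1) • ((z.2 * m z * bargmannKernel ζ z) •
      ContinuousLinearMap.fst ℂ ℂ ℂ) +
      (Complex.I * (z.2 * m z) * bargmannKernel ζ z) • ContinuousLinearMap.snd ℂ ℂ ℂ := by
    intro ζ z
    ext <;> simp [F'] <;> ring
  have hint : ∫ z, F' ζ z ∂halfPlaneMeasure =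
      ((bargmannIntegral (fun z => 2 * Complex.I * ((√z.2 : ℝ) * (z.1 * m z))) ζ +
        2 * ζ.1 * bargmannIntegral (fun z => z.2 * m z) ζ) • ContinuousLinearMap.fst ℂ ℂ ℂ +
        bargmannIntegral (fun z => Complex.I * (z.2 * m z)) ζ •
          ContinuousLinearMap.snd ℂ ℂ ℂ) := by
    have i1 := (hm1.integrable_mul_kernel hζ).smul_const (ContinuousLinearMap.fst ℂ ℂ ℂ)
    have i2 := ((hm2.integrable_mul_kernel hζ).smul_const (ContinuousLinearMap.fst ℂ ℂ ℂ)).smul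
      (2 * ζ.1)
    have i3 := (hm3.integrable_mul_kernel hζ).smul_const (ContinuousLinearMap.snd ℂ ℂ ℂ)
    rw [integral_congr_ae (Filter.Eventually.of_forall (hF' ζ))]
    refine (integral_add (i1.add i2) i3).trans ?_
    rw [integral_add' i1 i2]
    simp only [Pi.smul_apply]
    rw [integral_smul_const, integral_smul, integral_smul_const, integral_smul_const]
    simp only [bargmannIntegral]
    rw [smul_smul, ← add_smul]
  rw [← hint]
  let N : ℝ := ‖ζ.1‖ + 1
  have hN : ∀ᶠ ξ : ℂ × ℂ in 𝓝 ζ, ‖ξ.1‖ < N := by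
    have : ContinuousAt (fun ξ : ℂ × ℂ => ‖ξ.1‖) ζ := by fun_prop
    exact this.tendsto.eventually_lt_const (by simp [N])
  have hN0 : 0 < N := by positivity
  refine hasFDerivAt_integral_of_dominated_of_fderiv_le
    (s := s ∩ {ξ : ℂ × ℂ | ‖ξ.1‖ < N})
    (bound := fun z => (‖2 * Complex.I * ((√z.2 : ℝ) * (z.1 * m z))‖ + 2 * N * ‖z.2 * m z‖ +
      ‖Complex.I * (z.2 * m z)‖) * Real.exp (-c * (z.1 ^ 2 + z.2)))
    (Filter.inter_mem hs hN) ?_ (h.integrable_mul_kernel hζ) ?_ ?_ ?_ ?_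
  · exact Filter.Eventually.of_forall fun ξ =>
      h.meas.mul (continuous_bargmannKernel ξ).aestronglyMeasurable
  · refine h.meas.smul ((continuous_bargmannKernel ζ).smul ?_).aestronglyMeasurable
    fun_prop
  · filter_upwards [ae_restrict_mem measurableSet_halfPlane] with z hz ξ hξ
    have hE := hb ξ hξ.1 z hz
    have hξN : ‖ξ.1‖ ≤ N := le_of_lt hξ.2
    rw [hF' ξ z]
    have n1 : ‖ContinuousLinearMap.fst ℂ ℂ ℂ‖ ≤ 1 := ContinuousLinearMap.norm_fst_le ..
    have n2 : ‖ContinuousLinearMap.snd ℂ ℂ ℂ‖ ≤ 1 := ContinuousLinearMap.norm_snd_le ..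
    refine (norm_add₃_le ..).trans ?_
    have b : ∀ (w : ℂ) (L : ℂ × ℂ →L[ℂ] ℂ), ‖L‖ ≤ 1 → ‖(w * bargmannKernel ξ z) • L‖ ≤
        ‖w‖ * Real.exp (-c * (z.1 ^ 2 + z.2)) := by
      intro w L hL
      rw [norm_smul, norm_mul]
      calc ‖w‖ * ‖bargmannKernel ξ z‖ * ‖L‖ ≤ ‖w‖ * Real.exp (-c * (z.1 ^ 2 + z.2)) * 1 := by
            gcongr
        _ = _ := mul_one _
    have b1 := b (2 * Complex.I * ((√z.2 : ℝ) * (z.1 * m z))) _ n1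
    have b2 := b (z.2 * m z) _ n1
    have b3 := b (Complex.I * (z.2 * m z)) _ n2
    have b2' : ‖(2 * ξ.1) • ((z.2 * m z * bargmannKernel ξ z) • ContinuousLinearMap.fst ℂ ℂ ℂ)‖ ≤
        2 * N * (‖z.2 * m z‖ * Real.exp (-c * (z.1 ^ 2 + z.2))) := by
      rw [norm_smul, norm_mul, Complex.norm_ofNat]
      gcongr
    linarith
  · have j1 := hm1.integrable c hc
    have j2 := (hm2.integrable c hc).const_mul (2 * N)
    have j3 := hm3.integrable c hc
    refine ((j1.add j2).add j3).congr (Filter.Eventually.of_forall fun z => ?_)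
    simp only [Pi.add_apply]
    ring
  · filter_upwards with z ξ _
    exact ((hasFDerivAt_bargmannKernel ξ z).const_mul (m z))

lemma IsTame.contDiffOn {m : ℝ × ℝ → ℂ} (h : IsTame m) :
    ContDiffOn ℂ ∞ (bargmannIntegral m) siegelDomain := by
  rw [contDiffOn_infty]
  intro k
  induction k generalizing m with
  | zero =>
    refine contDiffOn_zero.2 fun ζ hζ => (h.hasFDerivAt hζ).continuousAt.continuousWithinAt
  | succ k ih =>
    push_cast
    rw [contDiffOn_succ_iff_fderiv_of_isOpen isOpen_siegelDomain]
    refine ⟨fun ζ hζ => (h.hasFDerivAt hζ).differentiableAt.differentiableWithinAt, by simp, ?_⟩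
    refine ContDiffOn.congr ?_ fun ζ hζ => (h.hasFDerivAt hζ).fderiv
    have h1 := ih (h.fst_mul.sqrt_mul.const_mul (2 * Complex.I))
    have h2 := ih h.snd_mul
    have h3 := ih (h.snd_mul.const_mul Complex.I)
    exact ((h1.add ((contDiffOn_const.mul contDiffOn_fst).mul h2)).smul contDiffOn_const).add
      (h3.smul contDiffOn_const)

end LaplaceIntegrals

/-! ### Expansions in powers of `Im ζ₁` -/

section ImExpansion
open scoped ContDiff

/-- `f = ∑_{l < n} (Im ζ₁)^l a_l` on `D₂` with holomorphic coefficients `a_l`. -/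
structure HasImExpansion (n : ℕ) (f : ℂ × ℂ → ℂ) (a : ℕ → ℂ × ℂ → ℂ) : Prop where
  holo : ∀ l, DifferentiableOn ℂ (a l) siegelDomain
  eq : ∀ ζ ∈ siegelDomain, f ζ = ∑ l ∈ Finset.range n, (ζ.1.im : ℂ) ^ l * a l ζ

lemma HasImExpansion.fderiv_apply {n : ℕ} {f : ℂ × ℂ → ℂ} {a : ℕ → ℂ × ℂ → ℂ}
    (h : HasImExpansion n f a) {ζ : ℂ × ℂ} (hζ : ζ ∈ siegelDomain) (v : ℂ × ℂ) :
    fderiv ℝ f ζ v = ∑ l ∈ Finset.range n, ((l * (ζ.1.im : ℂ) ^ (l - 1) * v.1.im) * a l ζ +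
      (ζ.1.im : ℂ) ^ l * fderiv ℂ (a l) ζ v) := by
  have hE : Set.EqOn f (fun ζ => ∑ l ∈ Finset.range n, (ζ.1.im : ℂ) ^ l * a l ζ) siegelDomain :=
    h.eq
  rw [fderiv_congr_on hE hζ]
  have him : HasFDerivAt (fun ζ : ℂ × ℂ => (ζ.1.im : ℂ))
      ((Complex.ofRealCLM ∘L Complex.imCLM) ∘L ContinuousLinearMap.fst ℝ ℂ ℂ) ζ :=
    ((Complex.ofRealCLM ∘L Complex.imCLM) ∘L ContinuousLinearMap.fst ℝ ℂ ℂ).hasFDerivAt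
  have hd : ∀ l, HasFDerivAt (a l) ((fderiv ℂ (a l) ζ).restrictScalars ℝ) ζ := fun l =>
    (((h.holo l).differentiableAt
      (isOpen_siegelDomain.mem_nhds hζ)).hasFDerivAt).restrictScalars ℝ
  have hs := HasFDerivAt.fun_sum (u := Finset.range n) fun l _ => (him.pow l).mul (hd l)
  change fderiv ℝ (fun y => ∑ i ∈ Finset.range n,
    ((fun x : ℂ × ℂ => (x.1.im : ℂ) ^ i) * a i) y) ζ v = _
  rw [hs.fderiv]
  simp only [sum_apply]
  refine Finset.sum_congr rfl fun l _ => ?_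
  simp
  ring

lemma HasImExpansion.dbar₁_eq {n : ℕ} {f : ℂ × ℂ → ℂ} {a : ℕ → ℂ × ℂ → ℂ}
    (h : HasImExpansion n f a) {ζ : ℂ × ℂ} (hζ : ζ ∈ siegelDomain) :
    dbar₁ f ζ = ∑ l ∈ Finset.range n, (Complex.I / 2 * l) * (ζ.1.im : ℂ) ^ (l - 1) * a l ζ := by
  rw [dbar₁, h.fderiv_apply hζ, h.fderiv_apply hζ, Finset.mul_sum, ← Finset.sum_add_distrib,
    Finset.sum_div]
  refine Finset.sum_congr rfl fun l _ => ?_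
  have : fderiv ℂ (a l) ζ (Complex.I, 0) = Complex.I * fderiv ℂ (a l) ζ (1, 0) := by
    rw [← smul_eq_mul, ← map_smul]; simp
  rw [this]
  simp only [Complex.one_im, Complex.I_im, Complex.ofReal_zero, Complex.ofReal_one]
  linear_combination ((ζ.1.im : ℂ) ^ l * fderiv ℂ (a l) ζ (1, 0) / 2) * Complex.I_mul_I

lemma HasImExpansion.dbar₂_eq {n : ℕ} {f : ℂ × ℂ → ℂ} {a : ℕ → ℂ × ℂ → ℂ}
    (h : HasImExpansion n f a) {ζ : ℂ × ℂ} (hζ : ζ ∈ siegelDomain) : dbar₂ f ζ = 0 := by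
  rw [dbar₂, h.fderiv_apply hζ, h.fderiv_apply hζ, Finset.mul_sum, ← Finset.sum_add_distrib,
    Finset.sum_div]
  refine Finset.sum_eq_zero fun l _ => ?_
  have : fderiv ℂ (a l) ζ (0, Complex.I) = Complex.I * fderiv ℂ (a l) ζ (0, 1) := by
    rw [← smul_eq_mul, ← map_smul]; simp
  rw [this]
  simp only [Complex.zero_im, Complex.ofReal_zero]
  linear_combination ((ζ.1.im : ℂ) ^ l * fderiv ℂ (a l) ζ (0, 1) / 2) * Complex.I_mul_I

lemma HasImExpansion.tangentialDbar {n : ℕ} {f : ℂ × ℂ → ℂ} {a : ℕ → ℂ × ℂ → ℂ}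
    (h : HasImExpansion (n + 1) f a) : HasImExpansion n (tangentialDbar f)
      (fun l ζ => (Complex.I / 2 * (l + 1 : ℕ)) * a (l + 1) ζ) where
  holo l := (h.holo (l + 1)).const_mul _
  eq ζ hζ := by
    rw [SiegelToeplitz.tangentialDbar, h.dbar₁_eq hζ, h.dbar₂_eq hζ, Finset.sum_range_succ']
    simp only [Nat.cast_zero, mul_zero, zero_mul, add_zero, sub_zero, Nat.add_sub_cancel]
    refine Finset.sum_congr rfl fun l _ => ?_
    ring

lemma HasImExpansion.iterate_tangentialDbar {n : ℕ} {f : ℂ × ℂ → ℂ} {a : ℕ → ℂ × ℂ → ℂ}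
    (h : HasImExpansion n f a) {ζ : ℂ × ℂ} (hζ : ζ ∈ siegelDomain) :
    (SiegelToeplitz.tangentialDbar^[n]) f ζ = 0 := by
  induction n generalizing f a with
  | zero => simpa using h.eq ζ hζ
  | succ n ih =>
    rw [Function.iterate_succ_apply]
    exact ih h.tangentialDbar

lemma HasImExpansion.isPolyAnalytic {n : ℕ} {f : ℂ × ℂ → ℂ} {a : ℕ → ℂ × ℂ → ℂ}
    (h : HasImExpansion n f a) (ha : ∀ l, ContDiffOn ℂ ∞ (a l) siegelDomain) :
    IsPolyAnalytic n 1 f where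
  smooth := by
    refine ContDiffOn.congr (f := fun ζ => ∑ l ∈ Finset.range n, (ζ.1.im : ℂ) ^ l * a l ζ) ?_ h.eq
    refine ContDiffOn.sum fun l _ => ContDiffOn.mul ?_ ((ha l).restrict_scalars ℝ)
    have : ContDiff ℝ ∞ fun ζ : ℂ × ℂ => (ζ.1.im : ℂ) :=
      (Complex.ofRealCLM ∘L Complex.imCLM ∘L ContinuousLinearMap.fst ℝ ℂ ℂ).contDiff
    exact (this.pow l).contDiffOn
  tangential ζ hζ := h.iterate_tangentialDbar hζ
  transversal ζ hζ := h.dbar₂_eq hζ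

end ImExpansion

/-! ### Substitutions on slices -/

section ChangeOfVariables

/-- `(x, t) ↦ (2√t x + 2 t v, t)`. -/
noncomputable def shiftMap (v : ℝ) (z : ℝ × ℝ) : ℝ × ℝ := (2 * √z.2 * z.1 + 2 * z.2 * v, z.2)

lemma measurable_shiftMap (v : ℝ) : Measurable (shiftMap v) := by
  unfold shiftMap; fun_prop

/-- The substitution `t₁ = 2√t₂ x + 2 t₂ v`, whose Jacobian is `2√t₂`. -/
lemma map_shiftMap (v : ℝ) : (halfPlaneMeasure.withDensity
    fun z => ((2 * Real.toNNReal (√z.2) : NNReal) : ℝ≥0∞)).map (shiftMap v) = halfPlaneMeasure := by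
  refine Measure.ext_of_lintegral _ fun F hF => ?_
  have hw : Measurable fun z : ℝ × ℝ => ((2 * Real.toNNReal (√z.2) : NNReal) : ℝ≥0∞) := by fun_prop
  have hFs : Measurable fun z => F (shiftMap v z) := hF.comp (measurable_shiftMap v)
  rw [lintegral_map hF (measurable_shiftMap v),
    lintegral_withDensity_eq_lintegral_mul _ hw hFs, halfPlaneMeasure_eq,
    lintegral_prod_symm _ (hw.mul hFs).aemeasurable, lintegral_prod_symm _ hF.aemeasurable]
  refine setLIntegral_congr_fun measurableSet_Ioi fun t ht => ?_
  have ht0 : (0 : ℝ) < t := ht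
  have hr : 0 < 2 * √t := by positivity
  simp only [Pi.mul_apply, shiftMap]
  have hFt : Measurable fun x => F (x, t) := hF.comp measurable_prodMk_right
  have h0 : Measurable fun x => F (2 * √t * x + 2 * t * v, t) :=
    hFt.comp (by fun_prop : Measurable fun x => 2 * √t * x + 2 * t * v)
  rw [lintegral_const_mul _ h0]
  have h1 : ∫⁻ x, F (2 * √t * x + 2 * t * v, t) = ∫⁻ x, F (2 * √t * (x + 2 * t * v / (2 * √t)), t) := by
    congr 1; ext x; congr 2; field_simp
  have h2 := lintegral_add_right_eq_self (μ := (volume : Measure ℝ)) (fun x => F (2 * √t * x, t))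
    (2 * t * v / (2 * √t))
  have h3 : ∫⁻ x, F (x, t) = ENNReal.ofReal (2 * √t) * ∫⁻ x, F (2 * √t * x, t) := by
    conv_lhs => rw [← Real.smul_map_volume_mul_left hr.ne', abs_of_pos hr]
    rw [lintegral_smul_measure, lintegral_map hFt (by fun_prop), smul_eq_mul]
  rw [h1, h2, h3]
  congr 1
  rw [ENNReal.ofReal, Real.toNNReal_mul (by norm_num)]
  simp

lemma integrable_comp_shiftMap {v : ℝ} {F : ℝ × ℝ → ℂ} (hF : Measurable F) :
    Integrable (fun z => ((2 * √z.2 : ℝ) : ℂ) * F (shiftMap v z)) halfPlaneMeasure ↔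
      Integrable F halfPlaneMeasure := by
  conv_rhs => rw [← map_shiftMap v]
  rw [integrable_map_measure hF.aestronglyMeasurable (measurable_shiftMap v).aemeasurable,
    integrable_withDensity_iff_integrable_smul (by fun_prop)]
  refine integrable_congr (Filter.Eventually.of_forall fun z => ?_)
  simp [NNReal.smul_def]

lemma integral_comp_shiftMap {v : ℝ} {F : ℝ × ℝ → ℂ} (hF : Measurable F) :
    ∫ z, ((2 * √z.2 : ℝ) : ℂ) * F (shiftMap v z) ∂halfPlaneMeasure =
      ∫ z, F z ∂halfPlaneMeasure := by
  conv_rhs => rw [← map_shiftMap v]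
  rw [integral_map (measurable_shiftMap v).aemeasurable hF.aestronglyMeasurable,
    integral_withDensity_eq_integral_smul (by fun_prop)]
  congr 1
  ext z
  simp [NNReal.smul_def]

/-- Square integrability can be tested after the substitutions of `V₁` and `V₂`. -/
lemma memLp_of_comp_psi {G : (ℝ × ℝ) × (ℝ × ℝ) → ℂ} (hG : Measurable G)
    (h : MemLp (fun p => weight₁ (psi₂ p) * G (psi₁ (psi₂ p))) 2 flatMeasure) :
    MemLp G 2 flatMeasure := by
  refine ⟨hG.aestronglyMeasurable, ?_⟩
  have hG1 : Measurable fun p => weight₁ p * G (psi₁ p) :=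
    measurable_weight₁.mul (hG.comp measurable_psi₁)
  have h1 : eLpNorm G 2 flatMeasure = eLpNorm (fun p => weight₁ p * G (psi₁ p)) 2 flatMeasure := by
    refine eLpNorm_two_eq_of_sq ?_
    have hm : Measurable fun y => ‖G y‖ₑ ^ 2 := hG.enorm.pow_const 2
    conv_lhs => rw [← map_psi₁, lintegral_map hm measurable_psi₁]
    refine (lintegral_withDensity_eq_lintegral_mul _ (measurable_weight₁.enorm.pow_const 2)
      (hm.comp measurable_psi₁)).trans ?_
    simp only [enorm_mul, mul_pow, Pi.mul_apply, Function.comp_def]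
  rw [h1, ← eLpNorm_comp_measurePreserving hG1.aestronglyMeasurable measurePreserving_psi₂]
  exact h.2

end ChangeOfVariables

/-! ### The inverse transform -/

section Surjectivity
open Polynomial

/-- The polynomial part of `h_k`. -/
noncomputable def hermitePart (k : ℕ) : ℝ[X] := C (hermiteNorm k) * hermitePolynomial k

lemma hermiteFun_eq_hermitePart (k : ℕ) (y : ℝ) :
    hermiteFun k y = (hermitePart k).eval y * Real.exp (-y ^ 2 / 2) := by
  rw [hermiteFun_eq, hermitePart, eval_mul, eval_C]

lemma natDegree_hermitePart_le (k : ℕ) : (hermitePart k).natDegree ≤ k :=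
  (natDegree_C_mul_le _ _).trans (natDegree_hermitePolynomial_le k)

/-- Taylor expansion of the polynomial part of a Hermite function. -/
lemma eval_add_hermitePart {n : ℕ} (k : Fin n) (x s : ℝ) : (hermitePart k).eval (x + s) =
    ∑ l ∈ Finset.range n, s ^ l * (hasseDeriv l (hermitePart k)).eval x := by
  rw [add_comm, ← taylor_eval, eval_eq_sum_range' (n := n)]
  · refine Finset.sum_congr rfl fun l _ => ?_
    rw [taylor_coeff, mul_comm]
  · rw [natDegree_taylor]
    exact (natDegree_hermitePart_le k).trans_lt k.2

/-- The density of the coefficient of `(Im ζ₁)^l` in the inverse transform of `g`. -/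
noncomputable def coeffDensity (n : ℕ) (g : L2n n) (l : ℕ) (z : ℝ × ℝ) : ℂ :=
  (√2 / π : ℝ) * (z.2 * (((2 * √z.2 : ℝ) : ℂ) ^ l * ∑ k : Fin n,
    (((hasseDeriv l (hermitePart k)).eval z.1 : ℝ) : ℂ) * g k z))

lemma isTame_coeffDensity (n : ℕ) (g : L2n n) (l : ℕ) : IsTame (coeffDensity n g l) := by
  refine IsTame.const_mul (IsTame.snd_mul ?_) _
  suffices h : ∀ (m : ℝ × ℝ → ℂ), IsTame m →
      IsTame fun z => ((2 * √z.2 : ℝ) : ℂ) ^ l * m z from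
    h _ (IsTame.sum _ fun k _ => (isTame_Lp (g k)).polynomial_mul _)
  intro m h0
  induction l with
  | zero => simpa using h0
  | succ l ih =>
    have e : (fun z : ℝ × ℝ => ((2 * √z.2 : ℝ) : ℂ) ^ (l + 1) * m z) =
        fun z => 2 * ((√z.2 : ℝ) * (((2 * √z.2 : ℝ) : ℂ) ^ l * m z)) := by
      ext z
      push_cast
      ring
    rw [e]
    exact ih.sqrt_mul.const_mul 2

/-- The inverse transform of `g`, as an explicit function on `D₂`. -/
noncomputable def inverseTransform (n : ℕ) (g : L2n n) (ζ : ℂ × ℂ) : ℂ :=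
  ∑ l ∈ Finset.range n, (ζ.1.im : ℂ) ^ l * bargmannIntegral (coeffDensity n g l) ζ

lemma isPolyAnalytic_inverseTransform (n : ℕ) (g : L2n n) :
    IsPolyAnalytic n 1 (inverseTransform n g) :=
  HasImExpansion.isPolyAnalytic (a := fun l => bargmannIntegral (coeffDensity n g l))
    ⟨fun l => (isTame_coeffDensity n g l).contDiffOn.differentiableOn (by simp), fun _ _ => rfl⟩
    fun l => (isTame_coeffDensity n g l).contDiffOn

/-- The function `V₁⁻¹ V₂⁻¹ R₀ g`. -/
noncomputable def flatTransform (n : ℕ) (g : L2n n) (q : (ℝ × ℝ) × (ℝ × ℝ)) : ℂ :=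
  let x₁ := q.1.1 / (2 * √q.1.2) - √q.1.2 * q.2.1
  halfPlane.indicator (fun _ => ((√(2 * q.1.2) * Real.exp (-q.1.2 * q.2.2) : ℝ) : ℂ) *
    ∑ k : Fin n, (hermiteFun k (x₁ + 2 * √q.1.2 * q.2.1) : ℂ) * g k (x₁, q.1.2)) q.1

lemma measurable_flatTransform (n : ℕ) (g : L2n n) : Measurable (flatTransform n g) := by
  have h1 : ∀ k : Fin n, Measurable fun z => g k z := fun k =>
    (Lp.stronglyMeasurable (g k)).measurable
  have h2 : ∀ k : Fin n, Measurable (hermiteFun k) := fun k => (continuous_hermiteFun k).measurable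
  have h3 : Measurable fun q : (ℝ × ℝ) × (ℝ × ℝ) =>
      q.1.1 / (2 * √q.1.2) - √q.1.2 * q.2.1 := by fun_prop
  have e : flatTransform n g = (halfPlane ×ˢ (Set.univ : Set (ℝ × ℝ))).indicator (fun q =>
      ((√(2 * q.1.2) * Real.exp (-q.1.2 * q.2.2) : ℝ) : ℂ) *
    ∑ k : Fin n, (hermiteFun k (q.1.1 / (2 * √q.1.2) - √q.1.2 * q.2.1 + 2 * √q.1.2 * q.2.1) : ℂ) *
      g k (q.1.1 / (2 * √q.1.2) - √q.1.2 * q.2.1, q.1.2)) := by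
    ext q
    by_cases h : q.1 ∈ halfPlane <;> simp [flatTransform, h]
  rw [e]
  refine Measurable.indicator (Measurable.mul (by fun_prop) ?_)
    (measurableSet_halfPlane.prod MeasurableSet.univ)
  refine Finset.measurable_fun_sum _ fun k _ => ?_
  exact (Complex.measurable_ofReal.comp ((h2 k).comp (by fun_prop))).mul
    ((h1 k).comp (by fun_prop))

lemma flatTransform_comp_psi (n : ℕ) (g : L2n n) (p : (ℝ × ℝ) × (ℝ × ℝ)) :
    weight₁ (psi₂ p) * flatTransform n g (psi₁ (psi₂ p)) =
      ∑ k : Fin n, halfPlane.indicator (g k) p.1 * basisFun k p.2 := by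
  by_cases hp : p.1 ∈ halfPlane
  · have h0 : 0 < p.1.2 := hp
    have ha : |p.1.2| = p.1.2 := abs_of_pos h0
    have hs : 0 < √p.1.2 := Real.sqrt_pos.2 h0
    have hss : √p.1.2 * √p.1.2 = p.1.2 := Real.mul_self_sqrt h0.le
    have hq : (psi₁ (psi₂ p)).1 ∈ halfPlane := hp
    have hx : (psi₁ (psi₂ p)).1.1 / (2 * √(psi₁ (psi₂ p)).1.2) -
        √(psi₁ (psi₂ p)).1.2 * (psi₁ (psi₂ p)).2.1 = p.1.1 := by
      simp only [psi₁, psi₂, ha]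
      field_simp
      ring
    have hy : p.1.1 + 2 * √(psi₁ (psi₂ p)).1.2 * (psi₁ (psi₂ p)).2.1 = p.2.1 := by
      simp only [psi₁, psi₂, ha]
      field_simp
      ring
    simp only [flatTransform, Set.indicator_of_mem hq, Set.indicator_of_mem hp, hx, hy]
    rw [← mul_assoc]
    have hw : weight₁ (psi₂ p) * ((√(2 * (psi₁ (psi₂ p)).1.2) *
        Real.exp (-(psi₁ (psi₂ p)).1.2 * (psi₁ (psi₂ p)).2.2) : ℝ) : ℂ) =
        (laguerreFun₀ p.2.2 : ℂ) := by
      rw [weight₁, ← Complex.ofReal_mul]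
      congr 1
      simp only [psi₁, psi₂, ha, laguerreFun₀]
      have : 0 < √(2 * p.1.2) := by positivity
      rw [← mul_assoc, one_div, inv_mul_cancel₀ this.ne', one_mul]
      congr 1
      field_simp
    rw [hw, Finset.mul_sum]
    refine Finset.sum_congr rfl fun k _ => ?_
    simp only [basisFun]
    have : ((p.1.1, (psi₁ (psi₂ p)).1.2) : ℝ × ℝ) = p.1 := rfl
    rw [this]
    ring
  · have hq : (psi₁ (psi₂ p)).1 ∉ halfPlane := hp
    simp [flatTransform, hp, hq]

lemma memLp_flatTransform (n : ℕ) (g : L2n n) : MemLp (flatTransform n g) 2 flatMeasure := by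
  refine memLp_of_comp_psi (measurable_flatTransform n g) ?_
  simp_rw [flatTransform_comp_psi]
  exact (memLp_congr_ae (opR₀_coeFn n g)).1 (Lp.memLp _)

lemma opV₂_opV₁_flatTransform (n : ℕ) (g : L2n n) :
    opV₂ (opV₁ ((memLp_flatTransform n g).toLp _)) = opR₀ n g := by
  refine Lp.ext ?_
  filter_upwards [opV₂_opV₁_coeFn ((memLp_flatTransform n g).toLp _), opR₀_coeFn n g,
    ae_comp_psi₂ (ae_comp_psi₁ (memLp_flatTransform n g).coeFn_toLp)] with p h1 h2 h3
  rw [h1, h2, h3, flatTransform_comp_psi]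

/-- On a slice `Im w = v`, the density of the inverse transform is that of the inverse Fourier
integral, after the substitution `t₁ = 2√t₂ x + 2 t₂ v₁`. -/
lemma flatTransform_shiftMap (n : ℕ) (g : L2n n) (v u : ℝ × ℝ) {z : ℝ × ℝ} (hz : z ∈ halfPlane) :
    ((2 * √z.2 : ℝ) : ℂ) * (flatTransform n g (shiftMap v.1 z, v) *
        Complex.exp (Complex.I * ((shiftMap v.1 z).1 * u.1 + (shiftMap v.1 z).2 * u.2))) =
      (2 * π : ℂ) * ∑ l ∈ Finset.range n, ((kappa (u, v)).1.im : ℂ) ^ l *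
        (coeffDensity n g l z * bargmannKernel (kappa (u, v)) z) := by
  have h0 : 0 < z.2 := hz
  have hs : 0 < √z.2 := Real.sqrt_pos.2 h0
  have hss : √z.2 * √z.2 = z.2 := Real.mul_self_sqrt h0.le
  have hq : shiftMap v.1 z ∈ halfPlane := hz
  have hx : (shiftMap v.1 z).1 / (2 * √(shiftMap v.1 z).2) - √(shiftMap v.1 z).2 * v.1 = z.1 := by
    simp only [shiftMap]
    field_simp
    linear_combination (-v.1) * hss
  simp only [flatTransform, Set.indicator_of_mem hq, hx]
  simp only [shiftMap]
  have hE : bargmannKernel (kappa (u, v)) z = ((Real.exp (-z.2 * v.2) *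
      Real.exp (-(z.1 + 2 * √z.2 * v.1) ^ 2 / 2) : ℝ) : ℂ) *
      Complex.exp (Complex.I * (((2 * √z.2 * z.1 + 2 * z.2 * v.1 : ℝ) : ℂ) * u.1 + z.2 * u.2)) := by
    rw [bargmannKernel, ← Real.exp_add, Complex.ofReal_exp, ← Complex.exp_add]
    congr 1
    have h1 : ((‖(⟨u.1, v.1⟩ : ℂ)‖ : ℝ) : ℂ) ^ 2 = (u.1 : ℂ) ^ 2 + (v.1 : ℂ) ^ 2 := by
      rw [← Complex.ofReal_pow, ← Complex.normSq_eq_norm_sq, Complex.normSq_apply]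
      push_cast; ring
    have hss' : ((√z.2 : ℝ) : ℂ) ^ 2 = z.2 := by
      rw [pow_two, ← Complex.ofReal_mul, hss]
    simp only [kappa, h1]
    have e1 : (⟨u.1, v.1⟩ : ℂ) = u.1 + v.1 * Complex.I := Complex.mk_eq_add_mul_I _ _
    have e2 : (⟨u.2, v.2⟩ : ℂ) = u.2 + v.2 * Complex.I := Complex.mk_eq_add_mul_I _ _
    rw [e1, e2]
    push_cast
    linear_combination ((z.2 : ℂ) * v.2 + z.2 * (u.1 ^ 2 + v.1 ^ 2) + z.2 * v.1 ^ 2 +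
      2 * (√z.2 : ℝ) * z.1 * v.1) * Complex.I_sq + (2 * (v.1 : ℂ) ^ 2) * hss'
  have hsum : ∀ k : Fin n, (hermiteFun k (z.1 + 2 * √z.2 * v.1) : ℂ) =
      (∑ l ∈ Finset.range n, ((2 * √z.2 * v.1 : ℝ) : ℂ) ^ l *
        (((hasseDeriv l (hermitePart k)).eval z.1 : ℝ) : ℂ)) *
        (Real.exp (-(z.1 + 2 * √z.2 * v.1) ^ 2 / 2) : ℂ) := by
    intro k
    rw [hermiteFun_eq_hermitePart, eval_add_hermitePart k]
    push_cast
    rfl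
  have hk : (kappa (u, v)).1.im = v.1 := rfl
  have hsq : √(2 * z.2) = √2 * √z.2 := Real.sqrt_mul (by norm_num) _
  have hss' : ((√z.2 : ℝ) : ℂ) * (√z.2 : ℝ) = z.2 := by
    rw [← Complex.ofReal_mul, hss]
  rw [hk, hE]
  simp only [hsum, coeffDensity, Finset.mul_sum, Finset.sum_mul]
  rw [Finset.sum_comm]
  refine Finset.sum_congr rfl fun l _ => Finset.sum_congr rfl fun k _ => ?_
  have hpi : (π : ℂ) ≠ 0 := by exact_mod_cast Real.pi_ne_zero
  rw [hsq]
  push_cast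
  rw [← hss']
  field_simp
  ring

lemma integrable_flatTransform (n : ℕ) (g : L2n n) {v : ℝ × ℝ} (hv : v ∈ halfPlane) (u : ℝ × ℝ) :
    Integrable (fun t : ℝ × ℝ => flatTransform n g (t, v) *
        Complex.exp (Complex.I * (t.1 * u.1 + t.2 * u.2))) ∧
      inverseTransform n g (kappa (u, v)) = (2 * π : ℂ)⁻¹ *
        ∫ t : ℝ × ℝ, flatTransform n g (t, v) *
          Complex.exp (Complex.I * (t.1 * u.1 + t.2 * u.2)) := by
  have hκ : kappa (u, v) ∈ siegelDomain := by
    have h0 : 0 < v.2 := hv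
    simpa [kappa, siegelDomain, ← Complex.ofReal_pow] using h0
  set F : ℝ × ℝ → ℂ := fun t => flatTransform n g (t, v) *
        Complex.exp (Complex.I * (t.1 * u.1 + t.2 * u.2)) with hFdef
  have hF : Measurable F :=
    ((measurable_flatTransform n g).comp measurable_prodMk_right).mul (by fun_prop)
  have hFH : halfPlane.indicator F = F := by
    ext t
    by_cases h : t ∈ halfPlane <;> simp [F, h, flatTransform]
  have hkey : (fun z => ((2 * √z.2 : ℝ) : ℂ) * F (shiftMap v.1 z)) =ᵐ[halfPlaneMeasure]
      fun z => (2 * π : ℂ) * ∑ l ∈ Finset.range n, ((kappa (u, v)).1.im : ℂ) ^ l *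
        (coeffDensity n g l z * bargmannKernel (kappa (u, v)) z) := by
    filter_upwards [ae_restrict_mem measurableSet_halfPlane] with z hz
    exact flatTransform_shiftMap n g v u hz
  have hi : ∀ l ∈ Finset.range n, Integrable (fun z => ((kappa (u, v)).1.im : ℂ) ^ l *
        (coeffDensity n g l z * bargmannKernel (kappa (u, v)) z)) halfPlaneMeasure := fun l _ =>
    ((isTame_coeffDensity n g l).integrable_mul_kernel hκ).const_mul _
  have hiF : Integrable F halfPlaneMeasure := by
    rw [← integrable_comp_shiftMap (v := v.1) hF]
    exact ((integrable_finsetSum _ hi).const_mul _).congr hkey.symm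
  constructor
  · rw [← hFH]
    exact (integrable_indicator_iff measurableSet_halfPlane).2 hiF
  · rw [← hFH, integral_indicator measurableSet_halfPlane, ← integral_comp_shiftMap (v := v.1) hF,
      integral_congr_ae hkey, integral_const_mul, integral_finsetSum _ hi]
    simp_rw [integral_const_mul]
    rw [← mul_assoc, inv_mul_cancel₀ (by simp [Real.pi_ne_zero]), one_mul]
    rfl

/-- Every element of the range of `R₀` is the transform of a function in the poly-Bergman space. -/
lemma exists_polyBergman_opU_eq (n : ℕ) (g : L2n n) :
    ∃ f ∈ polyBergman n 1, opU f = opR₀ n g := by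
  have hpa := isPolyAnalytic_inverseTransform n g
  have hm : AEStronglyMeasurable (inverseTransform n g) siegelMeasure :=
    hpa.smooth.continuousOn.aestronglyMeasurable measurableSet_siegelDomain
  obtain ⟨h, hU⟩ := opU₁_opU₀_eq hm (measurable_flatTransform n g) (memLp_flatTransform n g)
    (fun v hv => by simpa using (integrable_flatTransform n g hv 0).1)
    (fun v hv u => (integrable_flatTransform n g hv u).2)
  refine ⟨h.toLp _, ⟨_, hpa, h.coeFn_toLp⟩, ?_⟩
  simp only [opU, ContinuousLinearMap.comp_apply]
  rw [hU, opV₂_opV₁_flatTransform]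

end Surjectivity

/-! ### Expansion of `(n, 1)`-analytic functions -/

section PolyanalyticExpansion
open scoped ContDiff

lemma fderiv_fderiv_apply {f : ℂ × ℂ → ℂ} (hf : ContDiffOn ℝ ∞ f siegelDomain) {ζ : ℂ × ℂ}
    (hζ : ζ ∈ siegelDomain) (v w : ℂ × ℂ) :
    fderiv ℝ (fun ξ => fderiv ℝ f ξ v) ζ w = fderiv ℝ (fderiv ℝ f) ζ w v := by
  have hd : DifferentiableAt ℝ (fderiv ℝ f) ζ :=
    ((hf.fderiv_of_isOpen isOpen_siegelDomain (m := ∞) (by simp)).contDiffAt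
      (isOpen_siegelDomain.mem_nhds hζ)).differentiableAt (by simp)
  rw [fderiv_clm_apply hd (differentiableAt_const v)]
  simp

lemma fderiv_fderiv_comm {f : ℂ × ℂ → ℂ} (hf : ContDiffOn ℝ ∞ f siegelDomain) {ζ : ℂ × ℂ}
    (hζ : ζ ∈ siegelDomain) (v w : ℂ × ℂ) :
    fderiv ℝ (fun ξ => fderiv ℝ f ξ v) ζ w = fderiv ℝ (fun ξ => fderiv ℝ f ξ w) ζ v := by
  rw [fderiv_fderiv_apply hf hζ, fderiv_fderiv_apply hf hζ]
  have hc : ContDiffAt ℝ ∞ f ζ := hf.contDiffAt (isOpen_siegelDomain.mem_nhds hζ)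
  exact (hc.isSymmSndFDerivAt (by simpa using WithTop.coe_le_coe.2 (le_top : (2 : ℕ∞) ≤ ⊤))) w v

lemma fderiv_combination {f : ℂ × ℂ → ℂ} (hf : ContDiffOn ℝ ∞ f siegelDomain) {ζ : ℂ × ℂ}
    (hζ : ζ ∈ siegelDomain) (v v' w : ℂ × ℂ) :
    fderiv ℝ (fun ξ => (fderiv ℝ f ξ v + Complex.I * fderiv ℝ f ξ v') / 2) ζ w =
      (fderiv ℝ (fun ξ => fderiv ℝ f ξ v) ζ w +
        Complex.I * fderiv ℝ (fun ξ => fderiv ℝ f ξ v') ζ w) / 2 := by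
  have h : ∀ v, DifferentiableAt ℝ (fun ξ => fderiv ℝ f ξ v) ζ := fun v =>
    ((contDiffOn_fderiv_apply hf v).contDiffAt
      (isOpen_siegelDomain.mem_nhds hζ)).differentiableAt (by simp)
  have h1 := ((h v).hasFDerivAt.add ((h v').hasFDerivAt.const_mul Complex.I)).mul_const (2⁻¹ : ℂ)
  have h2 : (fun ξ => (fderiv ℝ f ξ v + Complex.I * fderiv ℝ f ξ v') / 2) =
      fun ξ => ((fun ξ => fderiv ℝ f ξ v) + fun ξ => Complex.I * fderiv ℝ f ξ v') ξ * 2⁻¹ := by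
    ext ξ
    rw [div_eq_mul_inv, Pi.add_apply]
  rw [h2, h1.fderiv]
  simp
  ring

/-- The two Cauchy–Riemann operators commute, by symmetry of the second derivative. -/
lemma dbar₂_dbar₁ {f : ℂ × ℂ → ℂ} (hf : ContDiffOn ℝ ∞ f siegelDomain) {ζ : ℂ × ℂ}
    (hζ : ζ ∈ siegelDomain) : dbar₂ (dbar₁ f) ζ = dbar₁ (dbar₂ f) ζ := by
  simp only [dbar₁, dbar₂]
  unfold dbar₁ dbar₂
  rw [fderiv_combination hf hζ, fderiv_combination hf hζ, fderiv_combination hf hζ,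
    fderiv_combination hf hζ, fderiv_fderiv_comm hf hζ (1, 0) (0, 1),
    fderiv_fderiv_comm hf hζ (1, 0) (0, Complex.I),
    fderiv_fderiv_comm hf hζ (Complex.I, 0) (0, 1),
    fderiv_fderiv_comm hf hζ (Complex.I, 0) (0, Complex.I)]
  ring

/-- The Cauchy–Riemann equations in both variables. -/
lemma differentiableOn_of_dbar_eq_zero {f : ℂ × ℂ → ℂ} (hf : ContDiffOn ℝ ∞ f siegelDomain)
    (h1 : ∀ ζ ∈ siegelDomain, dbar₁ f ζ = 0) (h2 : ∀ ζ ∈ siegelDomain, dbar₂ f ζ = 0) :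
    DifferentiableOn ℂ f siegelDomain := by
  intro ζ hζ
  have hd : DifferentiableAt ℝ f ζ :=
    (hf.contDiffAt (isOpen_siegelDomain.mem_nhds hζ)).differentiableAt (by simp)
  set L := fderiv ℝ f ζ with hL
  have e1 : L (Complex.I, 0) = Complex.I * L (1, 0) := by
    have := h1 ζ hζ
    rw [dbar₁, ← hL] at this
    linear_combination (-2 * Complex.I) * this + L (Complex.I, 0) * Complex.I_mul_I
  have e2 : L (0, Complex.I) = Complex.I * L (0, 1) := by
    have := h2 ζ hζ
    rw [dbar₂, ← hL] at this
    linear_combination (-2 * Complex.I) * this + L (0, Complex.I) * Complex.I_mul_I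
  let L' : ℂ × ℂ →L[ℂ] ℂ := L (1, 0) • ContinuousLinearMap.fst ℂ ℂ ℂ +
    L (0, 1) • ContinuousLinearMap.snd ℂ ℂ ℂ
  have hLL : L'.restrictScalars ℝ = L := by
    refine ContinuousLinearMap.ext fun z => ?_
    obtain ⟨z, w⟩ := z
    have hz : (z, w) = z.re • ((1, 0) : ℂ × ℂ) + z.im • (Complex.I, 0) + w.re • (0, 1) +
        w.im • (0, Complex.I) := by
      ext <;> simp
    rw [hz]
    simp only [map_add, map_smul, e1, e2]
    simp [L']
    ring
  exact (hasFDerivAt_of_restrictScalars ℝ hd.hasFDerivAt hLL).differentiableAt.differentiableWithinAt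

/-- Applied `n` times, the tangential operator isolates the top coefficient. -/
lemma HasImExpansion.iterate_tangentialDbar_top {n : ℕ} {f : ℂ × ℂ → ℂ} {a : ℕ → ℂ × ℂ → ℂ}
    (h : HasImExpansion (n + 1) f a) {ζ : ℂ × ℂ} (hζ : ζ ∈ siegelDomain) :
    (SiegelToeplitz.tangentialDbar^[n]) f ζ = n.factorial * (Complex.I / 2) ^ n * a n ζ := by
  induction n generalizing f a with
  | zero => simpa using h.eq ζ hζ
  | succ n ih =>
    rw [Function.iterate_succ_apply, ih h.tangentialDbar, Nat.factorial_succ]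
    push_cast
    ring

lemma tangentialDbar_eq_dbar₁ {f : ℂ × ℂ → ℂ} (h : ∀ ζ ∈ siegelDomain, dbar₂ f ζ = 0) :
    Set.EqOn (tangentialDbar f) (dbar₁ f) siegelDomain := fun ζ hζ => by
  rw [tangentialDbar, h ζ hζ]
  ring

lemma dbar₂_tangentialDbar {f : ℂ × ℂ → ℂ} (hf : ContDiffOn ℝ ∞ f siegelDomain)
    (h : ∀ ζ ∈ siegelDomain, dbar₂ f ζ = 0) :
    ∀ ζ ∈ siegelDomain, dbar₂ (tangentialDbar f) ζ = 0 := by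
  intro ζ hζ
  rw [isLocalLinear_dbar₂.congr _ _ (tangentialDbar_eq_dbar₁ h) hζ, dbar₂_dbar₁ hf hζ,
    isLocalLinear_dbar₁.congr (dbar₂ f) 0 h hζ]
  simp [dbar₁]

lemma iterate_tangentialDbar_smooth {f : ℂ × ℂ → ℂ} (hf : ContDiffOn ℝ ∞ f siegelDomain)
    (h : ∀ ζ ∈ siegelDomain, dbar₂ f ζ = 0) (n : ℕ) :
    ContDiffOn ℝ ∞ (tangentialDbar^[n] f) siegelDomain ∧
      ∀ ζ ∈ siegelDomain, dbar₂ (tangentialDbar^[n] f) ζ = 0 := by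
  induction n with
  | zero => exact ⟨hf, h⟩
  | succ n ih =>
    rw [Function.iterate_succ_apply']
    exact ⟨isLocalLinear_tangentialDbar.smooth _ ih.1, dbar₂_tangentialDbar ih.1 ih.2⟩

/-- Induction on `n`: the `n`-th iterate of the tangential operator is holomorphic and determines the
top coefficient, whose term is subtracted. -/
lemma exists_hasImExpansion_aux (n : ℕ) : ∀ f : ℂ × ℂ → ℂ, ContDiffOn ℝ ∞ f siegelDomain →
    (∀ ζ ∈ siegelDomain, dbar₂ f ζ = 0) →
    (∀ ζ ∈ siegelDomain, (tangentialDbar^[n]) f ζ = 0) → ∃ a, HasImExpansion n f a := by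
  induction n with
  | zero => exact fun f _ _ h => ⟨fun _ _ => 0, fun _ => differentiableOn_const _,
      fun ζ hζ => by simpa using h ζ hζ⟩
  | succ n ih =>
    intro f hf h2 h1
    set h := tangentialDbar^[n] f with hh
    obtain ⟨hs, hd2⟩ := iterate_tangentialDbar_smooth hf h2 n
    rw [← hh] at hs hd2
    have hd1 : ∀ ζ ∈ siegelDomain, dbar₁ h ζ = 0 := by
      intro ζ hζ
      have := h1 ζ hζ
      rw [Function.iterate_succ_apply', ← hh] at this
      rw [← tangentialDbar_eq_dbar₁ hd2 hζ, this]
    have hhol := differentiableOn_of_dbar_eq_zero hs hd1 hd2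
    -- the top coefficient: applying the operator `n` times to `(Im ζ₁)ⁿ b` gives `n! (i/2)ⁿ b`
    let b : ℂ × ℂ → ℂ := fun ζ => (n.factorial * (Complex.I / 2) ^ n)⁻¹ * h ζ
    have hb : DifferentiableOn ℂ b siegelDomain := hhol.const_mul _
    have hbs : ContDiffOn ℝ ∞ b siegelDomain := contDiffOn_const.mul hs
    let p : ℂ × ℂ → ℂ := fun ζ => (ζ.1.im : ℂ) ^ n * b ζ
    have hp : HasImExpansion (n + 1) p (fun l ζ => if l = n then b ζ else 0) := by
      refine ⟨fun l => ?_, fun ζ _ => ?_⟩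
      · by_cases hl : l = n
        · simpa [hl] using hb
        · simp [hl]
      · simp [p]
    have hps : ContDiffOn ℝ ∞ p siegelDomain := by
      have : ContDiff ℝ ∞ fun ζ : ℂ × ℂ => (ζ.1.im : ℂ) :=
        (Complex.ofRealCLM ∘L Complex.imCLM ∘L ContinuousLinearMap.fst ℝ ℂ ℂ).contDiff
      exact (this.pow n).contDiffOn.mul hbs
    have hne : (n.factorial * (Complex.I / 2) ^ n : ℂ) ≠ 0 :=
      mul_ne_zero (by exact_mod_cast n.factorial_ne_zero) (pow_ne_zero _ (by simp))
    let f' : ℂ × ℂ → ℂ := fun ζ => (-1) * p ζ + f ζ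
    obtain ⟨a, ha⟩ := ih f' ((contDiffOn_const.mul hps).add hf)
      (fun ζ hζ => by
        rw [isLocalLinear_dbar₂.comb p f (-1) hps hf hζ]
        simp only
        rw [hp.dbar₂_eq hζ, h2 ζ hζ]
        simp)
      (fun ζ hζ => by
        rw [isLocalLinear_tangentialDbar.iterate_comb n p f (-1) hps hf hζ]
        simp only
        rw [hp.iterate_tangentialDbar_top hζ]
        simp only [if_true, b, ← hh]
        rw [mul_inv_cancel_left₀ hne]
        ring)
    refine ⟨Function.update a n b, fun l => ?_, fun ζ hζ => ?_⟩
    · by_cases hl : l = n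
      · subst hl; simpa using hb
      · simpa [hl] using ha.holo l
    · have e := ha.eq ζ hζ
      rw [Finset.sum_range_succ, Function.update_self]
      have : ∑ l ∈ Finset.range n, (ζ.1.im : ℂ) ^ l * Function.update a n b l ζ =
          ∑ l ∈ Finset.range n, (ζ.1.im : ℂ) ^ l * a l ζ := by
        refine Finset.sum_congr rfl fun l hl => ?_
        rw [Function.update_of_ne (Finset.mem_range.1 hl).ne]
      rw [this, ← e]
      simp only [f', p]
      ring

/-- An `(n, 1)`-analytic function is a polynomial of degree `< n` in `Im ζ₁` with holomorphic
coefficients: once `∂f/∂ζ̄₂ = 0`, the tangential operator acts as `∂/∂ζ̄₁`. -/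
lemma IsPolyAnalytic.exists_hasImExpansion {n : ℕ} {f : ℂ × ℂ → ℂ} (hf : IsPolyAnalytic n 1 f) :
    ∃ a, HasImExpansion n f a :=
  exists_hasImExpansion_aux n f hf.smooth hf.transversal hf.tangential

end PolyanalyticExpansion

/-! ### Mean value inequality for the top coefficient -/

section GrowthBounds
open Metric

lemma HasImExpansion.continuousOn {n : ℕ} {f : ℂ × ℂ → ℂ} {a : ℕ → ℂ × ℂ → ℂ}
    (h : HasImExpansion n f a) : ContinuousOn f siegelDomain := by
  refine ContinuousOn.congr (f := fun ζ => ∑ l ∈ Finset.range n, (ζ.1.im : ℂ) ^ l * a l ζ) ?_ h.eq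
  refine continuousOn_finsetSum _ fun l _ => ContinuousOn.mul ?_ (h.holo l).continuousOn
  exact ((Complex.continuous_ofReal.comp (Complex.continuous_im.comp continuous_fst)).pow
    l).continuousOn

lemma HasImExpansion.mul_left {n : ℕ} {f φ : ℂ × ℂ → ℂ} {a : ℕ → ℂ × ℂ → ℂ}
    (h : HasImExpansion n f a) (hφ : DifferentiableOn ℂ φ siegelDomain) :
    HasImExpansion n (fun ζ => φ ζ * f ζ) (fun l ζ => φ ζ * a l ζ) where
  holo l := hφ.mul (h.holo l)
  eq ζ hζ := by
    rw [h.eq ζ hζ, Finset.mul_sum]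
    exact Finset.sum_congr rfl fun l _ => by ring

/-- The translation `(ζ₁, ζ₂) ↦ (ζ₁, ζ₂ + iε)`, which maps `D₂` into itself for `ε ≥ 0`. -/
def liftPoint (ε : ℝ) (ζ : ℂ × ℂ) : ℂ × ℂ := (ζ.1, ζ.2 + ε * Complex.I)

lemma liftPoint_mem {ε : ℝ} (hε : 0 ≤ ε) {ζ : ℂ × ℂ} (hζ : ζ ∈ siegelDomain) :
    liftPoint ε ζ ∈ siegelDomain := by
  simp only [siegelDomain, liftPoint, Set.mem_ofPred_eq] at *
  simp
  linarith

lemma measurePreserving_liftPoint (ε : ℝ) : MeasurePreserving (liftPoint ε) := by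
  exact (MeasurePreserving.id (volume : Measure ℂ)).prod
    (measurePreserving_add_right (volume : Measure ℂ) (ε * Complex.I))

lemma HasImExpansion.comp_liftPoint {n : ℕ} {f : ℂ × ℂ → ℂ} {a : ℕ → ℂ × ℂ → ℂ}
    (h : HasImExpansion n f a) {ε : ℝ} (hε : 0 ≤ ε) :
    HasImExpansion n (fun ζ => f (liftPoint ε ζ)) (fun l ζ => a l (liftPoint ε ζ)) where
  holo l := (h.holo l).comp (by unfold liftPoint; fun_prop) fun _ hζ => liftPoint_mem hε hζ
  eq ζ hζ := h.eq _ (liftPoint_mem hε hζ)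

lemma siegelDomain_im_pos {ζ : ℂ × ℂ} (hζ : ζ ∈ siegelDomain) : ‖ζ.1‖ ^ 2 < ζ.2.im := by
  have : 0 < ζ.2.im - ‖ζ.1‖ ^ 2 := hζ
  linarith

lemma im_add_one_le_norm (ζ : ℂ × ℂ) : ζ.2.im + 1 ≤ ‖ζ.2 + Complex.I‖ := by
  have := Complex.im_le_norm (ζ.2 + Complex.I)
  simpa using this

lemma one_add_sq_lt_norm {ζ : ℂ × ℂ} (hζ : ζ ∈ siegelDomain) :
    1 + ‖ζ.1‖ ^ 2 < ‖ζ.2 + Complex.I‖ := by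
  linarith [siegelDomain_im_pos hζ, im_add_one_le_norm ζ]

lemma one_le_norm_add_I {ζ : ℂ × ℂ} (hζ : ζ ∈ siegelDomain) : 1 ≤ ‖ζ.2 + Complex.I‖ := by
  nlinarith [one_add_sq_lt_norm hζ, sq_nonneg ‖ζ.1‖]

lemma add_I_ne_zero {ζ : ℂ × ℂ} (hζ : ζ ∈ siegelDomain) : ζ.2 + Complex.I ≠ 0 :=
  norm_pos_iff.1 (one_pos.trans_le (one_le_norm_add_I hζ))

lemma norm_liftPoint_le {ε : ℝ} (hε : 0 ≤ ε) (hε1 : ε ≤ 1) {ζ : ℂ × ℂ} (hζ : ζ ∈ siegelDomain) :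
    ‖(liftPoint ε ζ).2 + Complex.I‖ ≤ 2 * ‖ζ.2 + Complex.I‖ := by
  have h : (liftPoint ε ζ).2 + Complex.I = (ζ.2 + Complex.I) + ε * Complex.I := by
    simp only [liftPoint]; ring
  rw [h]
  refine (norm_add_le _ _).trans ?_
  have := one_le_norm_add_I hζ
  simp [abs_of_nonneg hε]
  linarith

lemma differentiableOn_inv_pow (M : ℕ) :
    DifferentiableOn ℂ (fun ζ : ℂ × ℂ => ((ζ.2 + Complex.I) ^ M)⁻¹) siegelDomain :=
  DifferentiableOn.inv (by fun_prop) fun _ hζ => pow_ne_zero _ (add_I_ne_zero hζ)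

/-- On the circle `|z - z₀| = ρ` the function `(z - z₀) Im z` is a holomorphic polynomial, so
the circle average of `(z - z₀)ⁿ F` isolates the top coefficient of a polyanalytic `F`. -/
lemma norm_circleAverage_eq_topCoeff {n : ℕ} {F : ℂ → ℂ} {b : ℕ → ℂ → ℂ} {z₀ : ℂ} {r ρ : ℝ}
    (hρ : 0 < ρ) (hρr : ρ < r) (hb : ∀ l, DifferentiableOn ℂ (b l) (ball z₀ r))
    (hF : ∀ z ∈ ball z₀ r, F z = ∑ l ∈ Finset.range (n + 1), (z.im : ℂ) ^ l * b l z) :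
    ‖Real.circleAverage (fun z => (z - z₀) ^ n * F z) z₀ ρ‖ = (ρ ^ 2 / 2) ^ n * ‖b n z₀‖ := by
  let p : ℂ → ℂ := fun z =>
    ((z - z₀) * (z - (starRingEnd ℂ) z₀) - (ρ : ℂ) ^ 2) / (2 * Complex.I)
  let G : ℂ → ℂ := fun z => ∑ l ∈ Finset.range (n + 1), (z - z₀) ^ (n - l) * (p z ^ l * b l z)
  have hsub : closedBall z₀ ρ ⊆ ball z₀ r := closedBall_subset_ball hρr
  have hpd : Differentiable ℂ p := by
    intro z; fun_prop
  have hG : DifferentiableOn ℂ G (ball z₀ r) := by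
    refine DifferentiableOn.fun_sum fun l _ => ?_
    exact (((differentiable_id.sub_const z₀).pow _).differentiableOn).mul
      (((hpd.pow l).differentiableOn).mul (hb l))
  have h1 : Real.circleAverage (fun z => (z - z₀) ^ n * F z) z₀ ρ = Real.circleAverage G z₀ ρ := by
    refine Real.circleAverage_congr_sphere fun z hz => ?_
    rw [abs_of_pos hρ] at hz
    have hzb : z ∈ ball z₀ r := hsub (sphere_subset_closedBall hz)
    have hp : p z = (z - z₀) * (z.im : ℂ) := by
      have hn : (z - z₀) * (starRingEnd ℂ) (z - z₀) = (ρ : ℂ) ^ 2 := by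
        rw [Complex.mul_conj, Complex.normSq_eq_norm_sq, ← dist_eq_norm, mem_sphere.1 hz]
        push_cast; ring
      have him : (z.im : ℂ) = (z - (starRingEnd ℂ) z) / (2 * Complex.I) := Complex.im_eq_sub_conj z
      rw [map_sub] at hn
      simp only [p]
      rw [him, ← hn]
      ring
    simp only [G]
    rw [hF z hzb, Finset.mul_sum]
    refine Finset.sum_congr rfl fun l hl => ?_
    have hln : l ≤ n := Nat.lt_succ_iff.1 (Finset.mem_range.1 hl)
    rw [hp, mul_pow, ← Nat.sub_add_cancel hln, pow_add, Nat.add_sub_cancel]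
    ring
  have h2 : Real.circleAverage G z₀ ρ = G z₀ := by
    refine DiffContOnCl.circleAverage ?_
    rw [abs_of_pos hρ]
    exact (hG.mono hsub).diffContOnCl_ball subset_rfl
  have h3 : G z₀ = p z₀ ^ n * b n z₀ := by
    simp only [G]
    rw [Finset.sum_range_succ, Finset.sum_eq_zero fun l hl => ?_]
    · simp
    · have : n - l ≠ 0 := Nat.sub_ne_zero_of_lt (Finset.mem_range.1 hl)
      simp [this]
  have h4 : ‖p z₀‖ = ρ ^ 2 / 2 := by
    simp [p]
  rw [h1, h2, h3, norm_mul, norm_pow, h4]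

/-- The top coefficient of a polyanalytic function is controlled by its local `L¹` norm. -/
lemma topCoeff_le_lintegral_ball {n : ℕ} {F : ℂ → ℂ} {b : ℕ → ℂ → ℂ} {z₀ : ℂ} {r : ℝ}
    (hr : 0 < r) (hb : ∀ l, DifferentiableOn ℂ (b l) (ball z₀ r))
    (hF : ∀ z ∈ ball z₀ r, F z = ∑ l ∈ Finset.range (n + 1), (z.im : ℂ) ^ l * b l z) :
    ENNReal.ofReal ((r / 2) ^ (n + 2) * (2 * π / 2 ^ n)) * ‖b n z₀‖ₑ ≤
      ∫⁻ z in ball z₀ r, ‖F z‖ₑ := by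
  have hFc : ContinuousOn F (ball z₀ r) := by
    refine ContinuousOn.congr (f := fun z => ∑ l ∈ Finset.range (n + 1), (z.im : ℂ) ^ l * b l z)
      ?_ hF
    refine continuousOn_finsetSum _ fun l _ => ContinuousOn.mul ?_ (hb l).continuousOn
    exact ((Complex.continuous_ofReal.comp Complex.continuous_im).pow l).continuousOn
  classical
  let G : ℂ → ℝ≥0∞ := (ball z₀ r).indicator fun z => ‖F z‖ₑ
  have hG : Measurable G := by
    have := ContinuousOn.measurable_piecewise (s := ball z₀ r) (f := fun z => ‖F z‖ₑ)
      (g := 0) hFc.enorm continuousOn_const measurableSet_ball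
    rwa [Set.piecewise_eq_indicator] at this
  -- the contribution of the circle of radius `ρ`
  have hcircle : ∀ ρ ∈ Set.Ioo (r / 2) r,
      ENNReal.ofReal ((r / 2) ^ (n + 1) * (2 * π / 2 ^ n)) * ‖b n z₀‖ₑ ≤
        ∫⁻ θ in Set.Ioo (-π) π, ENNReal.ofReal ρ * G (circleMap z₀ ρ θ) := by
    intro ρ hρ
    have hρ0 : 0 < ρ := (half_pos hr).trans hρ.1
    have h1 := norm_circleAverage_eq_topCoeff hρ0 hρ.2 hb hF
    rw [Real.circleAverage_eq_integral_add (-π),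
      intervalIntegral.integral_comp_add_right
        (fun θ => (circleMap z₀ ρ θ - z₀) ^ n * F (circleMap z₀ ρ θ)),
      intervalIntegral.integral_of_le (by linarith [Real.pi_pos]), integral_Ioc_eq_integral_Ioo,
      norm_smul, norm_inv, Real.norm_of_nonneg Real.two_pi_pos.le] at h1
    have e1 : (0 : ℝ) + -π = -π := by ring
    have e2 : 2 * π + -π = π := by ring
    rw [e1, e2] at h1
    have h2 := enorm_integral_le_lintegral_enorm (μ := volume.restrict (Set.Ioo (-π) π))
      (fun θ => (circleMap z₀ ρ θ - z₀) ^ n * F (circleMap z₀ ρ θ))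
    rw [← ofReal_norm] at h2
    have h3 : ‖∫ θ in Set.Ioo (-π) π, (circleMap z₀ ρ θ - z₀) ^ n * F (circleMap z₀ ρ θ)‖ =
        2 * π * ((ρ ^ 2 / 2) ^ n * ‖b n z₀‖) := by
      rw [← h1]
      field_simp
    rw [h3] at h2
    have h4 : ∀ θ, ‖(circleMap z₀ ρ θ - z₀) ^ n * F (circleMap z₀ ρ θ)‖ₑ =
        ENNReal.ofReal (ρ ^ n) * G (circleMap z₀ ρ θ) := by
      intro θ
      have hm : circleMap z₀ ρ θ ∈ ball z₀ r :=
        closedBall_subset_ball hρ.2 (circleMap_mem_closedBall z₀ hρ0.le θ)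
      simp only [G]
      rw [Set.indicator_of_mem hm, enorm_mul, ← ofReal_norm ((_ : ℂ) ^ n), norm_pow,
        circleMap_sub_center]
      simp [abs_of_pos hρ0]
    simp_rw [h4] at h2
    have hGc : Measurable fun θ => G (circleMap z₀ ρ θ) :=
      hG.comp (continuous_circleMap z₀ ρ).measurable
    rw [lintegral_const_mul _ hGc] at h2 ⊢
    have h5 : 2 * π * ((ρ ^ 2 / 2) ^ n * ‖b n z₀‖) =
        ρ ^ n * (ρ ^ n * (2 * π / 2 ^ n) * ‖b n z₀‖) := by
      rw [div_pow, ← pow_mul, mul_comm 2 n, pow_mul]; ring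
    rw [h5, ENNReal.ofReal_mul (by positivity)] at h2
    have h6 := (ENNReal.mul_le_mul_iff_right (a := ENNReal.ofReal (ρ ^ n))
      (by simpa using pow_pos hρ0 n) ENNReal.ofReal_ne_top).1 h2
    refine le_trans ?_ (mul_le_mul_right h6 (ENNReal.ofReal ρ))
    rw [← ENNReal.ofReal_mul hρ0.le, ← ofReal_norm, ← ENNReal.ofReal_mul (by positivity)]
    refine ENNReal.ofReal_le_ofReal ?_
    have h7 : (r / 2) ^ (n + 1) ≤ ρ ^ (n + 1) := pow_le_pow_left₀ (by positivity) hρ.1.le _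
    calc (r / 2) ^ (n + 1) * (2 * π / 2 ^ n) * ‖b n z₀‖
        ≤ ρ ^ (n + 1) * (2 * π / 2 ^ n) * ‖b n z₀‖ := by gcongr
      _ = _ := by ring
  have hpolar : ∫⁻ z in ball z₀ r, ‖F z‖ₑ =
      ∫⁻ ρ in Set.Ioi (0 : ℝ), ∫⁻ θ in Set.Ioo (-π) π,
        ENNReal.ofReal ρ * G (circleMap z₀ ρ θ) := by
    rw [← lintegral_indicator measurableSet_ball,
      ← lintegral_add_right_eq_self (fun z => (ball z₀ r).indicator (fun z => ‖F z‖ₑ) z) z₀,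
      ← Complex.lintegral_comp_polarCoord_symm, polarCoord_target, Measure.volume_eq_prod,
      ← Measure.prod_restrict]
    have hc : ∀ p : ℝ × ℝ, Complex.polarCoord.symm p + z₀ = circleMap z₀ p.1 p.2 := by
      intro p
      rw [Complex.polarCoord_symm_apply, circleMap, Complex.exp_mul_I]
      push_cast
      ring
    have hcm : Measurable fun p : ℝ × ℝ => circleMap z₀ p.1 p.2 := by
      unfold circleMap; fun_prop
    simp only [hc, smul_eq_mul]
    refine lintegral_prod _ (Measurable.aemeasurable ?_)
    exact (measurable_fst.ennreal_ofReal).mul (hG.comp hcm)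
  rw [hpolar]
  -- only the radii in `(r/2, r)` are kept, where `ρ ^ (n + 1) ≥ (r / 2) ^ (n + 1)`
  calc ENNReal.ofReal ((r / 2) ^ (n + 2) * (2 * π / 2 ^ n)) * ‖b n z₀‖ₑ
      = ∫⁻ _ in Set.Ioo (r / 2) r,
          ENNReal.ofReal ((r / 2) ^ (n + 1) * (2 * π / 2 ^ n)) * ‖b n z₀‖ₑ := by
        rw [setLIntegral_const, Real.volume_Ioo, mul_right_comm, ← ENNReal.ofReal_mul (by positivity)]
        congr 2
        ring
    _ ≤ ∫⁻ ρ in Set.Ioo (r / 2) r, ∫⁻ θ in Set.Ioo (-π) π,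
        ENNReal.ofReal ρ * G (circleMap z₀ ρ θ) := setLIntegral_mono' measurableSet_Ioo hcircle
    _ ≤ _ := lintegral_mono_set fun x hx => (half_pos hr).trans hx.1

/-- The mean value inequality on a bidisc contained in `D₂`: the one-variable inequality is applied to
`a_n(ζ₁, ·)`, which is holomorphic, and then to `f(·, w)` for each fixed `w`. -/
lemma topCoeff_le_lintegral_siegel {n : ℕ} {f : ℂ × ℂ → ℂ} {a : ℕ → ℂ × ℂ → ℂ}
    (h : HasImExpansion (n + 1) f a) {ζ : ℂ × ℂ} {r : ℝ} (hr : 0 < r)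
    (hsub : ball ζ.1 r ×ˢ ball ζ.2 r ⊆ siegelDomain) :
    ENNReal.ofReal ((r / 2) ^ (n + 2) * (2 * π / 2 ^ n)) *
      (ENNReal.ofReal ((r / 2) ^ 2 * (2 * π)) * ‖a n ζ‖ₑ) ≤ ∫⁻ z, ‖f z‖ₑ ∂siegelMeasure := by
  have h2 : ENNReal.ofReal ((r / 2) ^ 2 * (2 * π)) * ‖a n ζ‖ₑ ≤
      ∫⁻ w in ball ζ.2 r, ‖a n (ζ.1, w)‖ₑ := by
    have := topCoeff_le_lintegral_ball (n := 0) (F := fun w => a n (ζ.1, w))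
      (b := fun _ w => a n (ζ.1, w)) (z₀ := ζ.2) hr
      (fun _ => (h.holo n).comp (by fun_prop) fun w hw => hsub ⟨mem_ball_self hr, hw⟩)
      (fun w _ => by simp)
    simpa using this
  have h1 : ∀ w ∈ ball ζ.2 r, ENNReal.ofReal ((r / 2) ^ (n + 2) * (2 * π / 2 ^ n)) *
      ‖a n (ζ.1, w)‖ₑ ≤ ∫⁻ z in ball ζ.1 r, ‖f (z, w)‖ₑ := fun w hw =>
    topCoeff_le_lintegral_ball (n := n) (F := fun z => f (z, w)) (b := fun l z => a l (z, w))
      (z₀ := ζ.1) hr (fun l => (h.holo l).comp (by fun_prop) fun z hz => hsub ⟨hz, hw⟩)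
      (fun z hz => h.eq _ (hsub ⟨hz, hw⟩))
  calc _ ≤ _ := mul_le_mul_right h2 _
    _ = ∫⁻ w in ball ζ.2 r, ENNReal.ofReal ((r / 2) ^ (n + 2) * (2 * π / 2 ^ n)) *
      ‖a n (ζ.1, w)‖ₑ := (lintegral_const_mul' _ _ ENNReal.ofReal_ne_top).symm
    _ ≤ ∫⁻ w in ball ζ.2 r, ∫⁻ z in ball ζ.1 r, ‖f (z, w)‖ₑ :=
      setLIntegral_mono' measurableSet_ball h1
    _ = ∫⁻ z in ball ζ.1 r ×ˢ ball ζ.2 r, ‖f z‖ₑ := by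
      rw [Measure.volume_eq_prod, ← Measure.prod_restrict, lintegral_prod_symm]
      rw [Measure.prod_restrict, ← Measure.volume_eq_prod]
      exact (h.continuousOn.mono hsub).enorm.aemeasurable
        (measurableSet_ball.prod measurableSet_ball)
    _ ≤ _ := lintegral_mono_set hsub

end GrowthBounds

/-! ### Polynomial growth of the coefficients -/

section CoefficientGrowth
open Metric

/-- In the coordinates of `κ`, each of `1 + u₁²`, `1 + v₁²` is at most `|ζ₂ + i|`, and each of `1 + u₂²`,
`1 + v₂²` is at most `|ζ₂ + i|²`. -/
lemma integrable_norm_add_I_pow_neg :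
    Integrable (fun ζ : ℂ × ℂ => (‖ζ.2 + Complex.I‖ ^ 6)⁻¹) siegelMeasure := by
  have hm : Measurable fun ζ : ℂ × ℂ => (‖ζ.2 + Complex.I‖ ^ 6)⁻¹ := by fun_prop
  rw [← measurePreserving_kappa.integrable_comp hm.aestronglyMeasurable]
  have h1 := integrable_inv_one_add_sq
  have h2 : Integrable (fun u : ℝ × ℝ => (1 + u.1 ^ 2)⁻¹ * (1 + u.2 ^ 2)⁻¹) := h1.mul_prod h1
  have h3 : Integrable (fun p : (ℝ × ℝ) × (ℝ × ℝ) => ((1 + p.1.1 ^ 2)⁻¹ * (1 + p.1.2 ^ 2)⁻¹) *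
      ((1 + p.2.1 ^ 2)⁻¹ * (1 + p.2.2 ^ 2)⁻¹)) flatMeasure :=
    h2.mul_prod (h2.mono_measure Measure.restrict_le_self)
  refine h3.mono' (hm.comp measurable_kappa).aestronglyMeasurable ?_
  rw [flatMeasure_eq]
  filter_upwards [ae_restrict_mem (measurableSet_lt measurable_const (by fun_prop))] with p hp
  obtain ⟨⟨u₁, u₂⟩, v₁, v₂⟩ := p
  have hv : 0 < v₂ := hp
  simp only [Function.comp_def]
  rw [norm_inv, norm_pow, norm_norm, ← mul_inv, ← mul_inv, ← mul_inv]
  refine inv_anti₀ (by positivity) ?_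
  have hz : (kappa ((u₁, u₂), (v₁, v₂))).2 + Complex.I = ⟨u₂, v₂ + (u₁ ^ 2 + v₁ ^ 2) + 1⟩ := by
    have : ‖(⟨u₁, v₁⟩ : ℂ)‖ ^ 2 = u₁ ^ 2 + v₁ ^ 2 := by
      rw [← Complex.normSq_eq_norm_sq, Complex.normSq_mk]; ring
    simp only [kappa]
    rw [← Complex.ofReal_pow, this]
    apply Complex.ext <;> simp [-Complex.ofReal_pow]
  rw [hz]
  set J := ‖(⟨u₂, v₂ + (u₁ ^ 2 + v₁ ^ 2) + 1⟩ : ℂ)‖ with hJ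
  have hJ2 : J ^ 2 = u₂ ^ 2 + (v₂ + (u₁ ^ 2 + v₁ ^ 2) + 1) ^ 2 := by
    rw [hJ, ← Complex.normSq_eq_norm_sq, Complex.normSq_mk]; ring
  have h4 : 1 + u₁ ^ 2 ≤ J :=
    (abs_le_of_sq_le_sq' (by nlinarith [sq_nonneg v₁, sq_nonneg u₁, sq_nonneg u₂])
      (norm_nonneg _)).2
  have h5 : 1 + v₁ ^ 2 ≤ J :=
    (abs_le_of_sq_le_sq' (by nlinarith [sq_nonneg v₁, sq_nonneg u₁, sq_nonneg u₂])
      (norm_nonneg _)).2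
  have h6 : 1 + u₂ ^ 2 ≤ J ^ 2 := by nlinarith [sq_nonneg v₁, sq_nonneg u₁]
  have h7 : 1 + v₂ ^ 2 ≤ J ^ 2 := by nlinarith [sq_nonneg v₁, sq_nonneg u₁, sq_nonneg u₂]
  calc (1 + u₁ ^ 2) * (1 + u₂ ^ 2) * ((1 + v₁ ^ 2) * (1 + v₂ ^ 2))
      ≤ J * J ^ 2 * (J * J ^ 2) := by gcongr
    _ = J ^ 6 := by ring

/-- Away from the boundary of `D₂`, the top coefficient of a function that is integrable with
polynomial weight grows at most polynomially. -/
lemma exists_topCoeff_growth {n : ℕ} {f : ℂ × ℂ → ℂ} {a : ℕ → ℂ × ℂ → ℂ} {M : ℕ}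
    (h : HasImExpansion (n + 1) f a)
    (hf : Integrable (fun ζ => ((ζ.2 + Complex.I) ^ M)⁻¹ * f ζ) siegelMeasure)
    {ε : ℝ} (hε : 0 < ε) (hε1 : ε ≤ 1) :
    ∃ (C : ℝ) (N : ℕ), 0 ≤ C ∧ ∀ ζ ∈ siegelDomain,
      ‖a n (liftPoint ε ζ)‖ ≤ C * ‖ζ.2 + Complex.I‖ ^ N := by
  have h' := h.mul_left (differentiableOn_inv_pow M)
  set S := (∫⁻ z, ‖((z.2 + Complex.I) ^ M)⁻¹ * f z‖ₑ ∂siegelMeasure) with hS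
  have hSt : S ≠ ∞ := hf.2.ne
  refine ⟨S.toReal * (16 / ε) ^ (n + 4) * 2 ^ n / (4 * π ^ 2) * 2 ^ M, n + 4 + M, by positivity,
    fun ζ hζ => ?_⟩
  set J := ‖ζ.2 + Complex.I‖ with hJ
  have hJ1 : 1 ≤ J := one_le_norm_add_I hζ
  -- the bidisc of radius `r` around the lifted point stays in `D₂`, because `|ζ₁| ≤ J`
  set r := ε / (8 * J) with hr
  have hr0 : 0 < r := by positivity
  have hJr : J * r = ε / 8 := by rw [hr]; field_simp
  have hrε : r ≤ ε / 8 := by nlinarith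
  have hx : ‖ζ.1‖ ≤ J := by
    nlinarith [one_add_sq_lt_norm hζ, sq_nonneg (‖ζ.1‖ - 1), sq_nonneg ‖ζ.1‖]
  have hsub : ball (liftPoint ε ζ).1 r ×ˢ ball (liftPoint ε ζ).2 r ⊆ siegelDomain := by
    rintro ⟨w₁, w₂⟩ ⟨hw₁, hw₂⟩
    simp only [liftPoint, mem_ball, dist_eq_norm] at hw₁ hw₂
    have e1 : ‖w₁‖ ≤ ‖ζ.1‖ + r := by
      have := norm_add_le ζ.1 (w₁ - ζ.1)
      rw [add_sub_cancel] at this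
      linarith
    have e2 : ζ.2.im + ε - r ≤ w₂.im := by
      have := (abs_le.1 (Complex.abs_im_le_norm (w₂ - (ζ.2 + ε * Complex.I)))).1
      simp at this
      linarith
    have e3 := siegelDomain_im_pos hζ
    have e4 : ‖w₁‖ ^ 2 ≤ (‖ζ.1‖ + r) ^ 2 := pow_le_pow_left₀ (norm_nonneg _) e1 2
    have e5 : ‖ζ.1‖ * r ≤ ε / 8 := by rw [← hJr]; gcongr
    simp only [siegelDomain, Set.mem_ofPred_eq]
    nlinarith
  have key := topCoeff_le_lintegral_siegel h' hr0 hsub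
  rw [← hS, ← mul_assoc, ← ENNReal.ofReal_mul (by positivity), ← ofReal_norm,
    ← ENNReal.ofReal_mul (by positivity), ENNReal.ofReal_le_iff_le_toReal hSt, norm_mul, norm_inv,
    norm_pow] at key
  set J' := ‖(liftPoint ε ζ).2 + Complex.I‖ with hJ'
  have hJ'0 : 0 < J' := one_pos.trans_le (one_le_norm_add_I (liftPoint_mem hε.le hζ))
  have hJ'le : J' ≤ 2 * J := norm_liftPoint_le hε.le hε1 hζ
  have hc : (r / 2) ^ (n + 2) * (2 * π / 2 ^ n) * ((r / 2) ^ 2 * (2 * π)) *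
      ((16 / ε) ^ (n + 4) * 2 ^ n / (4 * π ^ 2) * J ^ (n + 4)) = 1 := by
    have : (r / 2) ^ (n + 2) * (2 * π / 2 ^ n) * ((r / 2) ^ 2 * (2 * π)) *
      ((16 / ε) ^ (n + 4) * 2 ^ n / (4 * π ^ 2) * J ^ (n + 4)) =
      (r / 2 * (16 / ε) * J) ^ (n + 4) := by
      rw [mul_pow, mul_pow]; field_simp; ring
    rw [this, hr]
    have : ε / (8 * J) / 2 * (16 / ε) * J = 1 := by field_simp; norm_num
    rw [this, one_pow]
  set c := (r / 2) ^ (n + 2) * (2 * π / 2 ^ n) * ((r / 2) ^ 2 * (2 * π)) with hcdef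
  set d := (16 / ε) ^ (n + 4) * 2 ^ n / (4 * π ^ 2) * J ^ (n + 4) with hd
  have hd0 : 0 ≤ d := by positivity
  calc ‖a n (liftPoint ε ζ)‖ = (c * ((J' ^ M)⁻¹ * ‖a n (liftPoint ε ζ)‖)) * d * J' ^ M := by
        rw [mul_right_comm c, hc, one_mul]
        field_simp
    _ ≤ S.toReal * d * (2 * J) ^ M := by gcongr
    _ = _ := by rw [hd, mul_pow]; ring

/-- Away from the boundary of `D₂`, all coefficients of a function that is integrable with
polynomial weight grow at most polynomially. -/
lemma exists_coeff_growth (n : ℕ) : ∀ (f : ℂ × ℂ → ℂ) (a : ℕ → ℂ × ℂ → ℂ) (M : ℕ),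
    HasImExpansion n f a →
    Integrable (fun ζ => ((ζ.2 + Complex.I) ^ M)⁻¹ * f ζ) siegelMeasure →
    ∀ ε : ℝ, 0 < ε → ε ≤ 1 → ∃ (C : ℝ) (N : ℕ), 0 ≤ C ∧ ∀ l < n, ∀ ζ ∈ siegelDomain,
      ‖a l (liftPoint ε ζ)‖ ≤ C * ‖ζ.2 + Complex.I‖ ^ N := by
  induction n with
  | zero => exact fun f a M _ _ ε _ _ => ⟨0, 0, le_rfl, fun l hl => absurd hl (Nat.not_lt_zero l)⟩
  | succ n ih =>
    intro f a M h hf ε hε hε1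
    obtain ⟨C₁, N₁, hC₁, hB₁⟩ := exists_topCoeff_growth h hf hε hε1
    obtain ⟨C₂, N₂, hC₂, hB₂⟩ := exists_topCoeff_growth h hf (half_pos hε) (by linarith)
    have hε2 : 0 ≤ ε / 2 := by positivity
    have hs := h.comp_liftPoint hε2
    -- half of the lift controls the top term; its subtraction lowers the degree
    let f' : ℂ × ℂ → ℂ := fun ζ => f (liftPoint (ε / 2) ζ) -
      (ζ.1.im : ℂ) ^ n * a n (liftPoint (ε / 2) ζ)
    have h' : HasImExpansion n f' (fun l ζ => a l (liftPoint (ε / 2) ζ)) := by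
      refine ⟨hs.holo, fun ζ hζ => ?_⟩
      simp only [f']
      rw [hs.eq ζ hζ, Finset.sum_range_succ, add_sub_cancel_right]
    -- `N₂ + n` compensates the growth of the subtracted term, `6` makes the weight integrable
    let M' := M + N₂ + n + 6
    have hmeas : ∀ {g : ℂ × ℂ → ℂ}, ContinuousOn g siegelDomain →
        AEStronglyMeasurable (fun ζ : ℂ × ℂ => ((ζ.2 + Complex.I) ^ M')⁻¹ * g ζ) siegelMeasure :=
      fun hg => ((differentiableOn_inv_pow M').continuousOn.mul hg).aestronglyMeasurable
        measurableSet_siegelDomain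
    have hshift : Integrable (fun ζ => (((liftPoint (ε / 2) ζ).2 + Complex.I) ^ M)⁻¹ *
        f (liftPoint (ε / 2) ζ)) siegelMeasure := by
      have h1 : IntegrableOn (fun ζ => (((liftPoint (ε / 2) ζ).2 + Complex.I) ^ M)⁻¹ *
          f (liftPoint (ε / 2) ζ)) (liftPoint (ε / 2) ⁻¹' siegelDomain) := by
        have h2 := (measurePreserving_liftPoint (ε / 2)).restrict_preimage
          measurableSet_siegelDomain
        exact h2.integrable_comp_of_integrable hf
      exact h1.mono_set fun ζ hζ => liftPoint_mem hε2 hζ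
    have hf' : Integrable (fun ζ => ((ζ.2 + Complex.I) ^ M')⁻¹ * f' ζ) siegelMeasure := by
      have i1 : Integrable (fun ζ => ((ζ.2 + Complex.I) ^ M')⁻¹ * f (liftPoint (ε / 2) ζ))
          siegelMeasure := by
        refine (hshift.norm.const_mul (2 ^ M)).mono' (hmeas hs.continuousOn) ?_
        filter_upwards [ae_restrict_mem measurableSet_siegelDomain] with ζ hζ
        rw [norm_mul, norm_mul, norm_inv, norm_inv, norm_pow, norm_pow, ← mul_assoc]
        gcongr
        have e1 := one_le_norm_add_I hζ
        have e2 := one_le_norm_add_I (liftPoint_mem hε2 hζ)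
        have e3 := norm_liftPoint_le hε2 (by linarith) hζ
        rw [← div_eq_mul_inv, inv_le_comm₀ (by positivity) (by positivity), inv_div,
          div_le_iff₀ (by positivity)]
        calc _ ≤ (2 * ‖ζ.2 + Complex.I‖) ^ M := by gcongr
          _ = ‖ζ.2 + Complex.I‖ ^ M * 2 ^ M := by ring
          _ ≤ ‖ζ.2 + Complex.I‖ ^ M' * 2 ^ M := by
            gcongr
            omega
      have i2 : Integrable (fun ζ => ((ζ.2 + Complex.I) ^ M')⁻¹ *
          ((ζ.1.im : ℂ) ^ n * a n (liftPoint (ε / 2) ζ))) siegelMeasure := by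
        refine (integrable_norm_add_I_pow_neg.const_mul C₂).mono' (hmeas ?_) ?_
        · exact (((Complex.continuous_ofReal.comp
            (Complex.continuous_im.comp continuous_fst)).pow n).continuousOn).mul
            (hs.holo n).continuousOn
        filter_upwards [ae_restrict_mem measurableSet_siegelDomain] with ζ hζ
        rw [norm_mul, norm_mul, norm_inv, norm_pow, norm_pow, Complex.norm_real, Real.norm_eq_abs]
        have e1 := one_le_norm_add_I hζ
        have e2 : |ζ.1.im| ≤ ‖ζ.2 + Complex.I‖ := by
          nlinarith [one_add_sq_lt_norm hζ, Complex.abs_im_le_norm ζ.1, sq_nonneg (‖ζ.1‖ - 1)]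
        have e3 := hB₂ ζ hζ
        set J := ‖ζ.2 + Complex.I‖
        calc (J ^ M')⁻¹ * (|ζ.1.im| ^ n * ‖a n (liftPoint (ε / 2) ζ)‖)
            ≤ (J ^ M')⁻¹ * (J ^ n * (C₂ * J ^ N₂)) := by gcongr
          _ = C₂ * ((J ^ M)⁻¹ * (J ^ 6)⁻¹) := by
            simp only [M']
            rw [pow_add, pow_add, pow_add]
            field_simp
          _ ≤ C₂ * (1 * (J ^ 6)⁻¹) := by
            gcongr
            exact inv_le_one_of_one_le₀ (one_le_pow₀ e1)
          _ = _ := by rw [one_mul]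
      refine (i1.sub i2).congr (Filter.Eventually.of_forall fun ζ => ?_)
      simp only [f', Pi.sub_apply]
      ring
    obtain ⟨C₃, N₃, hC₃, hB₃⟩ := ih f' _ M' h' hf' (ε / 2) (half_pos hε) (by linarith)
    refine ⟨C₁ + C₃, N₁ + N₃, by positivity, fun l hl ζ hζ => ?_⟩
    have e1 := one_le_norm_add_I hζ
    rcases Nat.lt_succ_iff_lt_or_eq.1 hl with hl | rfl
    · have e2 : liftPoint (ε / 2) (liftPoint (ε / 2) ζ) = liftPoint ε ζ := by
        simp only [liftPoint, Prod.mk.injEq, true_and]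
        push_cast; ring
      rw [← e2]
      refine (hB₃ l hl ζ hζ).trans ?_
      gcongr
      · linarith
      · omega
    · refine (hB₁ ζ hζ).trans ?_
      gcongr
      · linarith
      · omega

end CoefficientGrowth

/-! ### Shifting horizontal contours -/

section ContourShift
open Filter Topology

lemma integrable_div_one_add_sq (C : ℝ) : Integrable fun u : ℝ => C / (1 + u ^ 2) := by
  simpa [div_eq_mul_inv] using integrable_inv_one_add_sq.const_mul C

/-- The integral of a holomorphic function with quadratic decay over a horizontal line does not
depend on the line. -/
lemma integral_horizontal_eq {G : ℂ → ℂ} {a b C : ℝ}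
    (hd : ∀ z : ℂ, z.im ∈ Set.uIcc a b → DifferentiableAt ℂ G z)
    (hb : ∀ z : ℂ, z.im ∈ Set.uIcc a b → ‖G z‖ ≤ C / (1 + z.re ^ 2)) :
    ∫ u : ℝ, G (u + a * Complex.I) = ∫ u : ℝ, G (u + b * Complex.I) := by
  have hC : 0 ≤ C := by
    have := (norm_nonneg _).trans (hb (0 + a * Complex.I) (by simp))
    simpa using this
  have hint : ∀ c ∈ Set.uIcc a b, Integrable fun u : ℝ => G (u + c * Complex.I) := by
    intro c hc
    have hcont : Continuous fun u : ℝ => G (u + c * Complex.I) := by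
      refine continuous_iff_continuousAt.2 fun u => ?_
      have h1 : ContinuousAt G ((u : ℂ) + c * Complex.I) := (hd _ (by simpa using hc)).continuousAt
      exact h1.comp (f := fun u : ℝ => (u : ℂ) + c * Complex.I) (by fun_prop)
    refine (integrable_div_one_add_sq C).mono' hcont.aestronglyMeasurable ?_
    exact Eventually.of_forall fun u => by simpa using hb (u + c * Complex.I) (by simpa using hc)
  have hlim : ∀ c ∈ Set.uIcc a b, Tendsto (fun R : ℝ => ∫ u in (-R)..R, G (u + c * Complex.I)) atTop
      (𝓝 (∫ u : ℝ, G (u + c * Complex.I))) := fun c hc =>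
    intervalIntegral_tendsto_integral (hint c hc) tendsto_neg_atTop_atBot tendsto_id
  have hvert : ∀ s : ℝ, s ^ 2 = 1 → Tendsto
      (fun R : ℝ => ∫ y in a..b, G (((s * R : ℝ) : ℂ) + y * Complex.I)) atTop (𝓝 0) := by
    intro s hs
    have h0 : Tendsto (fun R : ℝ => C / (1 + R ^ 2) * |b - a|) atTop (𝓝 0) := by
      have h1 : Tendsto (fun R : ℝ => 1 + R ^ 2) atTop atTop :=
        tendsto_atTop_add_const_left _ _ (tendsto_pow_atTop two_ne_zero)
      simpa using (h1.const_div_atTop C).mul_const |b - a|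
    refine squeeze_zero_norm (fun R => ?_) h0
    refine intervalIntegral.norm_integral_le_of_norm_le_const fun y hy => ?_
    have := hb (((s * R : ℝ) : ℂ) + y * Complex.I) (by simpa using Set.uIoc_subset_uIcc hy)
    simpa [mul_pow, hs] using this
  have hrect : ∀ R : ℝ, (∫ u in (-R)..R, G (u + a * Complex.I)) -
      (∫ u in (-R)..R, G (u + b * Complex.I)) +
      Complex.I • (∫ y in a..b, G (((1 * R : ℝ) : ℂ) + y * Complex.I)) -
      Complex.I • (∫ y in a..b, G (((-1 * R : ℝ) : ℂ) + y * Complex.I)) = 0 := by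
    intro R
    have := Complex.integral_boundary_rect_eq_zero_of_differentiableOn G ⟨-R, a⟩ ⟨R, b⟩
      fun z hz => (hd z hz.2).differentiableWithinAt
    simpa using this
  have hl := ((((hlim a Set.left_mem_uIcc).sub (hlim b Set.right_mem_uIcc)).add
    ((hvert 1 (by norm_num)).const_smul Complex.I)).sub
    ((hvert (-1) (by norm_num)).const_smul Complex.I))
  simp only [hrect, smul_zero, add_zero, sub_zero] at hl
  exact (sub_eq_zero.1 (tendsto_nhds_unique hl tendsto_const_nhds)).symm ▸ rfl

end ContourShift

/-! ### The Fourier–Laplace transform in the second variable -/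

section PartialTransform
open Filter Topology Metric

/-- Holomorphic functions on `D₂` which decay like `|ζ₂ + i|⁻⁴`. -/
structure HasQuarticDecay (A : ℂ × ℂ → ℂ) (C : ℝ) : Prop where
  holo : DifferentiableOn ℂ A siegelDomain
  nonneg : 0 ≤ C
  bound : ∀ ζ ∈ siegelDomain, ‖A ζ‖ ≤ C / ‖ζ.2 + Complex.I‖ ^ 4

variable {A : ℂ × ℂ → ℂ} {C : ℝ}

lemma mem_siegelDomain_of_sq_lt {w : ℂ} {z : ℂ} (h : ‖w‖ ^ 2 < z.im) : (w, z) ∈ siegelDomain := by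
  change 0 < z.im - ‖w‖ ^ 2
  linarith

lemma one_add_re_sq_le {ζ : ℂ × ℂ} (hζ : ζ ∈ siegelDomain) :
    1 + ζ.2.re ^ 2 ≤ ‖ζ.2 + Complex.I‖ ^ 2 := by
  have := siegelDomain_im_pos hζ
  rw [← Complex.normSq_eq_norm_sq, Complex.normSq_apply]
  simp
  nlinarith [sq_nonneg ‖ζ.1‖]

lemma HasQuarticDecay.bound_mul (h : HasQuarticDecay A C) {ζ : ℂ × ℂ} (hζ : ζ ∈ siegelDomain) :
    ‖A ζ‖ ≤ C / ((1 + ‖ζ.1‖ ^ 2) * (1 + ζ.2.re ^ 2)) := by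
  refine (h.bound ζ hζ).trans ?_
  have h0 := h.nonneg
  have h1 := one_le_norm_add_I hζ
  have h2 := one_add_re_sq_le hζ
  have h3 := one_add_sq_lt_norm hζ
  gcongr
  calc (1 + ‖ζ.1‖ ^ 2) * (1 + ζ.2.re ^ 2) ≤ ‖ζ.2 + Complex.I‖ ^ 2 * ‖ζ.2 + Complex.I‖ ^ 2 := by
        gcongr
        nlinarith
    _ = _ := by ring

lemma HasQuarticDecay.bound_re (h : HasQuarticDecay A C) {ζ : ℂ × ℂ} (hζ : ζ ∈ siegelDomain) :
    ‖A ζ‖ ≤ C / (1 + ζ.2.re ^ 2) := by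
  refine (h.bound_mul hζ).trans ?_
  have h0 := h.nonneg
  gcongr
  nlinarith [sq_nonneg ‖ζ.1‖, sq_nonneg ζ.2.re, mul_nonneg (sq_nonneg ‖ζ.1‖) (sq_nonneg ζ.2.re)]

/-- The Fourier–Laplace transform `∫ A(w, z) e^{-itz} dz` in the second variable, along the line
`Im z = |w|² + 1`. -/
noncomputable def partialTransform (A : ℂ × ℂ → ℂ) (t : ℝ) (w : ℂ) : ℂ :=
  ∫ u : ℝ, A (w, u + (‖w‖ ^ 2 + 1 : ℝ) * Complex.I) *
    Complex.exp (-Complex.I * t * (u + (‖w‖ ^ 2 + 1 : ℝ) * Complex.I))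

lemma norm_exp_neg_I_mul (t : ℝ) (z : ℂ) :
    ‖Complex.exp (-Complex.I * t * z)‖ = Real.exp (t * z.im) := by
  rw [Complex.norm_exp]
  simp

/-- Any line `Im z = b` with `b > |w|²` may be used. -/
lemma HasQuarticDecay.partialTransform_eq (h : HasQuarticDecay A C) {t b : ℝ} {w : ℂ}
    (hb : ‖w‖ ^ 2 < b) : partialTransform A t w = ∫ u : ℝ, A (w, u + b * Complex.I) *
      Complex.exp (-Complex.I * t * (u + b * Complex.I)) := by
  have hmem : ∀ z : ℂ, z.im ∈ Set.uIcc (‖w‖ ^ 2 + 1) b → (w, z) ∈ siegelDomain := fun z hz =>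
    mem_siegelDomain_of_sq_lt ((lt_min (by linarith) hb).trans_le hz.1)
  refine integral_horizontal_eq (G := fun z => A (w, z) * Complex.exp (-Complex.I * t * z))
    (C := C * Real.exp (|t| * max (‖w‖ ^ 2 + 1) b)) (fun z hz => ?_) fun z hz => ?_
  · have h1 : DifferentiableAt ℂ A (w, z) :=
      h.holo.differentiableAt (isOpen_siegelDomain.mem_nhds (hmem z hz))
    exact (h1.comp z (f := fun z => (w, z)) (by fun_prop)).mul (by fun_prop)
  · rw [norm_mul, norm_exp_neg_I_mul, mul_div_right_comm]
    have h1 := h.bound_re (hmem z hz)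
    have h2 : t * z.im ≤ |t| * max (‖w‖ ^ 2 + 1) b := by
      have h3 : 0 ≤ z.im := (sq_nonneg _).trans (siegelDomain_im_pos (hmem z hz)).le
      exact mul_le_mul (le_abs_self t) hz.2 h3 (abs_nonneg t)
    have h0 := h.nonneg
    gcongr

/-- The line `Im z = b` may be chosen freely in this bound, subject to `b > |w|²`. -/
lemma HasQuarticDecay.norm_partialTransform_le (h : HasQuarticDecay A C) {t b : ℝ} {w : ℂ}
    (hb : ‖w‖ ^ 2 < b) :
    ‖partialTransform A t w‖ ≤ Real.exp (t * b) * (C * π / (1 + ‖w‖ ^ 2)) := by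
  rw [h.partialTransform_eq hb]
  have h0 := h.nonneg
  have h1 : ∀ u : ℝ, ‖A (w, u + b * Complex.I) *
      Complex.exp (-Complex.I * t * (u + b * Complex.I))‖ ≤
      Real.exp (t * b) * (C / (1 + ‖w‖ ^ 2)) * (1 + u ^ 2)⁻¹ := by
    intro u
    have hm : (w, (u + b * Complex.I : ℂ)) ∈ siegelDomain := mem_siegelDomain_of_sq_lt (by simpa)
    rw [norm_mul, norm_exp_neg_I_mul, mul_comm]
    have h2 := h.bound_mul hm
    simp only [Complex.add_re, Complex.ofReal_re, Complex.mul_re, Complex.I_re, mul_zero,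
      Complex.ofReal_im, Complex.I_im, mul_one, sub_self, add_zero] at h2
    rw [mul_assoc]
    have h3 : ((u : ℂ) + b * Complex.I).im = b := by simp
    rw [h3]
    gcongr
    rwa [← div_eq_mul_inv, div_div]
  refine (norm_integral_le_of_norm_le (integrable_inv_one_add_sq.const_mul _)
    (Eventually.of_forall h1)).trans ?_
  rw [integral_const_mul, integral_univ_inv_one_add_sq]
  apply le_of_eq
  ring

/-- For `t < 0` the line of integration can be moved to `+i∞`. -/
lemma HasQuarticDecay.partialTransform_of_neg (h : HasQuarticDecay A C) {t : ℝ} (ht : t < 0)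
    (w : ℂ) : partialTransform A t w = 0 := by
  have h1 : Tendsto (fun b : ℝ => Real.exp (t * b) * (C * π / (1 + ‖w‖ ^ 2))) atTop (𝓝 0) := by
    have := Real.tendsto_exp_atBot.comp (tendsto_id.const_mul_atTop_of_neg ht)
    simpa using this.mul_const (C * π / (1 + ‖w‖ ^ 2))
  refine norm_le_zero_iff.1 (ge_of_tendsto h1 ?_)
  filter_upwards [eventually_gt_atTop (‖w‖ ^ 2)] with b hb using h.norm_partialTransform_le hb

/-- The transform is entire in `w`: near a given point one line of integration serves all `w`, and
Cauchy's estimate dominates the derivative of the integrand. -/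
lemma HasQuarticDecay.differentiable_partialTransform (h : HasQuarticDecay A C) (t : ℝ) :
    Differentiable ℂ (partialTransform A t) := by
  intro w₀
  set b : ℝ := (‖w₀‖ + 2) ^ 2 with hbdef
  have hlt : ∀ w ∈ ball w₀ 2, ‖w‖ ^ 2 < b := by
    intro w hw
    have := norm_add_le w₀ (w - w₀)
    rw [add_sub_cancel] at this
    rw [mem_ball, dist_eq_norm] at hw
    exact pow_lt_pow_left₀ (by linarith) (norm_nonneg _) two_ne_zero
  have hmem : ∀ w ∈ ball w₀ 2, ∀ u : ℝ, (w, (u + b * Complex.I : ℂ)) ∈ siegelDomain :=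
    fun w hw u => mem_siegelDomain_of_sq_lt (by simpa using hlt w hw)
  let e : ℝ → ℂ := fun u => Complex.exp (-Complex.I * t * (u + b * Complex.I))
  have hen : ∀ u, ‖e u‖ = Real.exp (t * b) := fun u => by
    simp only [e]; rw [norm_exp_neg_I_mul]; simp
  let F : ℂ → ℝ → ℂ := fun w u => A (w, u + b * Complex.I) * e u
  let F' : ℂ → ℝ → ℂ := fun w u => fderiv ℂ A (w, u + b * Complex.I) (1, 0) * e u
  have hsub : ball w₀ 1 ⊆ ball w₀ 2 := ball_subset_ball (by norm_num)
  have hmeas : ∀ w ∈ ball w₀ 2, AEStronglyMeasurable (F w) volume := by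
    intro w hw
    refine (Continuous.mul (h.holo.continuousOn.comp_continuous (by fun_prop) (hmem w hw))
      (by simp only [e]; fun_prop)).aestronglyMeasurable
  have hbound : ∀ w ∈ ball w₀ 2, ∀ u : ℝ, ‖A (w, u + b * Complex.I)‖ ≤ C / (1 + u ^ 2) := by
    intro w hw u
    simpa using h.bound_re (hmem w hw u)
  have hderivA : ∀ w ∈ ball w₀ 2, ∀ u : ℝ, HasDerivAt (fun w => A (w, u + b * Complex.I))
      (fderiv ℂ A (w, u + b * Complex.I) (1, 0)) w := by
    intro w hw u
    have h1 := (h.holo.differentiableAt (isOpen_siegelDomain.mem_nhds (hmem w hw u))).hasFDerivAt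
    exact h1.comp_hasDerivAt w ((hasDerivAt_id w).prodMk (hasDerivAt_const w _))
  have key := (hasDerivAt_integral_of_dominated_loc_of_deriv_le (μ := (volume : Measure ℝ))
    (F := F) (F' := F') (x₀ := w₀) (s := ball w₀ 1)
    (bound := fun u => Real.exp (t * b) * (C / (1 + u ^ 2))) (ball_mem_nhds w₀ one_pos)
    (by filter_upwards [ball_mem_nhds w₀ two_pos] with w hw using hmeas w hw)
    ?_ ?_ ?_ ((integrable_div_one_add_sq C).const_mul _) ?_).2.differentiableAt
  · refine key.congr_of_eventuallyEq ?_
    filter_upwards [ball_mem_nhds w₀ two_pos] with w hw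
    exact h.partialTransform_eq (hlt w hw)
  · refine ((integrable_div_one_add_sq C).const_mul (Real.exp (t * b))).mono'
      (hmeas w₀ (mem_ball_self two_pos)) (Eventually.of_forall fun u => ?_)
    rw [norm_mul, hen, mul_comm]
    exact mul_le_mul_of_nonneg_left (hbound w₀ (mem_ball_self two_pos) u) (Real.exp_pos _).le
  · refine Measurable.aestronglyMeasurable (Measurable.mul ?_ (by simp only [e]; fun_prop))
    exact (measurable_fderiv_apply_const ℂ A (1, 0)).comp
      (by fun_prop : Measurable fun u : ℝ => ((w₀, u + b * Complex.I) : ℂ × ℂ))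
  · refine Eventually.of_forall fun u w hw => ?_
    have hs : closedBall w 1 ⊆ ball w₀ 2 :=
      (closedBall_subset_ball' (by rw [mem_ball] at hw; linarith))
    have h1 := Complex.norm_deriv_le_of_forall_mem_sphere_norm_le (c := w) (R := 1)
      (f := fun w => A (w, u + b * Complex.I)) one_pos
      (DifferentiableOn.diffContOnCl_ball (U := ball w₀ 2)
        (fun z hz => (hderivA z hz u).differentiableAt.differentiableWithinAt) hs)
      (fun z hz => hbound z (hs (sphere_subset_closedBall hz)) u)
    rw [(hderivA w (hsub hw) u).deriv, div_one] at h1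
    rw [norm_mul, hen, mul_comm]
    exact mul_le_mul_of_nonneg_left h1 (Real.exp_pos _).le
  · exact Eventually.of_forall fun u w hw => (hderivA w (hsub hw) u).mul_const _

end PartialTransform

/-! ### The transform of polyanalytic functions with decaying coefficients -/

section TransformOfPolyanalytic
open Filter Topology

variable {A : ℂ × ℂ → ℂ} {C : ℝ}

lemma kappa_mem {v : ℝ × ℝ} (hv : v ∈ halfPlane) (u : ℝ × ℝ) : kappa (u, v) ∈ siegelDomain := by
  have : 0 < v.2 := hv
  simpa [kappa, siegelDomain, ← Complex.ofReal_pow] using this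

lemma kappa_eq (u v : ℝ × ℝ) : kappa (u, v) =
    (⟨u.1, v.1⟩, u.2 + (v.2 + ‖(⟨u.1, v.1⟩ : ℂ)‖ ^ 2 : ℝ) * Complex.I) := by
  simp only [kappa, Prod.mk.injEq, true_and]
  apply Complex.ext <;> simp [-Complex.ofReal_pow, ← Complex.ofReal_pow]

lemma continuous_kappa : Continuous kappa := by
  have : kappa = fun p : (ℝ × ℝ) × (ℝ × ℝ) => ((p.1.1 + p.2.1 * Complex.I : ℂ),
      (p.1.2 + p.2.2 * Complex.I + Complex.I * (‖(p.1.1 + p.2.1 * Complex.I : ℂ)‖ : ℂ) ^ 2 : ℂ)) := by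
    ext1 p
    simp only [kappa, Complex.mk_eq_add_mul_I]
  rw [this]
  fun_prop

lemma HasQuarticDecay.integrable_slice (h : HasQuarticDecay A C) {v : ℝ × ℝ}
    (hv : v ∈ halfPlane) {e : ℝ × ℝ → ℂ} (he : Continuous e) (he1 : ∀ u, ‖e u‖ ≤ 1) :
    Integrable fun u : ℝ × ℝ => A (kappa (u, v)) * e u := by
  have h2 : Integrable (fun u : ℝ × ℝ => (1 + u.1 ^ 2)⁻¹ * (1 + u.2 ^ 2)⁻¹) :=
    integrable_inv_one_add_sq.mul_prod integrable_inv_one_add_sq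
  refine (h2.const_mul C).mono' (Continuous.aestronglyMeasurable ?_) ?_
  · exact (h.holo.continuousOn.comp_continuous (continuous_kappa.comp (by fun_prop))
      (kappa_mem hv)).mul he
  refine Eventually.of_forall fun u => ?_
  have h3 := h.bound_mul (kappa_mem hv u)
  have h4 : (kappa (u, v)).2.re = u.2 := by rw [kappa_eq]; simp [-Complex.ofReal_pow]
  have h5 : 1 + u.1 ^ 2 ≤ 1 + ‖(kappa (u, v)).1‖ ^ 2 := by
    rw [kappa_eq, ← Complex.normSq_eq_norm_sq, Complex.normSq_mk]
    nlinarith [mul_self_nonneg v.1]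
  have h0 := h.nonneg
  rw [norm_mul]
  calc ‖A (kappa (u, v))‖ * ‖e u‖ ≤ ‖A (kappa (u, v))‖ * 1 := by gcongr; exact he1 u
    _ ≤ C / ((1 + ‖(kappa (u, v)).1‖ ^ 2) * (1 + (kappa (u, v)).2.re ^ 2)) := by rwa [mul_one]
    _ ≤ C / ((1 + u.1 ^ 2) * (1 + u.2 ^ 2)) := by rw [h4]; gcongr
    _ = _ := by rw [div_eq_mul_inv, mul_inv]

/-- Integration in `u₂` turns the Fourier integral of a slice into one of the entire function
`partialTransform A t₂`. -/
lemma HasQuarticDecay.integral_slice_eq (h : HasQuarticDecay A C) {v : ℝ × ℝ}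
    (hv : v ∈ halfPlane) (t₁ t₂ : ℝ) :
    ∫ u : ℝ × ℝ, A (kappa (u, v)) * Complex.exp (-Complex.I * (t₁ * u.1 + t₂ * u.2)) =
      ∫ u : ℝ, Complex.exp (-Complex.I * t₁ * u) *
        (Complex.exp (-t₂ * (v.2 + ‖(⟨u, v.1⟩ : ℂ)‖ ^ 2 : ℝ)) *
          partialTransform A t₂ ⟨u, v.1⟩) := by
  have hi := h.integrable_slice hv
    (e := fun u => Complex.exp (-Complex.I * (t₁ * u.1 + t₂ * u.2))) (by fun_prop) fun u => by
      rw [Complex.norm_exp]; simp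
  rw [Measure.volume_eq_prod] at hi ⊢
  rw [integral_prod _ hi]
  refine integral_congr_ae (Eventually.of_forall fun u => ?_)
  have hv2 : 0 < v.2 := hv
  simp only
  rw [h.partialTransform_eq (t := t₂) (w := ⟨u, v.1⟩) (b := v.2 + ‖(⟨u, v.1⟩ : ℂ)‖ ^ 2)
    (by linarith), ← integral_const_mul, ← integral_const_mul]
  refine integral_congr_ae (Eventually.of_forall fun s => ?_)
  simp only [kappa_eq]
  have : Complex.exp (-Complex.I * (t₁ * u + t₂ * s)) = Complex.exp (-Complex.I * t₁ * u) *
      (Complex.exp (-t₂ * (v.2 + ‖(⟨u, v.1⟩ : ℂ)‖ ^ 2 : ℝ)) *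
      Complex.exp (-Complex.I * t₂ * (s + (v.2 + ‖(⟨u, v.1⟩ : ℂ)‖ ^ 2 : ℝ) * Complex.I))) := by
    rw [← Complex.exp_add, ← Complex.exp_add]
    congr 1
    linear_combination ((t₂ * (v.2 + ‖(⟨u, v.1⟩ : ℂ)‖ ^ 2 : ℝ)) : ℂ) * Complex.I_sq
  rw [this]
  ring

/-- The entire function `e^{-tw² - 2i√t x w} ∫ A(w, z) e^{-itz} dz` of `w`. On the line
`Im w = (y - x) / (2√t)` it is, up to the factor `e^{(y² - x²)/2}`, the integrand of the Fourier
integral of a slice. -/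
noncomputable def shiftedIntegrand (A : ℂ × ℂ → ℂ) (x t : ℝ) (w : ℂ) : ℂ :=
  Complex.exp (-t * w ^ 2 - 2 * Complex.I * √t * x * w) * partialTransform A t w

/-- The factor `e^{-tw²}` compensates the growth `e^{t|w|²}` of the transform in `Re w`, so the line of
integration can be moved to the real axis. -/
lemma HasQuarticDecay.integral_shiftedIntegrand (h : HasQuarticDecay A C) {x t : ℝ} (ht : 0 ≤ t)
    (b : ℝ) : ∫ u : ℝ, shiftedIntegrand A x t (u + b * Complex.I) =
      ∫ u : ℝ, shiftedIntegrand A x t (u + (0 : ℝ) * Complex.I) := by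
  have h0 := h.nonneg
  refine integral_horizontal_eq
    (C := Real.exp (2 * t * b ^ 2 + 2 * √t * |x| * |b| + t) * (C * π)) (fun z _ => ?_)
    fun z hz => ?_
  · exact (by fun_prop : DifferentiableAt ℂ
      (fun w : ℂ => Complex.exp (-t * w ^ 2 - 2 * Complex.I * √t * x * w)) z).mul
      (h.differentiable_partialTransform t z)
  · have hzb : |z.im| ≤ |b| := by
      rcases Set.mem_uIcc.1 hz with hz | hz
      · rw [abs_of_nonpos hz.2, abs_of_nonpos (hz.1.trans hz.2)]; linarith [hz.1]
      · rw [abs_of_nonneg hz.1, abs_of_nonneg (hz.1.trans hz.2)]; exact hz.2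
    have h1 := h.norm_partialTransform_le (t := t) (w := z) (b := ‖z‖ ^ 2 + 1) (by linarith)
    have hns : ‖z‖ ^ 2 = z.re ^ 2 + z.im ^ 2 := by
      rw [← Complex.normSq_eq_norm_sq, Complex.normSq_apply]; ring
    rw [shiftedIntegrand, norm_mul, Complex.norm_exp]
    have h2 : (-t * z ^ 2 - 2 * Complex.I * √t * x * z : ℂ).re =
        -t * (z.re ^ 2 - z.im ^ 2) + 2 * √t * x * z.im := by
      simp [pow_two]
    rw [h2]
    calc _ ≤ Real.exp (-t * (z.re ^ 2 - z.im ^ 2) + 2 * √t * x * z.im) *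
          (Real.exp (t * (‖z‖ ^ 2 + 1)) * (C * π / (1 + ‖z‖ ^ 2))) := by gcongr
      _ = Real.exp (2 * t * z.im ^ 2 + 2 * √t * (x * z.im) + t) * (C * π / (1 + ‖z‖ ^ 2)) := by
        rw [← mul_assoc, ← Real.exp_add, hns]
        congr 2
        ring
      _ ≤ Real.exp (2 * t * b ^ 2 + 2 * √t * (|x| * |b|) + t) * (C * π / (1 + z.re ^ 2)) := by
        have h3 : z.im ^ 2 ≤ b ^ 2 := sq_le_sq.2 hzb
        have h4 : x * z.im ≤ |x| * |b| := by
          refine (le_abs_self _).trans ?_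
          rw [abs_mul]
          gcongr
        have h5 : z.re ^ 2 ≤ ‖z‖ ^ 2 := by rw [hns]; nlinarith [sq_nonneg z.im]
        gcongr
      _ = _ := by rw [mul_assoc (2 * √t)]; ring

/-- In the coordinates `(x, y)` of `V₂`, the Fourier integral of a slice is a Gaussian in `y`. -/
lemma HasQuarticDecay.integral_slice_gaussian (h : HasQuarticDecay A C) {x t : ℝ} (ht : 0 < t)
    (y s : ℝ) (hs : 0 < s) :
    ∫ u : ℝ × ℝ, A (kappa (u, (1 / (2 * √t) * (-x + y), s))) *
        Complex.exp (-Complex.I * ((√t * (x + y) : ℝ) * u.1 + t * u.2)) =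
      Real.exp (-t * s) * (Real.exp (x ^ 2 / 2) * Real.exp (-y ^ 2 / 2)) *
        ∫ u : ℝ, shiftedIntegrand A x t (u + (0 : ℝ) * Complex.I) := by
  have hst : √t * √t = t := Real.mul_self_sqrt ht.le
  have hs0 : 0 < √t := Real.sqrt_pos.2 ht
  set b := 1 / (2 * √t) * (-x + y) with hb
  have hbt : 2 * √t * b = y - x := by rw [hb]; field_simp; ring
  rw [h.integral_slice_eq (show ((b, s) : ℝ × ℝ) ∈ halfPlane from hs),
    ← h.integral_shiftedIntegrand ht.le b, ← integral_const_mul]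
  refine integral_congr_ae (Eventually.of_forall fun u => ?_)
  simp only [shiftedIntegrand, Complex.mk_eq_add_mul_I]
  rw [← mul_assoc, ← mul_assoc]
  congr 1
  have hn : ‖((u : ℂ) + b * Complex.I)‖ ^ 2 = u ^ 2 + b ^ 2 := by
    rw [← Complex.normSq_eq_norm_sq, Complex.normSq_add_mul_I]
  push_cast
  rw [← Complex.exp_add, ← Complex.exp_add, ← Complex.exp_add, ← Complex.exp_add,
    ← Complex.ofReal_pow, hn]
  congr 1
  have e1 : ((√t : ℝ) : ℂ) * (√t : ℝ) = (t : ℂ) := by rw [← Complex.ofReal_mul, hst]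
  have e2 : (2 : ℂ) * (√t : ℝ) * (b : ℂ) = y - x := by exact_mod_cast hbt
  have e3 : (y : ℂ) = x + 2 * (√t : ℝ) * (b : ℂ) := by rw [e2]; ring
  rw [e3, ← e1]
  push_cast
  linear_combination (((√t : ℝ) : ℂ) * (√t : ℝ) * b ^ 2 + 2 * (√t : ℝ) * x * b) * Complex.I_sq

lemma fourierSlice_eq_sum {n : ℕ} {f : ℂ × ℂ → ℂ} {A : ℕ → ℂ × ℂ → ℂ} {C : ℕ → ℝ}
    (hE : HasImExpansion n f A) (hA : ∀ l < n, HasQuarticDecay (A l) (C l)) {t v : ℝ × ℝ}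
    (hv : v ∈ halfPlane) : fourierSlice f (t, v) = (2 * π : ℂ)⁻¹ * ∑ l ∈ Finset.range n,
      (v.1 : ℂ) ^ l * ∫ u : ℝ × ℝ, A l (kappa (u, v)) *
        Complex.exp (-Complex.I * (t.1 * u.1 + t.2 * u.2)) := by
  rw [fourierSlice]
  congr 1
  have h1 : ∀ u : ℝ × ℝ, f (kappa (u, v)) * Complex.exp (-Complex.I * (t.1 * u.1 + t.2 * u.2)) =
      ∑ l ∈ Finset.range n, (v.1 : ℂ) ^ l * (A l (kappa (u, v)) *
        Complex.exp (-Complex.I * (t.1 * u.1 + t.2 * u.2))) := by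
    intro u
    rw [hE.eq _ (kappa_mem hv u), Finset.sum_mul]
    refine Finset.sum_congr rfl fun l _ => ?_
    rw [mul_assoc]
    rfl
  simp only [h1]
  rw [integral_finsetSum]
  · simp only [integral_const_mul]
  · intro l hl
    refine ((hA l (Finset.mem_range.1 hl)).integrable_slice hv (by fun_prop) fun u => ?_).const_mul _
    rw [Complex.norm_exp]; simp

/-- The transform of a polyanalytic function with decaying coefficients lies in the range of
`R₀`: it is `χ(x₂) e^{-y₂/2} e^{-y₁²/2}` times a polynomial in `y₁` of degree `< n`. -/
lemma exists_opR₀_eq_opU_of_decay {n : ℕ} {f : ℂ × ℂ → ℂ} {A : ℕ → ℂ × ℂ → ℂ} {C : ℕ → ℝ}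
    (hE : HasImExpansion n f A) (hA : ∀ l < n, HasQuarticDecay (A l) (C l))
    {F : Lp ℂ 2 siegelMeasure} (hF : F =ᵐ[siegelMeasure] f) : ∃ g : L2n n, opU F = opR₀ n g := by
  classical
  -- a representative that is measurable on all of `ℂ²`
  let f' : ℂ × ℂ → ℂ := siegelDomain.indicator f
  have hf'm : Measurable f' := by
    have := ContinuousOn.measurable_piecewise (s := siegelDomain) (f := f) (g := 0)
      hE.continuousOn continuousOn_const measurableSet_siegelDomain
    rwa [Set.piecewise_eq_indicator] at this
  have hE' : HasImExpansion n f' A := ⟨hE.holo, fun ζ hζ => by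
    simp only [f']; rw [Set.indicator_of_mem hζ, hE.eq ζ hζ]⟩
  have hFf' : F =ᵐ[siegelMeasure] f' := by
    filter_upwards [hF, ae_restrict_mem measurableSet_siegelDomain] with ζ h1 h2
    rw [h1]; simp only [f']; rw [Set.indicator_of_mem h2]
  have hslice : ∀ v ∈ halfPlane, Integrable fun u : ℝ × ℝ => f' (kappa (u, v)) := by
    intro v hv
    have h1 : (fun u : ℝ × ℝ => f' (kappa (u, v))) = fun u => ∑ l ∈ Finset.range n,
        (v.1 : ℂ) ^ l * (A l (kappa (u, v)) * 1) := by
      ext u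
      rw [hE'.eq _ (kappa_mem hv u)]
      simp only [mul_one]
      rfl
    rw [h1]
    refine integrable_finsetSum _ fun l hl => Integrable.const_mul ?_ _
    exact (hA l (Finset.mem_range.1 hl)).integrable_slice hv continuous_const (by simp)
  have key := Measure.ae_ae_of_ae_prod (opU_coeFn_of_integrable hf'm F hFf' hslice)
  refine exists_opR₀_eq n _ ?_
  filter_upwards [key, ae_snd_ne_zero] with x hx hx0
  rcases lt_or_gt_of_ne hx0 with hneg | hpos
  · refine ⟨0, ?_⟩
    filter_upwards [hx, ae_restrict_mem measurableSet_halfPlane] with y hy hy2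
    have hy2' : 0 < y.2 := hy2
    rw [hy, Set.indicator_of_notMem (by simp [halfPlane, hneg.le])]
    simp only [psi₁, psi₂]
    rw [fourierSlice_eq_sum hE' hA (show _ ∈ halfPlane from by
      change 0 < y.2 / (2 * |x.2|); positivity), Finset.sum_eq_zero, mul_zero, mul_zero]
    intro l hl
    rw [(hA l (Finset.mem_range.1 hl)).integral_slice_eq (show _ ∈ halfPlane from by
      change 0 < y.2 / (2 * |x.2|); positivity)]
    simp [(hA l (Finset.mem_range.1 hl)).partialTransform_of_neg hneg]
  -- `κ l` is the integral over the real axis, which does not depend on `y`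
  · let κ : ℕ → ℂ := fun l => ∫ u : ℝ, shiftedIntegrand (A l) x.1 x.2 (u + (0 : ℝ) * Complex.I)
    let d : ℂ := ((1 / √(2 * |x.2|) : ℝ) : ℂ) * (2 * π : ℂ)⁻¹ * Real.exp (x.1 ^ 2 / 2)
    let p : Polynomial ℂ := ∑ l ∈ Finset.range n, Polynomial.C (d * κ l) *
      (Polynomial.C ((1 / (2 * √x.2) : ℝ) : ℂ) * (Polynomial.X - Polynomial.C (x.1 : ℂ))) ^ l
    have hp : p.degree < n := by
      rw [← Polynomial.mem_degreeLT]
      refine Submodule.sum_mem _ fun l hl => ?_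
      rw [Polynomial.mem_degreeLT]
      refine Polynomial.degree_le_natDegree.trans_lt ?_
      rw [Nat.cast_lt]
      refine lt_of_le_of_lt ?_ (Finset.mem_range.1 hl)
      refine (Polynomial.natDegree_C_mul_le _ _).trans (Polynomial.natDegree_pow_le.trans ?_)
      refine (Nat.mul_le_mul_left l ((Polynomial.natDegree_C_mul_le _ _).trans
        (Polynomial.natDegree_X_sub_C_le _))).trans (by simp)
    obtain ⟨a, ha⟩ := exists_sum_hermiteFun n p hp
    refine ⟨a, ?_⟩
    filter_upwards [hx, ae_restrict_mem measurableSet_halfPlane] with y hy hy2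
    have hy2' : 0 < y.2 := hy2
    have hs : 0 < y.2 / (2 * x.2) := by positivity
    rw [hy, Set.indicator_of_mem (show x ∈ halfPlane from hpos)]
    simp only [psi₁, psi₂, weight₁, basisFun]
    rw [abs_of_pos hpos, fourierSlice_eq_sum hE' hA (show _ ∈ halfPlane from hs)]
    have h1 : ∀ l ∈ Finset.range n, ∫ u : ℝ × ℝ,
        A l (kappa (u, (1 / (2 * √x.2) * (-x.1 + y.1), y.2 / (2 * x.2)))) *
        Complex.exp (-Complex.I * ((√x.2 * (x.1 + y.1) : ℝ) * u.1 + x.2 * u.2)) =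
        laguerreFun₀ y.2 * (Real.exp (x.1 ^ 2 / 2) * Real.exp (-y.1 ^ 2 / 2)) * κ l := by
      intro l hl
      rw [(hA l (Finset.mem_range.1 hl)).integral_slice_gaussian hpos y.1 _ hs, laguerreFun₀]
      have : -x.2 * (y.2 / (2 * x.2)) = -y.2 / 2 := by field_simp
      rw [this]
    rw [Finset.sum_congr rfl fun l hl => by rw [h1 l hl]]
    simp only [← mul_assoc]
    rw [← Finset.sum_mul, ← ha, Polynomial.eval_finsetSum, Finset.mul_sum, Finset.sum_mul,
      Finset.sum_mul]
    refine Finset.sum_congr rfl fun l _ => ?_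
    simp only [Polynomial.eval_mul, Polynomial.eval_pow, Polynomial.eval_C, Polynomial.eval_sub,
      Polynomial.eval_X, d, abs_of_pos hpos]
    push_cast
    rw [neg_add_eq_sub]
    ring

end TransformOfPolyanalytic

/-! ### Approximation by functions with decaying coefficients -/

section Approximation
open Filter Topology

/-- The range of the isometry `R₀` is closed. -/
lemma isClosed_setOf_opU_eq_opR₀ (n : ℕ) :
    IsClosed {F : Lp ℂ 2 siegelMeasure | ∃ g : L2n n, opU F = opR₀ n g} := by
  have h1 : IsClosed (Set.range (opR₀ n)) :=
    (AddMonoidHomClass.isometry_of_norm _ (norm_opR₀ n)).isClosedEmbedding.isClosed_range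
  have h2 : {F : Lp ℂ 2 siegelMeasure | ∃ g : L2n n, opU F = opR₀ n g} =
      opU ⁻¹' Set.range (opR₀ n) := by
    ext F
    simp [eq_comm]
  rw [h2]
  exact h1.preimage opU.continuous

/-- The damping factor `(i / (δ ζ₂ + i))^M`, which is bounded by `1` on `D₂`, decays like
`|ζ₂|^{-M}`, and tends to `1` as `δ → 0`. -/
noncomputable def damping (M : ℕ) (δ : ℝ) (ζ : ℂ × ℂ) : ℂ :=
  (Complex.I / (δ * ζ.2 + Complex.I)) ^ M

lemma one_le_norm_damping_denom {δ : ℝ} (hδ : 0 ≤ δ) {ζ : ℂ × ℂ} (hζ : ζ ∈ siegelDomain) :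
    1 ≤ ‖δ * ζ.2 + Complex.I‖ := by
  have h1 : 0 < ζ.2.im := (sq_nonneg _).trans_lt (siegelDomain_im_pos hζ)
  have h2 := Complex.im_le_norm (δ * ζ.2 + Complex.I)
  have h3 : (δ * ζ.2 + Complex.I).im = δ * ζ.2.im + 1 := by simp
  rw [h3] at h2
  nlinarith [mul_nonneg hδ h1.le]

lemma mul_norm_le_norm_damping_denom {δ : ℝ} (hδ : 0 ≤ δ) (hδ1 : δ ≤ 1) {ζ : ℂ × ℂ}
    (hζ : ζ ∈ siegelDomain) : δ * ‖ζ.2 + Complex.I‖ ≤ ‖δ * ζ.2 + Complex.I‖ := by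
  have h1 : 0 < ζ.2.im := (sq_nonneg _).trans_lt (siegelDomain_im_pos hζ)
  refine (sq_le_sq₀ (by positivity) (norm_nonneg _)).1 ?_
  rw [mul_pow, ← Complex.normSq_eq_norm_sq, ← Complex.normSq_eq_norm_sq]
  simp [Complex.normSq_apply]
  nlinarith [mul_nonneg hδ h1.le]

lemma norm_damping_le_one (M : ℕ) {δ : ℝ} (hδ : 0 ≤ δ) {ζ : ℂ × ℂ} (hζ : ζ ∈ siegelDomain) :
    ‖damping M δ ζ‖ ≤ 1 := by
  rw [damping, norm_pow, norm_div, Complex.norm_I]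
  exact pow_le_one₀ (by positivity)
    (div_le_one_of_le₀ (one_le_norm_damping_denom hδ hζ) (norm_nonneg _))

lemma norm_damping_le (M : ℕ) {δ : ℝ} (hδ : 0 < δ) (hδ1 : δ ≤ 1) {ζ : ℂ × ℂ}
    (hζ : ζ ∈ siegelDomain) : ‖damping M δ ζ‖ ≤ (δ ^ M)⁻¹ / ‖ζ.2 + Complex.I‖ ^ M := by
  have h1 := mul_norm_le_norm_damping_denom hδ.le hδ1 hζ
  have h2 := one_le_norm_add_I hζ
  rw [damping, norm_pow, norm_div, Complex.norm_I, ← inv_pow, ← div_pow]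
  refine pow_le_pow_left₀ (by positivity) ?_ M
  rw [inv_eq_one_div, div_div]
  exact one_div_le_one_div_of_le (by positivity) h1

lemma differentiableOn_damping (M : ℕ) {δ : ℝ} (hδ : 0 ≤ δ) :
    DifferentiableOn ℂ (damping M δ) siegelDomain := by
  have h : Differentiable ℂ fun ζ : ℂ × ℂ => δ * ζ.2 + Complex.I := by fun_prop
  have h1 : DifferentiableOn ℂ (fun ζ : ℂ × ℂ => (δ * ζ.2 + Complex.I)⁻¹) siegelDomain :=
    h.differentiableOn.fun_inv fun ζ hζ =>
      norm_pos_iff.1 (one_pos.trans_le (one_le_norm_damping_denom hδ hζ))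
  exact (h1.const_mul Complex.I).pow M

lemma tendsto_damping (M : ℕ) (ζ : ℂ × ℂ) :
    Tendsto (fun δ : ℝ => damping M δ ζ) (𝓝 0) (𝓝 1) := by
  have : ContinuousAt (fun δ : ℝ => damping M δ ζ) 0 := by
    unfold damping
    refine ContinuousAt.pow (ContinuousAt.div (by fun_prop) (by fun_prop) ?_) _
    simp
  have h := this.tendsto
  simpa [damping] using h

lemma tendsto_eLpNorm_damping (M : ℕ) {f : ℂ × ℂ → ℂ} (hf : MemLp f 2 siegelMeasure) {δ : ℕ → ℝ}
    (hδ : ∀ k, 0 < δ k) (hδ0 : Tendsto δ atTop (𝓝 0)) :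
    Tendsto (fun k => eLpNorm ((fun ζ => damping M (δ k) ζ * f ζ) - f) 2 siegelMeasure) atTop
      (𝓝 0) := by
  have h1 : Tendsto (fun k => ∫⁻ ζ, ‖((fun ζ => damping M (δ k) ζ * f ζ) - f) ζ‖ₑ ^ 2
      ∂siegelMeasure) atTop (𝓝 (∫⁻ _, 0 ∂siegelMeasure)) := by
    refine tendsto_lintegral_of_dominated_convergence' (fun ζ => (2 * ‖f ζ‖ₑ) ^ 2) (fun k => ?_)
      (fun k => ?_) ?_ ?_
    · refine AEMeasurable.pow_const (AEStronglyMeasurable.enorm (AEStronglyMeasurable.sub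
        (AEStronglyMeasurable.mul ?_ hf.1) hf.1)) 2
      exact (differentiableOn_damping M (hδ k).le).continuousOn.aestronglyMeasurable
        measurableSet_siegelDomain
    · filter_upwards [ae_restrict_mem measurableSet_siegelDomain] with ζ hζ
      gcongr
      have h2 : ((fun ζ => damping M (δ k) ζ * f ζ) - f) ζ = damping M (δ k) ζ * f ζ - f ζ := rfl
      rw [h2, two_mul]
      refine (enorm_sub_le).trans ?_
      gcongr
      rw [enorm_mul]
      refine mul_le_of_le_one_left zero_le ?_
      rw [← ofReal_norm, ← ENNReal.ofReal_one]
      exact ENNReal.ofReal_le_ofReal (norm_damping_le_one M (hδ k).le hζ)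
    · have h2 : ∫⁻ ζ, (2 * ‖f ζ‖ₑ) ^ 2 ∂siegelMeasure = 4 * eLpNorm f 2 siegelMeasure ^ 2 := by
        simp_rw [mul_pow]
        rw [lintegral_const_mul' _ _ (by norm_num), eLpNorm_two_sq]
        norm_num
      rw [h2]
      exact ENNReal.mul_ne_top (by norm_num) (ENNReal.pow_ne_top hf.2.ne)
    · refine Eventually.of_forall fun ζ => ?_
      have h2 : Tendsto (fun k => damping M (δ k) ζ * f ζ - f ζ) atTop (𝓝 (1 * f ζ - f ζ)) :=
        (((tendsto_damping M ζ).comp hδ0).mul_const _).sub_const _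
      rw [one_mul, sub_self] at h2
      have h3 := ((ENNReal.continuous_pow 2).tendsto _).comp h2.enorm
      simpa [Function.comp_def] using h3
  rw [lintegral_zero] at h1
  simp_rw [← eLpNorm_two_sq] at h1
  have h2 := h1.ennrpow_const (1 / 2 : ℝ)
  simp only [one_div] at h2
  rw [ENNReal.zero_rpow_of_pos (by norm_num)] at h2
  refine h2.congr fun k => ?_
  rw [← ENNReal.rpow_natCast, ← ENNReal.rpow_mul]
  simp

/-- Translation in the direction `Im ζ₂` is continuous in `L²(D₂)`. -/
lemma tendsto_eLpNorm_liftPoint {f : ℂ × ℂ → ℂ} (hf : MemLp f 2 siegelMeasure) {ε : ℕ → ℝ}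
    (hε : ∀ k, 0 < ε k) (hε0 : Tendsto ε atTop (𝓝 0)) :
    Tendsto (fun k => eLpNorm ((fun ζ => f (liftPoint (ε k) ζ)) - f) 2 siegelMeasure) atTop
      (𝓝 0) := by
  let f₀ : ℂ × ℂ → ℂ := siegelDomain.indicator f
  have hf₀ : MemLp f₀ 2 volume := (memLp_indicator_iff_restrict measurableSet_siegelDomain).2 hf
  let g : C(ℝ, C(ℂ × ℂ, ℂ × ℂ)) := (ContinuousMap.mk
    (fun p : ℝ × (ℂ × ℂ) => liftPoint p.1 p.2) (by unfold liftPoint; fun_prop)).curry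
  have h1 : Continuous fun s : ℝ => Lp.compMeasurePreserving (g s)
      (measurePreserving_liftPoint s) (hf₀.toLp f₀) :=
    continuous_const.compMeasurePreservingLp g.continuous _ (by norm_num)
  have h2 := (h1.tendsto 0).comp hε0
  have h3 : ∀ s, Lp.compMeasurePreserving (g s) (measurePreserving_liftPoint s) (hf₀.toLp f₀) =
      (hf₀.comp_measurePreserving (measurePreserving_liftPoint s)).toLp _ := fun s => rfl
  simp only [Function.comp_def, h3] at h2
  rw [Lp.tendsto_Lp_iff_tendsto_eLpNorm''] at h2
  refine tendsto_of_tendsto_of_tendsto_of_le_of_le tendsto_const_nhds h2 (fun _ => zero_le)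
    fun k => ?_
  refine le_trans (le_of_eq ?_) (eLpNorm_mono_measure _ (Measure.restrict_le_self (s := siegelDomain)))
  refine eLpNorm_congr_ae ?_
  filter_upwards [ae_restrict_mem measurableSet_siegelDomain] with ζ hζ
  have h0 : liftPoint 0 ζ = ζ := by simp [liftPoint]
  simp only [Pi.sub_apply, f₀, h0]
  rw [Set.indicator_of_mem hζ, Set.indicator_of_mem (liftPoint_mem (hε k).le hζ)]

lemma memLp_comp_liftPoint {f : ℂ × ℂ → ℂ} (hf : MemLp f 2 siegelMeasure) {ε : ℝ} (hε : 0 ≤ ε) :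
    MemLp (fun ζ => f (liftPoint ε ζ)) 2 siegelMeasure := by
  have h1 := hf.comp_measurePreserving
    ((measurePreserving_liftPoint ε).restrict_preimage measurableSet_siegelDomain)
  exact h1.mono_measure (Measure.restrict_mono (fun ζ hζ => liftPoint_mem hε hζ) le_rfl)

lemma memLp_damping_mul (M : ℕ) {δ : ℝ} (hδ : 0 ≤ δ) {f : ℂ × ℂ → ℂ}
    (hf : MemLp f 2 siegelMeasure) :
    MemLp (fun ζ => damping M δ ζ * f ζ) 2 siegelMeasure := by
  refine hf.mono (((differentiableOn_damping M hδ).continuousOn.aestronglyMeasurable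
    measurableSet_siegelDomain).mul hf.1) ?_
  filter_upwards [ae_restrict_mem measurableSet_siegelDomain] with ζ hζ
  rw [norm_mul]
  exact mul_le_of_le_one_left (norm_nonneg _) (norm_damping_le_one M hδ hζ)

/-- The weight `|ζ₂ + i|⁻³` is square integrable on `D₂`. -/
lemma integrable_inv_pow_mul {f : ℂ × ℂ → ℂ} (hf : MemLp f 2 siegelMeasure) :
    Integrable (fun ζ => ((ζ.2 + Complex.I) ^ 3)⁻¹ * f ζ) siegelMeasure := by
  refine MemLp.integrable_mul (p := 2) (q := 2) ?_ hf
  have hm : AEStronglyMeasurable (fun ζ : ℂ × ℂ => ((ζ.2 + Complex.I) ^ 3)⁻¹) siegelMeasure :=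
    (differentiableOn_inv_pow 3).continuousOn.aestronglyMeasurable measurableSet_siegelDomain
  rw [memLp_two_iff_integrable_sq_norm hm]
  refine integrable_norm_add_I_pow_neg.congr (Eventually.of_forall fun ζ => ?_)
  simp only
  rw [norm_inv, norm_pow, inv_pow, ← pow_mul]

/-- The transform `U` maps the space of `(n, 1)`-analytic functions into the range of `R₀`. -/
lemma exists_opR₀_eq_opU (n : ℕ) {f : Lp ℂ 2 siegelMeasure} (hf : f ∈ polyBergman n 1) :
    ∃ g : L2n n, opU f = opR₀ n g := by
  obtain ⟨f₀, hf₀, hff₀⟩ := hf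
  obtain ⟨a, ha⟩ := hf₀.exists_hasImExpansion
  have hL : MemLp f₀ 2 siegelMeasure := (memLp_congr_ae hff₀).1 (Lp.memLp f)
  have hfe : f = hL.toLp f₀ := Lp.ext (hff₀.trans hL.coeFn_toLp.symm)
  have hcl := isClosed_setOf_opU_eq_opR₀ n
  let s : ℕ → ℝ := fun k => 1 / ((k : ℝ) + 1)
  have hs : ∀ k, 0 < s k := fun k => by positivity
  have hs1 : ∀ k, s k ≤ 1 := fun k => by
    simp only [s]
    rw [div_le_one (by positivity)]
    linarith [(Nat.cast_nonneg k : (0 : ℝ) ≤ k)]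
  have hs0 : Tendsto s atTop (𝓝 0) := tendsto_one_div_add_atTop_nhds_zero_nat
  -- the translates of `f` satisfy the claim, as limits of damped translates as `δ → 0`
  have hlift : ∀ k, ∃ g : L2n n,
      opU ((memLp_comp_liftPoint hL (hs k).le).toLp _) = opR₀ n g := by
    intro k
    obtain ⟨C, N, hC, hB⟩ := exists_coeff_growth n f₀ a 3 ha (integrable_inv_pow_mul hL) (s k)
      (hs k) (hs1 k)
    have hE := ha.comp_liftPoint (hs k).le
    have hLk := memLp_comp_liftPoint hL (hs k).le
    have hconv := (Lp.tendsto_Lp_iff_tendsto_eLpNorm'' _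
      (fun j => memLp_damping_mul (N + 4) (hs j).le hLk) _ hLk).2
      (tendsto_eLpNorm_damping (N + 4) hLk hs hs0)
    refine hcl.mem_of_tendsto hconv (Eventually.of_forall fun j => ?_)
    -- damping of order `N + 4` turns growth of order `N` into quartic decay
    refine exists_opR₀_eq_opU_of_decay (C := fun _ => ((s j) ^ (N + 4))⁻¹ * C)
      (hE.mul_left (differentiableOn_damping (N + 4) (hs j).le)) (fun l hl => ?_)
      (MemLp.coeFn_toLp _)
    have hsj := hs j
    refine ⟨(differentiableOn_damping (N + 4) (hs j).le).mul (hE.holo l), by positivity,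
      fun ζ hζ => ?_⟩
    have h1 := norm_damping_le (N + 4) (hs j) (hs1 j) hζ
    have h2 := hB l hl ζ hζ
    have h3 := one_le_norm_add_I hζ
    rw [norm_mul]
    calc _ ≤ ((s j ^ (N + 4))⁻¹ / ‖ζ.2 + Complex.I‖ ^ (N + 4)) * (C * ‖ζ.2 + Complex.I‖ ^ N) := by
          gcongr
      _ = _ := by
        rw [pow_add (‖ζ.2 + Complex.I‖)]
        field_simp
  rw [hfe]
  refine hcl.mem_of_tendsto ((Lp.tendsto_Lp_iff_tendsto_eLpNorm'' _
    (fun k => memLp_comp_liftPoint hL (hs k).le) _ hL).2 (tendsto_eLpNorm_liftPoint hL hs hs0))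
    (Eventually.of_forall hlift)

end Approximation

/-! ### The unitary operator `R_{(n,1)}` -/

section Unitary

lemma opU_injective : Function.Injective opU := fun f g h => by
  rw [← sub_eq_zero, ← norm_eq_zero, ← norm_opU, map_sub, h, sub_self, norm_zero]

lemma mem_polyBergman_iff (n : ℕ) (f : Lp ℂ 2 siegelMeasure) :
    f ∈ polyBergman n 1 ↔ opU f ∈ Set.range (opR₀ n) := by
  constructor
  · intro hf
    obtain ⟨g, hg⟩ := exists_opR₀_eq_opU n hf
    exact ⟨g, hg.symm⟩
  · rintro ⟨g, hg⟩
    obtain ⟨f', hf', h⟩ := exists_polyBergman_opU_eq n g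
    rwa [opU_injective (hg.symm.trans h.symm)]

/-- The poly-Bergman space is the preimage of the closed range of `R₀` under `U`. -/
lemma isClosed_polyBergman (n : ℕ) :
    IsClosed (polyBergman n 1 : Set (Lp ℂ 2 siegelMeasure)) := by
  have h1 : IsClosed (Set.range (opR₀ n)) :=
    (AddMonoidHomClass.isometry_of_norm (opR₀ n) (norm_opR₀ n)).isClosedEmbedding.isClosed_range
  have h2 : (polyBergman n 1 : Set (Lp ℂ 2 siegelMeasure)) = opU ⁻¹' Set.range (opR₀ n) := by
    ext f
    exact mem_polyBergman_iff n f
  rw [h2]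
  exact h1.preimage opU.continuous

lemma opR_eq_of_opU_eq {n : ℕ} {f : Lp ℂ 2 siegelMeasure} {g : L2n n} (h : opU f = opR₀ n g) :
    opR n f = g := by
  rw [opR, ContinuousLinearMap.comp_apply, h, adjoint_opR₀_opR₀]

lemma adjoint_opR_eq_of_opU_eq {n : ℕ} {f : Lp ℂ 2 siegelMeasure} {g : L2n n}
    (h : opU f = opR₀ n g) : ContinuousLinearMap.adjoint (opR n) g = f := by
  rw [opR, ContinuousLinearMap.adjoint_comp, ContinuousLinearMap.adjoint_adjoint,
    ContinuousLinearMap.comp_apply, ← h, ← ContinuousLinearMap.comp_apply,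
    (ContinuousLinearMap.norm_map_iff_adjoint_comp_self opU).1 norm_opU]
  rfl

/-- The restriction of `R_{(n,1)}` to the poly-Bergman space, as a unitary operator. -/
noncomputable def bargmannEquiv (n : ℕ) : polyBergman n 1 ≃ₗᵢ[ℂ] L2n n :=
  LinearIsometryEquiv.ofSurjective
    { toLinearMap := (opR n).toLinearMap ∘ₗ (polyBergman n 1).subtype
      norm_map' := fun f => by
        obtain ⟨g, hg⟩ := exists_opR₀_eq_opU n f.2
        change ‖opR n f‖ = ‖(f : Lp ℂ 2 siegelMeasure)‖
        rw [opR_eq_of_opU_eq hg, ← norm_opR₀, ← hg, norm_opU] }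
    fun g => by
      obtain ⟨f, hf, h⟩ := exists_polyBergman_opU_eq n g
      exact ⟨⟨f, hf⟩, opR_eq_of_opU_eq h⟩

lemma bargmannEquiv_apply (n : ℕ) (f : polyBergman n 1) : bargmannEquiv n f = opR n f := rfl

lemma opU_bargmannEquiv_symm (n : ℕ) (g : L2n n) :
    opU ((bargmannEquiv n).symm g : Lp ℂ 2 siegelMeasure) = opR₀ n g := by
  obtain ⟨f, hf, h⟩ := exists_polyBergman_opU_eq n g
  have : (bargmannEquiv n).symm g = ⟨f, hf⟩ := by
    rw [LinearIsometryEquiv.symm_apply_eq, bargmannEquiv_apply]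
    exact (opR_eq_of_opU_eq h).symm
  rw [this, h]

/-- `R_{(n,1)}` does not see the component orthogonal to the poly-Bergman space. -/
lemma opR_orthogonalProjection (n : ℕ) [(polyBergman n 1).HasOrthogonalProjection]
    (f : Lp ℂ 2 siegelMeasure) :
    opR n ((polyBergman n 1).orthogonalProjectionOnto f : Lp ℂ 2 siegelMeasure) = opR n f := by
  refine ext_inner_left ℂ fun g => ?_
  obtain ⟨f', hf', h⟩ := exists_polyBergman_opU_eq n g
  rw [← ContinuousLinearMap.adjoint_inner_left, ← ContinuousLinearMap.adjoint_inner_left,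
    adjoint_opR_eq_of_opU_eq h]
  have := Submodule.inner_orthogonalProjectionOnto_eq_of_mem_left (K := polyBergman n 1) ⟨f', hf'⟩ f
  exact this

end Unitary

/-! ### Toeplitz operators with nilpotent symbols -/

section Symbol

lemma aestronglyMeasurable_symbol {c : ℝ × ℝ → ℂ}
    (hc : MemLp (nilpotentSymbol c) ∞ siegelMeasure) :
    AEStronglyMeasurable c halfPlaneMeasure ∧ ∃ C, ∀ᵐ y ∂halfPlaneMeasure, ‖c y‖ ≤ C := by
  have hk : nilpotentSymbol c ∘ kappa = fun p => c p.2 := by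
    ext p
    simp [nilpotentSymbol, kappa, ← Complex.ofReal_pow]
  have h1 : MemLp (fun p : (ℝ × ℝ) × (ℝ × ℝ) => c p.2) ∞ flatMeasure := by
    rw [← hk]
    exact hc.comp_measurePreserving measurePreserving_kappa
  have hne : (ae (volume : Measure (ℝ × ℝ))).NeBot := inferInstance
  constructor
  · exact h1.1.prodMk_left.exists.choose_spec
  · have h2 : ∀ᵐ p ∂flatMeasure, ‖c p.2‖ ≤
        (eLpNorm (fun p : (ℝ × ℝ) × (ℝ × ℝ) => c p.2) ∞ flatMeasure).toReal := by
      filter_upwards [ae_le_eLpNormEssSup (f := fun p : (ℝ × ℝ) × (ℝ × ℝ) => c p.2)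
        (μ := flatMeasure)] with p hp
      rw [← eLpNorm_exponent_top, ← ofReal_norm] at hp
      exact (ENNReal.ofReal_le_iff_le_toReal h1.2.ne).1 hp
    obtain ⟨x, hx⟩ := (Measure.ae_ae_of_ae_prod h2).exists
    exact ⟨_, hx⟩

/-- `(y₁, y₂) ↦ ((-x₁ + y₁) / (2√x₂), y₂ / (2x₂))`. -/
noncomputable def symbolMap (x y : ℝ × ℝ) : ℝ × ℝ := ((-x.1 + y.1) / (2 * √x.2), y.2 / (2 * x.2))

lemma quasiMeasurePreserving_symbolMap {x : ℝ × ℝ} (hx : x ∈ halfPlane) :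
    Measure.QuasiMeasurePreserving (symbolMap x) halfPlaneMeasure halfPlaneMeasure := by
  have h0 : 0 < x.2 := hx
  have h1 : Measure.QuasiMeasurePreserving (fun y : ℝ => (-x.1 + y) / (2 * √x.2)) := by
    have hr : (2 * √x.2)⁻¹ ≠ 0 := by positivity
    have ha : Measure.QuasiMeasurePreserving (fun y : ℝ => y * (2 * √x.2)⁻¹) := by
      refine ⟨by fun_prop, ?_⟩
      rw [Real.map_volume_mul_right hr]
      exact Measure.smul_absolutelyContinuous
    exact ha.comp (measurePreserving_add_left volume (-x.1)).quasiMeasurePreserving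
  have h2 : Measure.QuasiMeasurePreserving (fun y : ℝ => y / (2 * x.2))
      (volume.restrict (Set.Ioi 0)) (volume.restrict (Set.Ioi 0)) := by
    refine ⟨by fun_prop, ?_⟩
    conv_rhs => rw [← map_scale (2 * x.2) (by positivity)]
    refine Measure.absolutelyContinuous_smul ?_
    simp [h0]
  rw [halfPlaneMeasure_eq]
  refine ⟨h1.measurable.prodMap h2.measurable, ?_⟩
  change Measure.map (Prod.map (fun y => (-x.1 + y) / (2 * √x.2)) fun y => y / (2 * x.2)) _ ≪ _
  rw [← Measure.map_prod_map _ _ h1.measurable h2.measurable]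
  exact h1.absolutelyContinuous.prod h2.absolutelyContinuous

lemma gammaIntegrand_eq (n : ℕ) (c : ℝ × ℝ → ℂ) (x y : ℝ × ℝ) (j k : Fin n) :
    gammaIntegrand n c x y j k = c (symbolMap x y) * (basisFun j y * basisFun k y) := by
  simp only [gammaIntegrand, symbolMap, basisFun, Matrix.of_apply]
  ring

lemma integrable_gammaIntegrand {c : ℝ × ℝ → ℂ} {C : ℝ}
    (hcm : AEStronglyMeasurable c halfPlaneMeasure)
    (hcb : ∀ᵐ y ∂halfPlaneMeasure, ‖c y‖ ≤ C) (n : ℕ) {x : ℝ × ℝ} (hx : x ∈ halfPlane)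
    (j k : Fin n) : Integrable (fun y => gammaIntegrand n c x y j k) halfPlaneMeasure := by
  simp_rw [gammaIntegrand_eq]
  have hq := quasiMeasurePreserving_symbolMap hx
  exact ((memLp_basisFun j).integrable_mul (memLp_basisFun k)).bdd_mul
    (hcm.comp_quasiMeasurePreserving hq) (hq.ae hcb)

lemma gammaFun_eq {c : ℝ × ℝ → ℂ} {C : ℝ} (hcm : AEStronglyMeasurable c halfPlaneMeasure)
    (hcb : ∀ᵐ y ∂halfPlaneMeasure, ‖c y‖ ≤ C) (n : ℕ) {x : ℝ × ℝ} (hx : x ∈ halfPlane)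
    (j k : Fin n) : gammaFun n c x j k =
      ∫ y, c (symbolMap x y) * (basisFun j y * basisFun k y) ∂halfPlaneMeasure := by
  have h := integrable_gammaIntegrand hcm hcb n hx j k
  simp_rw [← gammaIntegrand_eq n c x]
  rw [halfPlaneMeasure_eq] at h ⊢
  rw [integral_prod _ h]
  rfl

/-- Compressing multiplication by the symbol to the fibres spanned by the `h_k ℓ₀` gives the matrix
`γ^c`. -/
lemma opR_mul_coeFn {c : ℝ × ℝ → ℂ} {C : ℝ} (hcm : AEStronglyMeasurable c halfPlaneMeasure)
    (hcb : ∀ᵐ y ∂halfPlaneMeasure, ‖c y‖ ≤ C) {n : ℕ} {f h : Lp ℂ 2 siegelMeasure} {g : L2n n}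
    (hf : h =ᵐ[siegelMeasure] fun ζ => nilpotentSymbol c ζ * f ζ) (hg : opU f = opR₀ n g)
    (j : Fin n) : (opR n h j : ℝ × ℝ → ℂ) =ᵐ[halfPlaneMeasure]
      fun x => (gammaFun n c x).mulVec (fun k => (g k : ℝ × ℝ → ℂ) x) j := by
  have h1 := opU_mul hcm hcb f h hf
  rw [hg] at h1
  filter_upwards [adjoint_opR₀_coeFn n (opU h) j,
    ae_restrict_of_ae (Measure.ae_ae_of_ae_prod h1),
    ae_restrict_of_ae (Measure.ae_ae_of_ae_prod (opR₀_coeFn n g)),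
    ae_restrict_mem measurableSet_halfPlane] with x h2 h3 h4 hx
  have hx0 : 0 < x.2 := hx
  rw [opR, ContinuousLinearMap.comp_apply, h2]
  have h5 : ∫ y, opU h (x, y) * basisFun j y ∂halfPlaneMeasure = ∫ y, ∑ k : Fin n,
      g k x * (c (symbolMap x y) * (basisFun j y * basisFun k y)) ∂halfPlaneMeasure := by
    refine integral_congr_ae ?_
    filter_upwards [h3, h4] with y h6 h7
    have hσ : (psi₁ (psi₂ (x, y))).2 = symbolMap x y := by
      simp only [psi₁, psi₂, symbolMap, abs_of_pos hx0]
      ext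
      · simp only; ring
      · rfl
    rw [h6, h7, hσ, Finset.mul_sum, Finset.sum_mul]
    refine Finset.sum_congr rfl fun k _ => ?_
    rw [Set.indicator_of_mem hx]
    ring
  rw [h5, integral_finsetSum]
  · simp only [Matrix.mulVec, dotProduct, gammaFun_eq hcm hcb n hx, integral_const_mul]
    exact Finset.sum_congr rfl fun k _ => mul_comm _ _
  · intro k _
    have := integrable_gammaIntegrand hcm hcb n hx j k
    simp_rw [gammaIntegrand_eq] at this
    exact this.const_mul _

end Symbol

end SiegelToeplitz

open SiegelToeplitz
theorem mainTheorem4 (n : ℕ) (hn : 1 ≤ n) (c : ℝ × ℝ → ℂ)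
    (hc : MemLp (nilpotentSymbol c) ∞ siegelMeasure) :
    -- the integral defining `γ^c(x₁, x₂)` converges absolutely
    (∀ x ∈ halfPlane, ∀ j k : Fin n,
      Integrable (fun y => gammaIntegrand n c x y j k) halfPlaneMeasure) ∧
    -- `A²_{(n,1)}(D₂)` is closed in `L²(D₂)`, so that the orthogonal projection onto it exists
    ∃ _ : (polyBergman n 1).HasOrthogonalProjection,
    -- `R_{(n,1)}` restricts to a unitary operator `W` of `A²_{(n,1)}(D₂)` onto `(L²(ℝ × ℝ₊))ⁿ`,
    -- with inverse `R_{(n,1)}^*`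
    ∃ W : polyBergman n 1 ≃ₗᵢ[ℂ] L2n n,
      (∀ f : polyBergman n 1, W f = opR n f) ∧
      (∀ g : L2n n, (W.symm g : Lp ℂ 2 siegelMeasure) = ContinuousLinearMap.adjoint (opR n) g) ∧
      -- `R_{(n,1)} T_c R_{(n,1)}^*` is multiplication by `γ^c`
      ∀ (g : L2n n) (j : Fin n),
        (W (toeplitz (polyBergman n 1) (hc.toLp _) (W.symm g)) j : ℝ × ℝ → ℂ)
          =ᵐ[halfPlaneMeasure]
            fun x => (gammaFun n c x).mulVec (fun k => (g k : ℝ × ℝ → ℂ) x) j := by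
  obtain ⟨hcm, C, hcb⟩ := aestronglyMeasurable_symbol hc
  have hcl := isClosed_polyBergman n
  have hcs : CompleteSpace (polyBergman n 1) := hcl.completeSpace_coe
  refine ⟨fun x hx j k => integrable_gammaIntegrand hcm hcb n hx j k, inferInstance,
    bargmannEquiv n, bargmannEquiv_apply n, fun g => ?_, fun g j => ?_⟩
  · exact (adjoint_opR_eq_of_opU_eq (opU_bargmannEquiv_symm n g)).symm
  · rw [bargmannEquiv_apply]
    simp only [toeplitz, ContinuousLinearMap.comp_apply, opR_orthogonalProjection]
    refine opR_mul_coeFn hcm hcb ?_ (opU_bargmannEquiv_symm n g) j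
    filter_upwards [(ContinuousLinearMap.mul ℂ ℂ).coeFn_holder (r := 2) (hc.toLp _)
      ((bargmannEquiv n).symm g : Lp ℂ 2 siegelMeasure), hc.coeFn_toLp] with ζ h1 h2
    refine h1.trans ?_
    rw [h2]
    rfl
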